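/- Let $d\in\mathbb N$, $d\ge 1$, $k\in\mathbb N_0$, $p\in(1,\infty)$, and let $X$ be a complex Banach space. Put $\mathbb R^d_+=\{x\in\mathbb R^d: x_1>0\}$ and $w_\gamma(x)=|x_1|^\gamma$ for $\gamma\in\mathbb R$. Let $L^p(\mathbb R^d_+,w_\gamma;X)$ be the Bochner space of strongly measurable $f:\mathbb R^d_+\to X$ with $\int_{\mathbb R^d_+}\|f(x)\|_X^p\,w_\gamma(x)\,dx<\infty$, and let $W^{k,p}(\mathbb R^d_+,w_\gamma;X)$ be the space of $X$-valued distributions $f\in\mathcal D'(\mathbb R^d_+;X)$ such that $\partial^\alpha f\in L^p(\mathbb R^d_+,w_\gamma;X)$ for all $|\alpha|\le k$, with norm $\big(\sum_{|\alpha|\le k}\|\partial^\alpha f\|_{L^p(\mathbb R^d_+,w_\gamma;X)}^p\big)^{1/p}$. For $\theta\in(0,1)$, let $[\cdot,\cdot]_\theta$ denote the complex interpolation space of a compatible couple of Banach spaces; here both spaces are viewed as subspaces of $\mathcal D'(\mathbb R^d_+;X)$. Let $-1<\gamma_0<\gamma<\gamma_1<\infty$ and $\theta\in(0,1)$ be such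 that $\gamma=(1-\theta)\gamma_0+\theta\gamma_1$ and $\gamma>kp-1$. Then $$\big[W^{k,p}(\mathbb R^d_+,w_{\gamma_0};X),\,W^{k,p}(\mathbb R^d_+,w_{\gamma_1};X)\big]_\theta = W^{k,p}(\mathbb R^d_+,w_\gamma;X)$$ as subspaces of $\mathcal D'(\mathbb R^d_+;X)$ with equivalent norms, where the constants in the norm equivalence depend only on $p,k,d,\gamma_0,\gamma_1$ and $\theta$ (in particular not on $X$). -/

import Mathlib

open MeasureTheory Set Topology
open scoped ENNReal NNReal BoundedContinuousFunction Distributions LineDeriv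

noncomputable section

/-! ### Complex interpolation of a compatible couple of Banach spaces -/

/-- A compatible couple `(E₀, E₁)`: both spaces are continuously and injectively embedded in
one (Hausdorff) topological vector space `V`. -/
structure CompatibleCouple (E₀ E₁ V : Type*)
    [NormedAddCommGroup E₀] [NormedSpace ℂ E₀] [NormedAddCommGroup E₁] [NormedSpace ℂ E₁]
    [AddCommGroup V] [Module ℂ V] [TopologicalSpace V] where
  incl₀ : E₀ →L[ℂ] V
  incl₁ : E₁ →L[ℂ] V
  injective₀ : Function.Injective incl₀
  injective₁ : Function.Injective incl₁

namespace CompatibleCouple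

variable {E₀ E₁ V : Type*}
  [NormedAddCommGroup E₀] [NormedSpace ℂ E₀] [NormedAddCommGroup E₁] [NormedSpace ℂ E₁]
  [AddCommGroup V] [Module ℂ V] [TopologicalSpace V] [T2Space V] [ContinuousAdd V]
  (A : CompatibleCouple E₀ E₁ V)

/-- The pairs `(a, b)` with `a + b = 0` in `V`. -/
def zeroPairs : Submodule ℂ (E₀ × E₁) :=
  LinearMap.ker (A.incl₀.coprod A.incl₁ : E₀ × E₁ →ₗ[ℂ] V)

instance isClosed_zeroPairs : IsClosed (A.zeroPairs : Set (E₀ × E₁)) :=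
  (A.incl₀.coprod A.incl₁).isClosed_ker

/-- The sum space `E₀ + E₁`, as the quotient of `E₀ × E₁` by the pairs with zero sum. Its
quotient norm is `x ↦ inf {max ‖a‖ ‖b‖ | x = a + b}`, which is equivalent to
the usual norm `x ↦ inf {‖a‖ + ‖b‖ | x = a + b}`. -/
abbrev SumSpace : Type _ := (E₀ × E₁) ⧸ A.zeroPairs

/-- The embedding of `E₀` into `E₀ + E₁`. -/
def toSum₀ : E₀ →ₗ[ℂ] A.SumSpace := A.zeroPairs.mkQ ∘ₗ LinearMap.inl ℂ E₀ E₁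

/-- The embedding of `E₁` into `E₀ + E₁`. -/
def toSum₁ : E₁ →ₗ[ℂ] A.SumSpace := A.zeroPairs.mkQ ∘ₗ LinearMap.inr ℂ E₀ E₁

/-- The embedding of `E₀ + E₁` into `V`. -/
def sumIncl : A.SumSpace →ₗ[ℂ] V :=
  A.zeroPairs.liftQ (A.incl₀.coprod A.incl₁ : E₀ × E₁ →ₗ[ℂ] V) le_rfl

/-- The functions admissible in the complex interpolation method: bounded continuous functions
from the closed strip `0 ≤ Re z ≤ 1` to `E₀ + E₁`, holomorphic in the open strip, such that
`t ↦ f (j + it)` is a bounded continuous function with values in `E_j` for `j = 0, 1`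
(these functions are `bd₀` and `bd₁`). The values of `toFun` off the closed strip are
irrelevant. -/
structure StripFunction where
  toFun : ℂ → A.SumSpace
  bd₀ : ℝ →ᵇ E₀
  bd₁ : ℝ →ᵇ E₁
  diffContOnCl : DiffContOnCl ℂ toFun (Complex.HadamardThreeLines.verticalStrip 0 1)
  bounded : ∃ M : ℝ, ∀ z ∈ Complex.HadamardThreeLines.verticalClosedStrip 0 1, ‖toFun z‖ ≤ M
  eq_bd₀ : ∀ t : ℝ, toFun (t * Complex.I) = A.toSum₀ (bd₀ t)
  eq_bd₁ : ∀ t : ℝ, toFun (1 + t * Complex.I) = A.toSum₁ (bd₁ t)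

/-- The norm `max (sup_t ‖f (it)‖_{E₀}) (sup_t ‖f (1 + it)‖_{E₁})`. -/
def StripFunction.size {A : CompatibleCouple E₀ E₁ V} (f : A.StripFunction) : ℝ :=
  max ‖f.bd₀‖ ‖f.bd₁‖

/-- The complex interpolation space `[E₀, E₁]_θ`, as a subspace of `V`: the values at `θ` of the
admissible functions. -/
def interpolationSpace (θ : ℝ) : Submodule ℂ V where
  carrier := {v | ∃ f : A.StripFunction, A.sumIncl (f.toFun θ) = v}
  zero_mem' := by
    refine ⟨⟨fun _ => 0, 0, 0, diffContOnCl_const, ⟨0, by simp⟩, by simp, by simp⟩, by simp⟩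
  add_mem' := by
    rintro _ _ ⟨f, rfl⟩ ⟨g, rfl⟩
    obtain ⟨M, hM⟩ := f.bounded
    obtain ⟨N, hN⟩ := g.bounded
    exact ⟨⟨fun z => f.toFun z + g.toFun z, f.bd₀ + g.bd₀, f.bd₁ + g.bd₁,
      f.diffContOnCl.add g.diffContOnCl,
      ⟨M + N, fun z hz => (norm_add_le _ _).trans (add_le_add (hM z hz) (hN z hz))⟩,
      fun t => by simp [f.eq_bd₀, g.eq_bd₀], fun t => by simp [f.eq_bd₁, g.eq_bd₁]⟩, by simp⟩
  smul_mem' := by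
    rintro c _ ⟨f, rfl⟩
    obtain ⟨M, hM⟩ := f.bounded
    exact ⟨⟨fun z => c • f.toFun z, c • f.bd₀, c • f.bd₁, f.diffContOnCl.const_smul c,
      ⟨‖c‖ * M, fun z hz => by
        rw [norm_smul]; exact mul_le_mul_of_nonneg_left (hM z hz) (norm_nonneg c)⟩,
      fun t => by simp [f.eq_bd₀], fun t => by simp [f.eq_bd₁]⟩, by simp⟩

/-- The norm of `[E₀, E₁]_θ`: the infimum of the norms of the admissible functions `f` with
`f θ = v`. (Only meaningful for `v` in the interpolation space.) -/
def interpolationNorm (θ : ℝ) (v : V) : ℝ :=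
  sInf {r : ℝ | ∃ f : A.StripFunction, A.sumIncl (f.toFun θ) = v ∧ f.size = r}

end CompatibleCouple

/-! ### Weighted Lebesgue spaces on the half-space -/

/-- The half-space `{x ∈ ℝᵈ | x₁ > 0}`; the first coordinate has index `0`. -/
def halfSpace (d : ℕ) [NeZero d] : TopologicalSpace.Opens (EuclideanSpace ℝ (Fin d)) where
  carrier := {x | 0 < x 0}
  is_open' := isOpen_lt continuous_const (by fun_prop)

/-- The measure `|x₁|^γ dx` on the half-space. -/
def powerMeasure (d : ℕ) [NeZero d] (γ : ℝ) : Measure (EuclideanSpace ℝ (Fin d)) :=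
  (volume.restrict (halfSpace d)).withDensity fun x => ENNReal.ofReal (|x 0| ^ γ)

section Distributions

variable (d : ℕ) [NeZero d] (X : Type*) [NormedAddCommGroup X] [NormedSpace ℂ X]

/-- The weighted Lebesgue (Bochner) space `L^p(ℝᵈ₊, w_γ; X)`. -/
abbrev WeightedLp (p : ℝ≥0∞) (γ : ℝ) : Type _ := Lp X p (powerMeasure d γ)

variable {d} {X}

theorem restrict_le_powerMeasure (γ : ℝ) {K : Set (EuclideanSpace ℝ (Fin d))}
    (hK : IsCompact K) (hKH : K ⊆ halfSpace d) :
    ∃ c : ℝ≥0, volume.restrict K ≤ (c : ℝ≥0∞) • powerMeasure d γ := by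
  have hcont : ContinuousOn (fun x : EuclideanSpace ℝ (Fin d) => |x 0| ^ (-γ)) K := by
    intro x hx
    have hx0 : 0 < x 0 := hKH hx
    refine ContinuousAt.continuousWithinAt (ContinuousAt.rpow_const (by fun_prop) (Or.inl ?_))
    exact (abs_pos.2 hx0.ne').ne'
  obtain ⟨c, hc⟩ := (hK.image_of_continuousOn hcont).isBounded.bddAbove
  refine ⟨c.toNNReal, ?_⟩
  have hm : Measurable fun x : EuclideanSpace ℝ (Fin d) => ENNReal.ofReal (|x 0| ^ γ) := by
    fun_prop
  refine Measure.le_iff.2 fun s hs => ?_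
  rw [Measure.smul_apply, powerMeasure, withDensity_apply _ hs, smul_eq_mul,
    ← lintegral_const_mul _ hm, Measure.restrict_restrict hs]
  calc volume.restrict K s = ∫⁻ _ in s ∩ K, 1 := by simp [Measure.restrict_apply hs]
    _ ≤ ∫⁻ x in s ∩ K, (c.toNNReal : ℝ≥0∞) * ENNReal.ofReal (|x 0| ^ γ) := by
      refine setLIntegral_mono' (hs.inter hK.measurableSet) fun x hx => ?_
      have hx0 : 0 < |x 0| := abs_pos.2 (ne_of_gt (hKH hx.2))
      have h1 : |x 0| ^ (-γ) ≤ c := hc ⟨x, hx.2, rfl⟩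
      have h2 : 0 ≤ c := (Real.rpow_nonneg hx0.le _).trans h1
      change 1 ≤ ENNReal.ofReal c * ENNReal.ofReal (|x 0| ^ γ)
      rw [← ENNReal.ofReal_mul h2, ← ENNReal.ofReal_one]
      refine ENNReal.ofReal_le_ofReal ?_
      calc (1 : ℝ) = |x 0| ^ (-γ) * |x 0| ^ γ := by
            rw [← Real.rpow_add hx0]; simp
        _ ≤ c * |x 0| ^ γ := by gcongr
    _ ≤ _ := lintegral_mono_set (inter_subset_inter_right s hKH)

theorem ae_powerMeasure (γ : ℝ) :
    ae (powerMeasure d γ) = ae (volume.restrict (halfSpace d : Set (EuclideanSpace ℝ (Fin d)))) := by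
  refine le_antisymm (withDensity_absolutelyContinuous _ _).ae_le
    (withDensity_absolutelyContinuous' (by fun_prop) ?_).ae_le
  filter_upwards [ae_restrict_mem (halfSpace d).isOpen.measurableSet] with x hx
  have hx0 : 0 < |x 0| := abs_pos.2 (ne_of_gt hx)
  have := Real.rpow_pos_of_pos hx0 γ
  simpa using this

variable {p : ℝ≥0∞} [Fact (1 ≤ p)]

theorem integrableOn_weightedLp {X : Type*} [NormedAddCommGroup X] (γ : ℝ)
    {K : Set (EuclideanSpace ℝ (Fin d))}
    (hK : IsCompact K) (hKH : K ⊆ halfSpace d) :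
    ∃ C : ℝ, 0 ≤ C ∧ ∀ f : WeightedLp d X p γ,
      IntegrableOn f K volume ∧ ∫ x in K, ‖f x‖ ≤ C * ‖f‖ := by
  obtain ⟨c, hc⟩ := restrict_le_powerMeasure γ hK hKH
  have hp1 : (1 : ℝ≥0∞) ≤ p := Fact.out
  set D : ℝ≥0∞ := (c : ℝ≥0∞) ^ (1 / p).toReal *
    (volume.restrict K) univ ^ (1 / (1 : ℝ≥0∞).toReal - 1 / p.toReal) with hD
  have hfin : (volume.restrict K) univ ≠ ∞ := by simpa using hK.measure_lt_top.ne
  have hexp : 0 ≤ 1 / (1 : ℝ≥0∞).toReal - 1 / p.toReal := by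
    rcases eq_or_ne p ∞ with rfl | hpt
    · simp
    · have : 1 ≤ p.toReal := by simpa using ENNReal.toReal_mono hpt hp1
      have := inv_le_one_of_one_le₀ this
      simpa using this
  have hDt : D ≠ ∞ := ENNReal.mul_ne_top (ENNReal.rpow_ne_top_of_nonneg (by positivity) (by simp))
    (ENNReal.rpow_ne_top_of_nonneg hexp hfin)
  refine ⟨D.toReal, ENNReal.toReal_nonneg, fun f => ?_⟩
  have hmeas : AEStronglyMeasurable f (volume.restrict K) :=
    ((Lp.aestronglyMeasurable f).smul_measure (c : ℝ≥0∞)).mono_measure hc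
  have key : eLpNorm f 1 (volume.restrict K) ≤ D * eLpNorm f p (powerMeasure d γ) := by
    calc eLpNorm f 1 (volume.restrict K)
        ≤ eLpNorm f p (volume.restrict K) *
          (volume.restrict K) univ ^ (1 / (1 : ℝ≥0∞).toReal - 1 / p.toReal) :=
          eLpNorm_le_eLpNorm_mul_rpow_measure_univ hp1 hmeas
      _ ≤ ((c : ℝ≥0∞) ^ (1 / p).toReal • eLpNorm f p (powerMeasure d γ)) *
          (volume.restrict K) univ ^ (1 / (1 : ℝ≥0∞).toReal - 1 / p.toReal) := by
          gcongr
          exact (eLpNorm_mono_measure _ hc).trans (eLpNorm_smul_measure_le _ _ _ _)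
      _ = _ := by rw [hD, smul_eq_mul]; ring
  have hft : D * eLpNorm f p (powerMeasure d γ) ≠ ∞ := ENNReal.mul_ne_top hDt (Lp.eLpNorm_ne_top f)
  have hint : IntegrableOn f K volume :=
    memLp_one_iff_integrable.1 ⟨hmeas, key.trans_lt hft.lt_top⟩
  refine ⟨hint, ?_⟩
  rw [integral_norm_eq_lintegral_enorm hmeas, ← eLpNorm_one_eq_lintegral_enorm, Lp.norm_def,
    ← ENNReal.toReal_mul]
  exact ENNReal.toReal_mono hft key

theorem locallyIntegrableOn_weightedLp {X : Type*} [NormedAddCommGroup X] {γ : ℝ}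
    (f : WeightedLp d X p γ) :
    LocallyIntegrableOn f (halfSpace d : Set (EuclideanSpace ℝ (Fin d))) volume := by
  rw [locallyIntegrableOn_iff (halfSpace d).isOpen.isLocallyClosed]
  intro K hKH hK
  obtain ⟨C, -, hC⟩ := integrableOn_weightedLp (X := X) (p := p) γ hK hKH
  exact (hC f).1

/-- The pairing of a test function with a function in the weighted Lebesgue space. -/
theorem integrable_testFunction_smul {γ : ℝ} (f : WeightedLp d X p γ) (φ : 𝓓(halfSpace d, ℝ)) :
    Integrable (fun x => φ x • f x) volume :=
  φ.integrable_bilin (ContinuousLinearMap.lsmul ℝ ℝ) (locallyIntegrableOn_weightedLp f)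

/-- The `X`-valued distribution `φ ↦ ∫ φ g` on the half-space. -/
def regularDistribution (g : EuclideanSpace ℝ (Fin d) → X) : 𝓓'(halfSpace d, X) :=
  ContinuousLinearMap.toUniformConvergenceCLM _ _ _
    (TestFunction.integralAgainstBilinCLM (ContinuousLinearMap.lsmul ℝ ℝ) volume g)

theorem regularDistribution_apply {γ : ℝ} (f : WeightedLp d X p γ) (φ : 𝓓(halfSpace d, ℝ)) :
    regularDistribution f φ = ∫ x, φ x • f x :=
  TestFunction.integralAgainstBilinCLM_eq_integral (locallyIntegrableOn_weightedLp f)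

theorem ae_volume_of_ae {γ : ℝ} {P : EuclideanSpace ℝ (Fin d) → Prop}
    (h : ∀ᵐ x ∂(powerMeasure d γ), P x) (φ : 𝓓(halfSpace d, ℝ)) :
    ∀ᵐ x, φ x = 0 ∨ P x := by
  have h' : ∀ᵐ x ∂(volume.restrict (halfSpace d : Set (EuclideanSpace ℝ (Fin d)))), P x := by
    rw [Filter.Eventually, ← ae_powerMeasure γ]; exact h
  rw [ae_restrict_iff' (halfSpace d).isOpen.measurableSet] at h'
  filter_upwards [h'] with x hx
  by_cases hxH : x ∈ (halfSpace d : Set (EuclideanSpace ℝ (Fin d)))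
  · exact Or.inr (hx hxH)
  · exact Or.inl (image_eq_zero_of_notMem_tsupport fun h => hxH (φ.tsupport_subset h))

/-- The map `f ↦ (φ ↦ ∫ φ f)` from the weighted Lebesgue space to distributions. -/
def lpToDistribution (d : ℕ) [NeZero d] (X : Type*) [NormedAddCommGroup X] [NormedSpace ℂ X]
    (p : ℝ≥0∞) [Fact (1 ≤ p)] (γ : ℝ) : WeightedLp d X p γ →ₗ[ℂ] 𝓓'(halfSpace d, X) where
  toFun f := regularDistribution f
  map_add' f g := by
    ext φ
    change _ = regularDistribution f φ + regularDistribution g φ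
    simp only [regularDistribution_apply]
    rw [← integral_add (integrable_testFunction_smul f φ) (integrable_testFunction_smul g φ)]
    refine integral_congr_ae ?_
    filter_upwards [ae_volume_of_ae (Lp.coeFn_add f g) φ] with x hx
    rcases hx with hx | hx
    · simp [hx]
    · rw [hx, Pi.add_apply, smul_add]
  map_smul' c f := by
    ext φ
    change _ = c • regularDistribution f φ
    simp only [regularDistribution_apply]
    rw [← integral_smul]
    refine integral_congr_ae ?_
    filter_upwards [ae_volume_of_ae (Lp.coeFn_smul c f) φ] with x hx
    rcases hx with hx | hx
    · simp [hx]
    · rw [hx, Pi.smul_apply, smul_comm]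

theorem lpToDistribution_apply {γ : ℝ} (f : WeightedLp d X p γ) (φ : 𝓓(halfSpace d, ℝ)) :
    lpToDistribution d X p γ f φ = ∫ x, φ x • f x :=
  regularDistribution_apply f φ

theorem lpToDistribution_injective [CompleteSpace X] (γ : ℝ) :
    Function.Injective (lpToDistribution d X p γ) := by
  rw [injective_iff_map_eq_zero]
  intro f hf
  have h := (halfSpace d).isOpen.ae_eq_zero_of_integral_contDiff_smul_eq_zero
    (locallyIntegrableOn_weightedLp f) fun g hg hgc hgs => by
      have := lpToDistribution_apply f ⟨g, hg, hgc, hgs⟩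
      rw [hf] at this
      exact this.symm
  rw [← ae_restrict_iff' (halfSpace d).isOpen.measurableSet, Filter.Eventually,
    ← ae_powerMeasure γ] at h
  exact (Lp.eq_zero_iff_ae_eq_zero).2 h

theorem norm_lpToDistribution_le (γ : ℝ) {K : Set (EuclideanSpace ℝ (Fin d))}
    (hK : IsCompact K) (hKH : K ⊆ halfSpace d) :
    ∃ C : ℝ, 0 ≤ C ∧ ∀ (f : WeightedLp d X p γ) (φ : 𝓓(halfSpace d, ℝ)), tsupport φ ⊆ K →
      ∀ M : ℝ, (∀ x, ‖φ x‖ ≤ M) → ‖lpToDistribution d X p γ f φ‖ ≤ C * M * ‖f‖ := by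
  obtain ⟨C, hC0, hC⟩ := integrableOn_weightedLp (X := X) (p := p) γ hK hKH
  refine ⟨C, hC0, fun f φ hφ M hM => ?_⟩
  obtain ⟨hi, hb⟩ := hC f
  have hM0 : 0 ≤ M := (norm_nonneg _).trans (hM 0)
  rw [lpToDistribution_apply]
  have hsupp : ∀ x, x ∉ K → φ x • f x = 0 := fun x hx => by
    rw [image_eq_zero_of_notMem_tsupport fun h => hx (hφ h), zero_smul]
  rw [← setIntegral_eq_integral_of_forall_compl_eq_zero hsupp]
  calc ‖∫ x in K, φ x • f x‖ ≤ ∫ x in K, M * ‖f x‖ := by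
        refine norm_integral_le_of_norm_le (hi.norm.const_mul M) (ae_of_all _ fun x => ?_)
        rw [norm_smul]; gcongr; exact hM x
    _ = M * ∫ x in K, ‖f x‖ := integral_const_mul _ _
    _ ≤ M * (C * ‖f‖) := by gcongr
    _ = C * M * ‖f‖ := by ring

/-- Convergence in the weighted Lebesgue space implies convergence of distributions. -/
theorem continuous_lpToDistribution (γ : ℝ) : Continuous (lpToDistribution d X p γ) := by
  let B : 𝓓(halfSpace d, ℝ) →ₗ[ℝ] (WeightedLp d X p γ →L[ℂ] X) :=
    { toFun := fun φ => LinearMap.mkContinuousOfExistsBound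
        { toFun := fun f => lpToDistribution d X p γ f φ
          map_add' := fun f g => by rw [map_add]; rfl
          map_smul' := fun c f => by rw [map_smul]; rfl }
        (by
          obtain ⟨C, -, hC⟩ := norm_lpToDistribution_le (X := X) (p := p) γ
            φ.hasCompactSupport φ.tsupport_subset
          obtain ⟨M, hM⟩ := φ.hasCompactSupport.exists_bound_of_continuous φ.continuous
          exact ⟨C * M, fun f => hC f φ le_rfl M hM⟩)
      map_add' := fun φ ψ => by
        ext f; exact map_add (lpToDistribution d X p γ f) φ ψ
      map_smul' := fun c φ => by
        ext f; exact map_smul (lpToDistribution d X p γ f) c φ }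
  have hB : Continuous B := by
    rw [TestFunction.continuous_iff_continuous_comp]
    intro K hK
    obtain ⟨C, hC0, hC⟩ := norm_lpToDistribution_le (X := X) (p := p) γ K.isCompact hK
    let T : 𝓓^{⊤}_{K}(EuclideanSpace ℝ (Fin d), ℝ) →ₗ[ℝ] (WeightedLp d X p γ →L[ℂ] X) :=
      B ∘ₗ (TestFunction.ofSupportedInCLM ℝ hK).toLinearMap
    have hT : ∀ φ, ‖T φ‖ ≤ C * ‖ContDiffMapSupportedIn.toBoundedContinuousFunctionCLM ℝ φ‖ := by
      intro φ
      refine ContinuousLinearMap.opNorm_le_bound _ (by positivity) fun f => ?_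
      exact hC f (TestFunction.ofSupportedIn hK φ) φ.tsupport_subset _
        fun x => (ContDiffMapSupportedIn.toBoundedContinuousFunctionCLM ℝ φ).norm_coe_le_norm x
    change Continuous T
    refine continuous_of_continuousAt_zero T ?_
    rw [ContinuousAt, map_zero]
    refine squeeze_zero_norm hT ?_
    have h1 : Continuous fun φ : 𝓓^{⊤}_{K}(EuclideanSpace ℝ (Fin d), ℝ) =>
        C * ‖ContDiffMapSupportedIn.toBoundedContinuousFunctionCLM ℝ φ‖ := by fun_prop
    exact h1.tendsto' 0 0 (by rw [map_zero, norm_zero, mul_zero])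
  refine continuous_of_continuousAt_zero (lpToDistribution d X p γ) ?_
  rw [ContinuousAt, map_zero, (CompactConvergenceCLM.hasBasis_nhds_zero_of_basis
    (Metric.nhds_basis_ball)).tendsto_right_iff]
  rintro ⟨S, ε⟩ ⟨hS, hε⟩
  obtain ⟨M, hM⟩ := (hS.image hB).isBounded.exists_norm_le
  have hM' : ∀ φ ∈ S, ‖B φ‖ ≤ M := fun φ hφ => hM _ ⟨φ, hφ, rfl⟩
  have hlim : Filter.Tendsto (fun f : WeightedLp d X p γ => |M| * ‖f‖) (𝓝 0) (𝓝 0) := by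
    have : Continuous fun f : WeightedLp d X p γ => |M| * ‖f‖ := by fun_prop
    simpa using this.tendsto 0
  filter_upwards [hlim.eventually_lt_const hε] with f hf φ hφ
  rw [mem_ball_zero_iff]
  calc ‖B φ f‖ ≤ ‖B φ‖ * ‖f‖ := (B φ).le_opNorm f
    _ ≤ |M| * ‖f‖ := by gcongr; exact (hM' φ hφ).trans (le_abs_self M)
    _ < ε := hf

/-! ### Weighted Sobolev spaces -/

/-- Multi-indices of length `d` and order at most `k`. -/
def MultiIndex (d k : ℕ) : Type := {α : Fin d → ℕ // ∑ i, α i ≤ k}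

instance (d k : ℕ) : Finite (MultiIndex d k) :=
  Finite.of_injective
    (fun (α : MultiIndex d k) (i : Fin d) => (⟨α.1 i, Nat.lt_succ_of_le
      ((Finset.single_le_sum (fun _ _ => Nat.zero_le _) (Finset.mem_univ i)).trans α.2)⟩ :
        Fin (k + 1)))
    fun _ _ h => Subtype.ext (funext fun i => congrArg Fin.val (congrFun h i))

instance (d k : ℕ) : Fintype (MultiIndex d k) := Fintype.ofFinite _

instance (d k : ℕ) : Zero (MultiIndex d k) := ⟨⟨0, by simp⟩⟩

/-- The derivative `∂^α = ∂₁^{α₁} ⋯ ∂_d^{α_d}` of distributions on the half-space. -/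
def distribDeriv (α : Fin d → ℕ) : 𝓓'(halfSpace d, X) → 𝓓'(halfSpace d, X) := fun T =>
  (List.finRange d).foldr
    (fun i S => (fun R : 𝓓'(halfSpace d, X) => ∂_{EuclideanSpace.single i (1 : ℝ)} R)^[α i] S) T

theorem distribDeriv_linear (α : Fin d → ℕ) :
    ∃ L : 𝓓'(halfSpace d, X) →ₗ[ℂ] 𝓓'(halfSpace d, X), ∀ T, L T = distribDeriv α T := by
  let D (i : Fin d) : 𝓓'(halfSpace d, X) →ₗ[ℂ] 𝓓'(halfSpace d, X) :=
    { toFun := fun R => ∂_{EuclideanSpace.single i (1 : ℝ)} R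
      map_add' := fun R S => LineDerivAdd.lineDerivOp_add _ R S
      map_smul' := fun c R => by
        ext φ
        rw [Distribution.lineDerivOp_apply_apply]
        change c • R _ = c • (∂_{EuclideanSpace.single i (1 : ℝ)} R) φ
        rw [Distribution.lineDerivOp_apply_apply] }
  have key : ∀ l : List (Fin d), ∃ L : 𝓓'(halfSpace d, X) →ₗ[ℂ] 𝓓'(halfSpace d, X), ∀ T, L T =
      l.foldr (fun i S =>
        (fun R : 𝓓'(halfSpace d, X) => ∂_{EuclideanSpace.single i (1 : ℝ)} R)^[α i] S) T := by
    intro l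
    induction l with
    | nil => exact ⟨LinearMap.id, fun T => rfl⟩
    | cons i l ih =>
      obtain ⟨L, hL⟩ := ih
      refine ⟨((D i) ^ (α i)) ∘ₗ L, fun T => ?_⟩
      rw [List.foldr_cons, ← hL T, LinearMap.comp_apply, Module.End.pow_apply]
      rfl
  exact key _

/-- The weighted Sobolev space `W^{k,p}(ℝᵈ₊, w_γ; X)` with the norm
`(∑_{|α| ≤ k} ‖∂^α f‖^p)^{1/p}`. Its elements are the families `(f_α)_{|α| ≤ k}` in
`L^p(ℝᵈ₊, w_γ; X)` with `f_α = ∂^α f_0` in the sense of distributions, i.e. functions `f = f_0`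
together with their weak derivatives up to order `k`. -/
def weightedSobolev (d : ℕ) [NeZero d] (X : Type*) [NormedAddCommGroup X] [NormedSpace ℂ X]
    (k : ℕ) (p : ℝ≥0∞) [Fact (1 ≤ p)] (γ : ℝ) :
    Submodule ℂ (PiLp p fun _ : MultiIndex d k => WeightedLp d X p γ) where
  carrier := {F | ∀ α, lpToDistribution d X p γ (F α) =
    distribDeriv α.1 (lpToDistribution d X p γ (F 0))}
  zero_mem' := fun α => by
    obtain ⟨L, hL⟩ := distribDeriv_linear (X := X) α.1
    simp [← hL]
  add_mem' := fun {F G} hF hG α => by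
    obtain ⟨L, hL⟩ := distribDeriv_linear (X := X) α.1
    have hF := hF α
    have hG := hG α
    simp only [← hL] at hF hG ⊢
    simp [hF, hG]
  smul_mem' := fun c F hF α => by
    obtain ⟨L, hL⟩ := distribDeriv_linear (X := X) α.1
    have hF := hF α
    simp only [← hL] at hF ⊢
    simp [hF]

/-- The inclusion `W^{k,p}(ℝᵈ₊, w_γ; X) → 𝓓'(ℝᵈ₊; X)`. -/
def sobolevToDistribution (d : ℕ) [NeZero d] (X : Type*) [NormedAddCommGroup X] [NormedSpace ℂ X]
    (k : ℕ) (p : ℝ≥0∞) [Fact (1 ≤ p)] (γ : ℝ) :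
    weightedSobolev d X k p γ →L[ℂ] 𝓓'(halfSpace d, X) :=
  (⟨lpToDistribution d X p γ, continuous_lpToDistribution γ⟩ :
      WeightedLp d X p γ →L[ℂ] 𝓓'(halfSpace d, X)) ∘L
    PiLp.proj p (fun _ : MultiIndex d k => WeightedLp d X p γ) 0 ∘L
    (weightedSobolev d X k p γ).subtypeL

theorem sobolevToDistribution_injective [CompleteSpace X] (k : ℕ) (γ : ℝ) :
    Function.Injective (sobolevToDistribution d X k p γ) := by
  rw [injective_iff_map_eq_zero]
  intro F hF
  have h0 : lpToDistribution d X p γ (F.1 0) = 0 := hF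
  ext1
  refine PiLp.ext fun α => ?_
  obtain ⟨L, hL⟩ := distribDeriv_linear (X := X) α.1
  have h := F.2 α
  rw [h0, ← hL, map_zero] at h
  exact (injective_iff_map_eq_zero _).1 (lpToDistribution_injective γ) _ h

/-- A distribution `f` belongs to `W^{k,p}(ℝᵈ₊, w_γ; X)` if and only if `∂^α f` belongs to
`L^p(ℝᵈ₊, w_γ; X)` for all `|α| ≤ k`. -/
theorem mem_range_sobolevToDistribution (k : ℕ) (γ : ℝ) (f : 𝓓'(halfSpace d, X)) :
    f ∈ Set.range (sobolevToDistribution d X k p γ) ↔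
      ∀ α : MultiIndex d k, ∃ g : WeightedLp d X p γ,
        lpToDistribution d X p γ g = distribDeriv α.1 f := by
  have hz : distribDeriv (0 : MultiIndex d k).1 f = f := by
    change (List.finRange d).foldr (fun _ S => S) f = f
    induction List.finRange d with
    | nil => rfl
    | cons i l ih => exact ih
  constructor
  · rintro ⟨F, rfl⟩ α
    exact ⟨F.1 α, F.2 α⟩
  · intro h
    choose g hg using h
    refine ⟨⟨WithLp.toLp p g, fun α => ?_⟩, ?_⟩
    · change lpToDistribution d X p γ (g α) = distribDeriv α.1 (lpToDistribution d X p γ (g 0))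
      rw [hg, hg, hz]
    · exact (hg 0).trans hz

/-- The couple `(W^{k,p}(ℝᵈ₊, w_{γ₀}; X), W^{k,p}(ℝᵈ₊, w_{γ₁}; X))` inside `𝓓'(ℝᵈ₊; X)`. -/
def sobolevCouple (d : ℕ) [NeZero d] (X : Type*) [NormedAddCommGroup X] [NormedSpace ℂ X]
    [CompleteSpace X] (k : ℕ) (p : ℝ≥0∞) [Fact (1 ≤ p)] (γ₀ γ₁ : ℝ) :
    CompatibleCouple (weightedSobolev d X k p γ₀) (weightedSobolev d X k p γ₁)
      𝓓'(halfSpace d, X) where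
  incl₀ := sobolevToDistribution d X k p γ₀
  incl₁ := sobolevToDistribution d X k p γ₁
  injective₀ := sobolevToDistribution_injective k γ₀
  injective₁ := sobolevToDistribution_injective k γ₁

end Distributions

end

/-! ### Strip functions built from unconditional series -/

noncomputable section

/-! On the dyadic slab `slab d n` the coordinate x₁ is comparable with 2ⁿ, so there all power
weights agree up to a factor: replacing γ' by γ costs 2^(n(γ - γ')). Both inclusions balance this
factor against scalars exp(eₙ(z - θ)), which equal 1 at z = θ and whose modulus depends only on Re
z.

From the Sobolev space into the interpolation space: let (ηₙ) be a smooth dyadic partition of unity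
in x₁ and put f(z) = ∑ₙ 2^(-n(γ₁ - γ₀)(z - θ)/p) ηₙF. Then f(θ) = F. On the line Re z = j the
coefficients convert the weight γⱼ into γ, and since at most three slabs overlap, the norm of f(z)
is controlled by the L^p(w_γ) norms of the derivatives of the pieces ηₙF. By the Leibniz rule a
derivative of order j of ηₙ costs |x₁|^(-j), so |x₁|^(-j) ∂^αF has to be bounded in L^p(w_γ) for |α|
+ j ≤ k. This is an iterated Hardy inequality (`hardy_iterate`, `lintegral_hardySum_rpow_le`), and
it is where γ > kp - 1 enters. Convergence and holomorphy of the series are the abstract statement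
`exists_stripFunction_hasSum`; the inclusion is `exists_stripFunction_sobolevCouple`.

Hardy's inequality is proved for weak derivatives from the identity g(x) = g(2x₁, x') - ∫ t⁻² x₁
∂₁g(x₁/t, x') dt over [1/2, 1] (`ae_eq_comp_dilation_two_sub`). For a weight exponent above -1 the
dilation by 2 is a strict contraction of the weighted norm, so its term can be absorbed on the left.

Conversely, restrict the derivatives of a strip function to the slabs and multiply by scalars of the
opposite sign. The three lines theorem in a finite ℓ^p sum (`StripFunction.sum_enorm_rpow_le`)
bounds the slab norms of f(θ), and adding them up recovers the whole L^p(w_γ) norm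
(`exists_weightedSobolev_of_stripFunction`). No Hardy inequality is needed here. All constants come
from the weights, the overlap number, the partition and Hardy's inequality, hence do not depend on
X. -/

open Complex.HadamardThreeLines in
/-- A special case of the three lines theorem: equal bounds on the two boundary lines. -/
theorem norm_le_of_norm_le_on_strip_boundary {E : Type*} [NormedAddCommGroup E] [NormedSpace ℂ E]
    {f : ℂ → E} (hd : DiffContOnCl ℂ f (verticalStrip 0 1))
    (hB : ∃ M : ℝ, ∀ z ∈ verticalClosedStrip 0 1, ‖f z‖ ≤ M) {M : ℝ}
    (h0 : ∀ t : ℝ, ‖f (t * Complex.I)‖ ≤ M) (h1 : ∀ t : ℝ, ‖f (1 + t * Complex.I)‖ ≤ M)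
    {z : ℂ} (hz : z ∈ verticalClosedStrip 0 1) : ‖f z‖ ≤ M := by
  have hM : 0 ≤ M := (norm_nonneg _).trans (h0 0)
  obtain ⟨B, hB⟩ := hB
  have := norm_le_interp_of_mem_verticalClosedStrip₀₁' f hz hd
    ⟨B, by rintro _ ⟨w, hw, rfl⟩; exact hB w hw⟩ (a := M) (b := M)
    (fun w hw => by
      have : w = (w.im : ℂ) * Complex.I := by
        apply Complex.ext <;> simp; simpa using hw
      rw [this]; exact h0 _)
    (fun w hw => by
      have : w = 1 + (w.im : ℂ) * Complex.I := by
        apply Complex.ext <;> simp; simpa using hw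
      rw [this]; exact h1 _)
  rwa [← Real.rpow_add' hM (by norm_num), sub_add_cancel, Real.rpow_one] at this

/-- The hypothesis covers every finite set, in particular those far out, so the tails of `m` give
Cauchy's criterion. With `q = 1/p` the norms `‖f n‖` themselves need not be summable; only the joint
bound on finite sums is available for almost disjointly supported pieces. -/
theorem summable_of_norm_sum_le_rpow {ι E : Type*} [NormedAddCommGroup E] [CompleteSpace E]
    {f : ι → E} {m : ι → ℝ} (hm0 : ∀ n, 0 ≤ m n) (hm : Summable m) {q : ℝ} (hq : 0 < q)
    (h : ∀ s : Finset ι, ‖∑ n ∈ s, f n‖ ≤ (∑ n ∈ s, m n) ^ q) :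
    Summable f ∧ ‖∑' n, f n‖ ≤ (∑' n, m n) ^ q := by
  have hf : Summable f := by
    rw [summable_iff_vanishing_norm]
    intro ε hε
    obtain ⟨s, hs⟩ := summable_iff_vanishing_norm.1 hm (ε ^ q⁻¹) (by positivity)
    refine ⟨s, fun t ht => (h t).trans_lt ?_⟩
    have h1 := (le_abs_self _).trans_lt (hs t ht)
    have h2 := Real.rpow_lt_rpow (Finset.sum_nonneg fun n _ => hm0 n) h1 hq
    rwa [← Real.rpow_mul hε.le, inv_mul_cancel₀ hq.ne', Real.rpow_one] at h2
  refine ⟨hf, le_of_tendsto hf.hasSum.norm (Filter.Eventually.of_forall fun s => (h s).trans ?_)⟩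
  exact Real.rpow_le_rpow (Finset.sum_nonneg fun n _ => hm0 n)
    (hm.sum_le_tsum s fun n _ => hm0 n) hq.le

namespace CompatibleCouple

variable {E₀ E₁ V : Type*}
  [NormedAddCommGroup E₀] [NormedSpace ℂ E₀] [NormedAddCommGroup E₁] [NormedSpace ℂ E₁]
  [AddCommGroup V] [Module ℂ V] [TopologicalSpace V] [T2Space V] [ContinuousAdd V]
  (A : CompatibleCouple E₀ E₁ V)

theorem norm_toSum₀_le (a : E₀) : ‖A.toSum₀ a‖ ≤ ‖a‖ :=
  (Submodule.Quotient.norm_mk_le A.zeroPairs (a, 0)).trans (by simp)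

theorem norm_toSum₁_le (b : E₁) : ‖A.toSum₁ b‖ ≤ ‖b‖ :=
  (Submodule.Quotient.norm_mk_le A.zeroPairs (0, b)).trans (by simp)

theorem toSum₀_eq_toSum₁ {a : E₀} {b : E₁} (h : A.incl₀ a = A.incl₁ b) :
    A.toSum₀ a = A.toSum₁ b := by
  refine (Submodule.Quotient.eq A.zeroPairs).2 ?_
  simp [zeroPairs, h]

theorem sumIncl_toSum₀ (a : E₀) : A.sumIncl (A.toSum₀ a) = A.incl₀ a := by
  change A.incl₀ a + A.incl₁ 0 = _
  rw [map_zero, add_zero]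

theorem continuous_sumIncl : Continuous A.sumIncl :=
  continuous_quot_lift _ (A.incl₀.coprod A.incl₁).continuous

open Complex.HadamardThreeLines

theorem closure_verticalStrip_subset :
    closure (verticalStrip 0 1) ⊆ verticalClosedStrip 0 1 :=
  closure_minimal (preimage_mono Ioo_subset_Icc_self) (isClosed_Icc.preimage Complex.continuous_re)

/-- Unconditional sums `∑ x n` lie in the interpolation space as soon as the partial sums of
`∑ c n • x n` can be controlled for `|c n| ≤ exp (-θ e n)` in `E₀` and for
`|c n| ≤ exp ((1 - θ) e n)` in `E₁`. -/
theorem exists_stripFunction_hasSum [CompleteSpace E₀] [CompleteSpace E₁] {ι : Type*}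
    {x : ι → E₀} {y : ι → E₁} (hxy : ∀ n, A.incl₀ (x n) = A.incl₁ (y n)) (e : ι → ℝ) {θ : ℝ}
    (hθ₀ : 0 < θ) (hθ₁ : θ < 1) {m : ι → ℝ} (hm0 : ∀ n, 0 ≤ m n) (hm : Summable m) {q : ℝ}
    (hq : 0 < q)
    (h0 : ∀ (s : Finset ι) (c : ι → ℂ), (∀ n, ‖c n‖ ≤ Real.exp (-θ * e n)) →
      ‖∑ n ∈ s, c n • x n‖ ≤ (∑ n ∈ s, m n) ^ q)
    (h1 : ∀ (s : Finset ι) (c : ι → ℂ), (∀ n, ‖c n‖ ≤ Real.exp ((1 - θ) * e n)) →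
      ‖∑ n ∈ s, c n • y n‖ ≤ (∑ n ∈ s, m n) ^ q) :
    ∃ F : A.StripFunction, F.size ≤ (∑' n, m n) ^ q ∧
      HasSum (fun n => A.incl₀ (x n)) (A.sumIncl (F.toFun θ)) := by
  -- Normalised to be 1 at `θ`. On the two boundary lines its modulus is exactly the bound allowed
  -- in `h0` and `h1`.
  let c (n : ι) (z : ℂ) : ℂ := Complex.exp (e n * (z - θ))
  have hcnorm (n : ι) (z : ℂ) : ‖c n z‖ = Real.exp (e n * (z.re - θ)) := by
    simp [c, Complex.norm_exp]
  have hc0 (t : ℝ) (n : ι) : ‖c n (t * Complex.I)‖ ≤ Real.exp (-θ * e n) := by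
    rw [hcnorm]; simp [mul_comm]
  have hc1 (t : ℝ) (n : ι) : ‖c n (1 + t * Complex.I)‖ ≤ Real.exp ((1 - θ) * e n) := by
    rw [hcnorm]; simp [mul_comm]
  have hcd (n : ι) : Differentiable ℂ (c n) := by fun_prop
  let G (n : ι) (z : ℂ) : A.SumSpace := c n z • A.toSum₀ (x n)
  have hGd (n : ι) : Differentiable ℂ (G n) := (hcd n).smul_const _
  have hG1 (n : ι) (z : ℂ) : G n z = c n z • A.toSum₁ (y n) := by
    simp only [G, A.toSum₀_eq_toSum₁ (hxy n)]
  -- The three lines theorem carries the boundary bounds into the strip, uniformly in `z`; hence the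
  -- series converges uniformly there and its sum is holomorphic inside.
  have hGs (s : Finset ι) (z : ℂ) (hz : z ∈ verticalClosedStrip 0 1) :
      ‖∑ n ∈ s, G n z‖ ≤ (∑ n ∈ s, m n) ^ q := by
    refine norm_le_of_norm_le_on_strip_boundary (f := fun z => ∑ n ∈ s, G n z)
      (Differentiable.diffContOnCl (by fun_prop)) ⟨∑ n ∈ s, Real.exp |e n| * ‖A.toSum₀ (x n)‖, ?_⟩
      (fun t => ?_) (fun t => ?_) hz
    · intro w hw
      refine norm_sum_le_of_le _ fun n _ => ?_
      rw [norm_smul, hcnorm]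
      gcongr
      have : |w.re - θ| ≤ 1 := by
        have := hw.1; have := hw.2
        rw [abs_le]; constructor <;> linarith
      calc e n * (w.re - θ) ≤ |e n * (w.re - θ)| := le_abs_self _
        _ = |e n| * |w.re - θ| := abs_mul _ _
        _ ≤ |e n| * 1 := by gcongr
        _ = |e n| := mul_one _
    · have : ∑ n ∈ s, G n (t * Complex.I) = A.toSum₀ (∑ n ∈ s, c n (t * Complex.I) • x n) := by
        simp [G]
      simp only [this]
      exact (A.norm_toSum₀_le _).trans (h0 s _ (hc0 t))
    · have : ∑ n ∈ s, G n (1 + t * Complex.I) =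
          A.toSum₁ (∑ n ∈ s, c n (1 + t * Complex.I) • y n) := by
        simp [hG1]
      simp only [this]
      exact (A.norm_toSum₁_le _).trans (h1 s _ (hc1 t))
  -- Summing in the Banach space of bounded continuous functions yields continuity of the boundary
  -- values and the bound on `size` at once.
  let b₀ (n : ι) : ℝ →ᵇ E₀ := BoundedContinuousFunction.ofNormedAddCommGroup
    (fun t : ℝ => c n (t * Complex.I) • x n)
    (((hcd n).continuous.comp (by fun_prop)).smul continuous_const) (m n ^ q)
    (fun t => by simpa using h0 {n} _ (hc0 t))
  let b₁ (n : ι) : ℝ →ᵇ E₁ := BoundedContinuousFunction.ofNormedAddCommGroup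
    (fun t : ℝ => c n (1 + t * Complex.I) • y n)
    (((hcd n).continuous.comp (by fun_prop)).smul continuous_const) (m n ^ q)
    (fun t => by simpa using h1 {n} _ (hc1 t))
  let g (n : ι) : verticalClosedStrip 0 1 →ᵇ A.SumSpace :=
    BoundedContinuousFunction.ofNormedAddCommGroup (fun z => G n z)
    ((hGd n).continuous.comp continuous_subtype_val) (m n ^ q)
    (fun z => by simpa using hGs {n} _ z.2)
  have hmpos (s : Finset ι) : 0 ≤ (∑ n ∈ s, m n) ^ q :=
    Real.rpow_nonneg (Finset.sum_nonneg fun n _ => hm0 n) _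
  obtain ⟨hb₀, hb₀'⟩ := summable_of_norm_sum_le_rpow (f := b₀) hm0 hm hq fun s => by
    refine (BoundedContinuousFunction.norm_le (hmpos s)).2 fun t => ?_
    rw [BoundedContinuousFunction.coe_sum, Finset.sum_apply]
    exact h0 s _ (hc0 t)
  obtain ⟨hb₁, hb₁'⟩ := summable_of_norm_sum_le_rpow (f := b₁) hm0 hm hq fun s => by
    refine (BoundedContinuousFunction.norm_le (hmpos s)).2 fun t => ?_
    rw [BoundedContinuousFunction.coe_sum, Finset.sum_apply]
    exact h1 s _ (hc1 t)
  obtain ⟨hg, hg'⟩ := summable_of_norm_sum_le_rpow (f := g) hm0 hm hq fun s => by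
    refine (BoundedContinuousFunction.norm_le (hmpos s)).2 fun t => ?_
    rw [BoundedContinuousFunction.coe_sum, Finset.sum_apply]
    exact hGs s _ t.2
  have hgp (z : verticalClosedStrip 0 1) : HasSum (fun n => G n z) ((∑' n, g n) z) := by
    have := (BoundedContinuousFunction.evalCLM ℂ z).hasSum hg.hasSum
    exact this
  have hu : TendstoUniformlyOn (fun (s : Finset ι) z => ∑ n ∈ s, G n z)
      (fun z => ∑' n, G n z) Filter.atTop (verticalClosedStrip 0 1) := by
    have h := BoundedContinuousFunction.tendsto_iff_tendstoUniformly.1 hg.hasSum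
    rw [tendstoUniformlyOn_iff_tendstoUniformly_comp_coe]
    intro u hu
    filter_upwards [h u hu] with s hs z
    have h2 := hs z
    rw [BoundedContinuousFunction.coe_sum, Finset.sum_apply, ← (hgp z).tsum_eq] at h2
    exact h2
  have hsum0 (t : ℝ) : HasSum (fun n => G n (t * Complex.I)) (A.toSum₀ ((∑' n, b₀ n) t)) := by
    have h := (BoundedContinuousFunction.evalCLM ℂ t).hasSum hb₀.hasSum
    have hc : Continuous A.toSum₀ :=
      (A.toSum₀.mkContinuous 1 fun a => by simpa using A.norm_toSum₀_le a).continuous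
    have h2 := h.map A.toSum₀ hc
    convert h2 using 2 with n
    · simp [G, b₀]
    · rfl
  have hsum1 (t : ℝ) : HasSum (fun n => G n (1 + t * Complex.I)) (A.toSum₁ ((∑' n, b₁ n) t)) := by
    have h := (BoundedContinuousFunction.evalCLM ℂ t).hasSum hb₁.hasSum
    have hc : Continuous A.toSum₁ :=
      (A.toSum₁.mkContinuous 1 fun a => by simpa using A.norm_toSum₁_le a).continuous
    have h2 := h.map A.toSum₁ hc
    convert h2 using 2 with n
    · simp [hG1, b₁]
    · rfl
  let F : A.StripFunction :=
    { toFun := fun z => ∑' n, G n z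
      bd₀ := ∑' n, b₀ n
      bd₁ := ∑' n, b₁ n
      diffContOnCl := by
        constructor
        · refine ((hu.mono (preimage_mono Ioo_subset_Icc_self)).tendstoLocallyUniformlyOn).differentiableOn
            (Filter.Eventually.of_forall fun s => ?_) (isOpen_Ioo.preimage Complex.continuous_re)
          exact Differentiable.differentiableOn (by fun_prop)
        · refine (hu.continuousOn (Filter.Eventually.of_forall fun s => ?_).frequently).mono
            closure_verticalStrip_subset
          exact (Differentiable.continuous (𝕜 := ℂ) (by fun_prop)).continuousOn
      bounded := ⟨‖∑' n, g n‖, fun z hz => by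
        rw [(hgp ⟨z, hz⟩).tsum_eq]
        exact (∑' n, g n).norm_coe_le_norm ⟨z, hz⟩⟩
      eq_bd₀ := fun t => (hsum0 t).tsum_eq
      eq_bd₁ := fun t => (hsum1 t).tsum_eq }
  refine ⟨F, max_le hb₀' hb₁', ?_⟩
  have hθ : HasSum (fun n => G n θ) (F.toFun θ) := by
    have hz : (θ : ℂ) ∈ verticalClosedStrip 0 1 := ⟨by simpa using hθ₀.le, by simpa using hθ₁.le⟩
    exact (hgp ⟨θ, hz⟩).summable.hasSum
  have := hθ.map A.sumIncl A.continuous_sumIncl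
  refine this.congr_fun fun n => ?_
  simp [G, c, sumIncl_toSum₀]

end CompatibleCouple
end

/-! ### Products of distributions with functions of the first coordinate -/

noncomputable section

section MulDistribution

variable {d : ℕ} [NeZero d] {X : Type*} [NormedAddCommGroup X] [NormedSpace ℂ X]

theorem contDiff_comp_coord {ψ : ℝ → ℝ} (hψ : ContDiff ℝ (⊤ : ℕ∞) ψ) :
    ContDiff ℝ (⊤ : ℕ∞) fun x : EuclideanSpace ℝ (Fin d) => ψ (x 0) :=
  hψ.comp (EuclideanSpace.proj (𝕜 := ℝ) (0 : Fin d)).contDiff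

/-- Multiplication of a test function with the smooth function `x ↦ ψ (x 0)`. -/
def mulTest {ψ : ℝ → ℝ} (hψ : ContDiff ℝ (⊤ : ℕ∞) ψ) :
    𝓓(halfSpace d, ℝ) →L[ℝ] 𝓓(halfSpace d, ℝ) :=
  TestFunction.limitCLM ℝ
    (fun φ => ⟨fun x => φ x * ψ (x 0), φ.contDiff.mul (contDiff_comp_coord hψ),
      φ.hasCompactSupport.mul_right, (tsupport_mul_subset_left).trans φ.tsupport_subset⟩)
    (fun _ hK => TestFunction.ofSupportedInCLM ℝ hK ∘L
      ContDiffMapSupportedIn.bilinLeftCLM (ContinuousLinearMap.mul ℝ ℝ) (contDiff_comp_coord hψ))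
    (fun _ _ _ => by ext; rfl)

theorem mulTest_apply {ψ : ℝ → ℝ} (hψ : ContDiff ℝ (⊤ : ℕ∞) ψ) (φ : 𝓓(halfSpace d, ℝ))
    (x : EuclideanSpace ℝ (Fin d)) : mulTest hψ φ x = φ x * ψ (x 0) := rfl

theorem lineDerivOp_testFunction_apply (φ : 𝓓(halfSpace d, ℝ)) (v x : EuclideanSpace ℝ (Fin d)) :
    (∂_{v} φ) x = fderiv ℝ φ x v := by
  rw [TestFunction.lineDerivOp_eq_lineDerivCLM ℝ, TestFunction.lineDerivCLM_eq_fderivCLM,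
    TestFunction.fderivCLM_apply_of_le _ le_top]

theorem contDiff_deriv_of_contDiff {ψ : ℝ → ℝ} (hψ : ContDiff ℝ (⊤ : ℕ∞) ψ) :
    ContDiff ℝ (⊤ : ℕ∞) (deriv ψ) :=
  (contDiff_infty_iff_deriv.1 hψ).2

theorem hasFDerivAt_comp_coord {ψ : ℝ → ℝ} (hψ : ContDiff ℝ (⊤ : ℕ∞) ψ)
    (x : EuclideanSpace ℝ (Fin d)) :
    HasFDerivAt (fun x : EuclideanSpace ℝ (Fin d) => ψ (x 0))
      (deriv ψ (x 0) • (EuclideanSpace.proj (𝕜 := ℝ) (0 : Fin d) :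
        EuclideanSpace ℝ (Fin d) →L[ℝ] ℝ)) x := by
  have h1 : HasDerivAt ψ (deriv ψ (x 0)) (x 0) :=
    (hψ.differentiable (by simp) _).hasDerivAt
  exact h1.comp_hasFDerivAt x (EuclideanSpace.proj (𝕜 := ℝ) (0 : Fin d)).hasFDerivAt

theorem fderiv_mulTest {ψ : ℝ → ℝ} (hψ : ContDiff ℝ (⊤ : ℕ∞) ψ) (φ : 𝓓(halfSpace d, ℝ))
    (x v : EuclideanSpace ℝ (Fin d)) :
    fderiv ℝ (mulTest hψ φ) x v = fderiv ℝ φ x v * ψ (x 0) + φ x * (deriv ψ (x 0) * v 0) := by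
  have h1 : HasFDerivAt φ (fderiv ℝ φ x) x :=
    (φ.contDiff.differentiable (by simp) x).hasFDerivAt
  have h2 := h1.mul (hasFDerivAt_comp_coord hψ x)
  have h3 : fderiv ℝ (mulTest hψ φ) x = _ := h2.fderiv
  rw [h3]
  simp
  ring

theorem lineDerivOp_mulTest_zero {ψ : ℝ → ℝ} (hψ : ContDiff ℝ (⊤ : ℕ∞) ψ)
    (φ : 𝓓(halfSpace d, ℝ)) :
    ∂_{EuclideanSpace.single (0 : Fin d) (1 : ℝ)} (mulTest hψ φ) =
      mulTest hψ (∂_{EuclideanSpace.single (0 : Fin d) (1 : ℝ)} φ) +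
        mulTest (contDiff_deriv_of_contDiff hψ) φ := by
  ext x
  change _ = mulTest hψ (∂_{EuclideanSpace.single (0 : Fin d) (1 : ℝ)} φ) x +
    mulTest (contDiff_deriv_of_contDiff hψ) φ x
  simp only [lineDerivOp_testFunction_apply, mulTest_apply, fderiv_mulTest]
  simp

theorem lineDerivOp_mulTest_of_ne {ψ : ℝ → ℝ} (hψ : ContDiff ℝ (⊤ : ℕ∞) ψ)
    {i : Fin d} (hi : i ≠ 0) (φ : 𝓓(halfSpace d, ℝ)) :
    ∂_{EuclideanSpace.single i (1 : ℝ)} (mulTest hψ φ) =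
      mulTest hψ (∂_{EuclideanSpace.single i (1 : ℝ)} φ) := by
  ext x
  simp only [lineDerivOp_testFunction_apply, mulTest_apply, fderiv_mulTest]
  simp [hi.symm]

/-- Multiplication of a distribution with the smooth function `x ↦ ψ (x 0)`. -/
def mulDist {ψ : ℝ → ℝ} (hψ : ContDiff ℝ (⊤ : ℕ∞) ψ) :
    𝓓'(halfSpace d, X) →L[ℝ] 𝓓'(halfSpace d, X) :=
  (mulTest hψ).precompCompactConvergenceCLM X

theorem mulDist_apply {ψ : ℝ → ℝ} (hψ : ContDiff ℝ (⊤ : ℕ∞) ψ) (T : 𝓓'(halfSpace d, X))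
    (φ : 𝓓(halfSpace d, ℝ)) : mulDist hψ T φ = T (mulTest hψ φ) := rfl

theorem lineDerivOp_mulDist_zero {ψ : ℝ → ℝ} (hψ : ContDiff ℝ (⊤ : ℕ∞) ψ)
    (T : 𝓓'(halfSpace d, X)) :
    ∂_{EuclideanSpace.single (0 : Fin d) (1 : ℝ)} (mulDist hψ T) =
      mulDist (contDiff_deriv_of_contDiff hψ) T +
        mulDist hψ (∂_{EuclideanSpace.single (0 : Fin d) (1 : ℝ)} T) := by
  ext φ
  change _ = mulDist (contDiff_deriv_of_contDiff hψ) T φ +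
    mulDist hψ (∂_{EuclideanSpace.single (0 : Fin d) (1 : ℝ)} T) φ
  simp only [Distribution.lineDerivOp_apply_apply, mulDist_apply, lineDerivOp_mulTest_zero,
    map_neg, map_add]
  abel

theorem lineDerivOp_mulDist_of_ne {ψ : ℝ → ℝ} (hψ : ContDiff ℝ (⊤ : ℕ∞) ψ)
    {i : Fin d} (hi : i ≠ 0) (T : 𝓓'(halfSpace d, X)) :
    ∂_{EuclideanSpace.single i (1 : ℝ)} (mulDist hψ T) =
      mulDist hψ (∂_{EuclideanSpace.single i (1 : ℝ)} T) := by
  ext φ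
  simp only [Distribution.lineDerivOp_apply_apply, mulDist_apply, lineDerivOp_mulTest_of_ne hψ hi,
    map_neg]

theorem contDiff_iteratedDeriv {ψ : ℝ → ℝ} (hψ : ContDiff ℝ (⊤ : ℕ∞) ψ) (j : ℕ) :
    ContDiff ℝ (⊤ : ℕ∞) (iteratedDeriv j ψ) := by
  induction j with
  | zero => simpa using hψ
  | succ j ih => rw [iteratedDeriv_succ]; exact contDiff_deriv_of_contDiff ih

/-- The Leibniz rule for an additive operator `D`, in abstract form. -/
theorem iterate_leibniz {N : Type*} [AddCommMonoid N] (D : N →+ N) (u : ℕ → ℕ → N)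
    (h : ∀ i j, D (u i j) = u (i + 1) j + u i (j + 1)) (m : ℕ) :
    D^[m] (u 0 0) = ∑ ij ∈ Finset.HasAntidiagonal.antidiagonal m, m.choose ij.1 • u ij.1 ij.2 := by
  induction m with
  | zero => simp
  | succ m ih =>
    rw [Function.iterate_succ_apply', ih, map_sum, Finset.sum_antidiagonal_choose_succ_nsmul,
      ← Finset.sum_add_distrib]
    refine Finset.sum_congr rfl fun ij hij => ?_
    rw [map_nsmul, h, nsmul_add, add_comm]
    congr 2
    -- One of the two sums in Pascal's rule carries the binomial coefficient of the second index;
    -- symmetry turns it into that of the first.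
    rw [← Finset.HasAntidiagonal.mem_antidiagonal.1 hij, Nat.choose_symm_add]

/-- The derivatives in all directions but the first. -/
def tangentialDeriv (α : Fin d → ℕ) (T : 𝓓'(halfSpace d, X)) : 𝓓'(halfSpace d, X) :=
  (List.finRange d).tail.foldr
    (fun i S => (fun R : 𝓓'(halfSpace d, X) => ∂_{EuclideanSpace.single i (1 : ℝ)} R)^[α i] S) T

theorem finRange_eq_cons : List.finRange d = 0 :: (List.finRange d).tail := by
  obtain ⟨n, rfl⟩ := Nat.exists_eq_succ_of_ne_zero (NeZero.ne d)
  rw [List.finRange_succ]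
  rfl

theorem ne_zero_of_mem_tail {i : Fin d} (hi : i ∈ (List.finRange d).tail) : i ≠ 0 := by
  have h := List.nodup_finRange d
  rw [finRange_eq_cons, List.nodup_cons] at h
  rintro rfl
  exact h.1 hi

/-- Index `0` heads `List.finRange d`, so its derivative is applied last and splits off as an outer
iterate. The remaining derivatives commute with multiplication by `ψ (x 0)`, which reduces the
Leibniz rule to one direction. -/
theorem distribDeriv_update (α : Fin d → ℕ) (m : ℕ) (T : 𝓓'(halfSpace d, X)) :
    distribDeriv (Function.update α 0 m) T =
      (fun R : 𝓓'(halfSpace d, X) => ∂_{EuclideanSpace.single (0 : Fin d) (1 : ℝ)} R)^[m]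
        (tangentialDeriv α T) := by
  rw [distribDeriv, finRange_eq_cons, List.foldr_cons, Function.update_self, tangentialDeriv]
  congr 1
  have : ∀ l : List (Fin d), (∀ i ∈ l, i ≠ 0) → ∀ S : 𝓓'(halfSpace d, X), l.foldr
      (fun i S => (fun R : 𝓓'(halfSpace d, X) =>
        ∂_{EuclideanSpace.single i (1 : ℝ)} R)^[Function.update α 0 m i] S) S = l.foldr
      (fun i S => (fun R : 𝓓'(halfSpace d, X) =>
        ∂_{EuclideanSpace.single i (1 : ℝ)} R)^[α i] S) S := by
    intro l hl S
    induction l with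
    | nil => rfl
    | cons i l ih =>
      rw [List.foldr_cons, List.foldr_cons, ih fun j hj => hl j (List.mem_cons_of_mem _ hj),
        Function.update_of_ne (hl i List.mem_cons_self)]
  exact this _ (fun i hi => ne_zero_of_mem_tail hi) T

theorem distribDeriv_eq (α : Fin d → ℕ) (T : 𝓓'(halfSpace d, X)) :
    distribDeriv α T =
      (fun R : 𝓓'(halfSpace d, X) => ∂_{EuclideanSpace.single (0 : Fin d) (1 : ℝ)} R)^[α 0]
        (tangentialDeriv α T) := by
  rw [← distribDeriv_update, Function.update_eq_self]

theorem lineDerivOp_distribDeriv (α : Fin d → ℕ) (m : ℕ) (T : 𝓓'(halfSpace d, X)) :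
    ∂_{EuclideanSpace.single (0 : Fin d) (1 : ℝ)} (distribDeriv (Function.update α 0 m) T) =
      distribDeriv (Function.update α 0 (m + 1)) T := by
  rw [distribDeriv_update, distribDeriv_update, Function.iterate_succ_apply']

theorem tangentialDeriv_mulDist {ψ : ℝ → ℝ} (hψ : ContDiff ℝ (⊤ : ℕ∞) ψ) (α : Fin d → ℕ)
    (T : 𝓓'(halfSpace d, X)) :
    tangentialDeriv α (mulDist hψ T) = mulDist hψ (tangentialDeriv α T) := by
  have : ∀ l : List (Fin d), (∀ i ∈ l, i ≠ 0) → l.foldr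
      (fun i S => (fun R : 𝓓'(halfSpace d, X) =>
        ∂_{EuclideanSpace.single i (1 : ℝ)} R)^[α i] S) (mulDist hψ T) = mulDist hψ (l.foldr
      (fun i S => (fun R : 𝓓'(halfSpace d, X) =>
        ∂_{EuclideanSpace.single i (1 : ℝ)} R)^[α i] S) T) := by
    intro l hl
    induction l with
    | nil => rfl
    | cons i l ih =>
      rw [List.foldr_cons, List.foldr_cons, ih fun j hj => hl j (List.mem_cons_of_mem _ hj)]
      exact ((Function.Semiconj.iterate_right (fun S =>
        (lineDerivOp_mulDist_of_ne hψ (hl i List.mem_cons_self) S).symm) (α i)) _).symm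
  exact this _ fun i hi => ne_zero_of_mem_tail hi

/-- The Leibniz rule for the product of a distribution with `x ↦ ψ (x 0)`. -/
theorem distribDeriv_mulDist {ψ : ℝ → ℝ} (hψ : ContDiff ℝ (⊤ : ℕ∞) ψ) (α : Fin d → ℕ)
    (T : 𝓓'(halfSpace d, X)) :
    distribDeriv α (mulDist hψ T) = ∑ ij ∈ Finset.HasAntidiagonal.antidiagonal (α 0), (α 0).choose ij.1 •
      mulDist (contDiff_iteratedDeriv hψ ij.1) (distribDeriv (Function.update α 0 ij.2) T) := by
  rw [distribDeriv_eq, tangentialDeriv_mulDist]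
  let D : 𝓓'(halfSpace d, X) →+ 𝓓'(halfSpace d, X) :=
    { toFun := fun R => ∂_{EuclideanSpace.single (0 : Fin d) (1 : ℝ)} R
      map_zero' := map_zero (Distribution.lineDerivCLM _)
      map_add' := map_add (Distribution.lineDerivCLM _) }
  -- The doubly indexed family is the i-th derivative of `ψ` times the derivative of `T` with first
  -- order j; the product rule raises one of the two indices.
  have := iterate_leibniz D (fun i j => mulDist (contDiff_iteratedDeriv hψ i)
    (distribDeriv (Function.update α 0 j) T)) (fun i j => ?_) (α 0)
  · rw [← this]
    change D^[α 0] _ = _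
    congr 1
    rw [distribDeriv_update]
    ext φ
    simp only [mulDist_apply]
    rfl
  · have hD : ∀ R, D R = ∂_{EuclideanSpace.single (0 : Fin d) (1 : ℝ)} R := fun _ => rfl
    rw [hD, lineDerivOp_mulDist_zero, lineDerivOp_distribDeriv]
    congr 1
    ext φ
    simp only [mulDist_apply]
    congr 1
    ext x
    simp [mulTest_apply, iteratedDeriv_succ]

/-- All derivatives are moved onto the test function, and the resulting `φ'` is the same for every
`T`. This makes the relation defining the Sobolev space an equality of continuous functionals. -/
theorem exists_distribDeriv_apply_eq (α : Fin d → ℕ) (φ : 𝓓(halfSpace d, ℝ)) :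
    ∃ φ' : 𝓓(halfSpace d, ℝ), ∀ T : 𝓓'(halfSpace d, X), distribDeriv α T φ = T φ' := by
  have hit : ∀ (i : Fin d) (m : ℕ) (φ : 𝓓(halfSpace d, ℝ)), ∃ φ' : 𝓓(halfSpace d, ℝ),
      ∀ T : 𝓓'(halfSpace d, X), (fun R : 𝓓'(halfSpace d, X) =>
        ∂_{EuclideanSpace.single i (1 : ℝ)} R)^[m] T φ = T φ' := by
    intro i m
    induction m with
    | zero => exact fun φ => ⟨φ, fun T => rfl⟩
    | succ m ih =>
      intro φ
      obtain ⟨φ', h⟩ := ih (-∂_{EuclideanSpace.single i (1 : ℝ)} φ)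
      refine ⟨φ', fun T => ?_⟩
      rw [Function.iterate_succ_apply', Distribution.lineDerivOp_apply_apply, h]
  have : ∀ (l : List (Fin d)) (φ : 𝓓(halfSpace d, ℝ)), ∃ φ' : 𝓓(halfSpace d, ℝ),
      ∀ T : 𝓓'(halfSpace d, X), l.foldr (fun i S => (fun R : 𝓓'(halfSpace d, X) =>
        ∂_{EuclideanSpace.single i (1 : ℝ)} R)^[α i] S) T φ = T φ' := by
    intro l
    induction l with
    | nil => exact fun φ => ⟨φ, fun T => rfl⟩
    | cons i l ih =>
      intro φ
      obtain ⟨φ₁, h₁⟩ := hit i (α i) φ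
      obtain ⟨φ₂, h₂⟩ := ih φ₁
      exact ⟨φ₂, fun T => by rw [List.foldr_cons, h₁, h₂]⟩
  exact this _ φ

end MulDistribution

/-! ### Completeness of the weighted Sobolev spaces -/

section SobolevComplete

variable {d : ℕ} [NeZero d] {X : Type*} [NormedAddCommGroup X] [NormedSpace ℂ X]
  {p : ℝ≥0∞} [Fact (1 ≤ p)]

theorem continuous_lpToDistribution_apply (γ : ℝ) (φ : 𝓓(halfSpace d, ℝ)) :
    Continuous fun f : WeightedLp d X p γ => lpToDistribution d X p γ f φ := by
  obtain ⟨C, -, hC⟩ := norm_lpToDistribution_le (X := X) (p := p) γ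
    φ.hasCompactSupport φ.tsupport_subset
  obtain ⟨M, hM⟩ := φ.hasCompactSupport.exists_bound_of_continuous φ.continuous
  exact AddMonoidHomClass.continuous_of_bound
    ({ toFun := fun f => lpToDistribution d X p γ f φ
       map_add' := fun f g => by rw [map_add]; rfl
       map_smul' := fun c f => by rw [map_smul]; rfl } : WeightedLp d X p γ →ₗ[ℂ] X) (C * M)
    (fun f => hC f φ le_rfl M hM)

/-- Tested against each `φ`, the defining relation cuts out a closed subset of a finite ℓ^p sum of
Lebesgue spaces. Completeness is needed to sum the boundary values of the strip function. -/
instance completeSpace_weightedSobolev [CompleteSpace X] (k : ℕ) (γ : ℝ) :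
    CompleteSpace (weightedSobolev d X k p γ) := by
  have hcl : IsClosed (weightedSobolev d X k p γ :
      Set (PiLp p fun _ : MultiIndex d k => WeightedLp d X p γ)) := by
    choose φ' hφ' using fun (α : MultiIndex d k) (φ : 𝓓(halfSpace d, ℝ)) =>
      exists_distribDeriv_apply_eq (X := X) α.1 φ
    have : (weightedSobolev d X k p γ :
        Set (PiLp p fun _ : MultiIndex d k => WeightedLp d X p γ)) =
        ⋂ α, ⋂ φ, {F | lpToDistribution d X p γ (F α) φ =
          lpToDistribution d X p γ (F 0) (φ' α φ)} := by
      ext F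
      simp only [mem_iInter, mem_ofPred_eq, ← hφ']
      exact ⟨fun h α φ => by rw [h α], fun h α => by ext φ; exact h α φ⟩
    rw [this]
    refine isClosed_iInter fun α => isClosed_iInter fun φ => isClosed_eq ?_ ?_
    · exact (continuous_lpToDistribution_apply γ φ).comp (PiLp.continuous_apply p _ α)
    · exact (continuous_lpToDistribution_apply γ _).comp (PiLp.continuous_apply p _ 0)
  exact hcl.completeSpace_coe

end SobolevComplete
end

/-! ### Dilations in the first coordinate -/

noncomputable section

section Dilation

variable {d : ℕ} [NeZero d]

/-- The dilation `(x₁, x') ↦ (t x₁, x')` in the first coordinate. -/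
def dilation (t : ℝ) : EuclideanSpace ℝ (Fin d) →L[ℝ] EuclideanSpace ℝ (Fin d) :=
  ContinuousLinearMap.id ℝ _ + (EuclideanSpace.proj (𝕜 := ℝ) (0 : Fin d)).smulRight
    ((t - 1) • EuclideanSpace.single (0 : Fin d) (1 : ℝ))

theorem dilation_apply (t : ℝ) (x : EuclideanSpace ℝ (Fin d)) :
    dilation t x = x + x 0 • ((t - 1) • EuclideanSpace.single (0 : Fin d) (1 : ℝ)) := rfl

@[simp]
theorem dilation_apply_zero (t : ℝ) (x : EuclideanSpace ℝ (Fin d)) :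
    dilation t x 0 = t * x 0 := by
  simp [dilation_apply]; ring

theorem dilation_dilation (s t : ℝ) (x : EuclideanSpace ℝ (Fin d)) :
    dilation s (dilation t x) = dilation (s * t) x := by
  rw [dilation_apply, dilation_apply_zero, dilation_apply, dilation_apply, add_assoc, smul_smul,
    smul_smul, smul_smul, ← add_smul]
  congr 2
  ring

@[simp]
theorem dilation_one (x : EuclideanSpace ℝ (Fin d)) : dilation 1 x = x := by
  simp [dilation_apply]

theorem Continuous.dilation {A : Type*} [TopologicalSpace A] {f : A → ℝ}
    {g : A → EuclideanSpace ℝ (Fin d)} (hf : Continuous f) (hg : Continuous g) :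
    Continuous fun a => dilation (f a) (g a) := by
  simp only [dilation_apply]
  fun_prop

theorem continuous_dilation_uncurry :
    Continuous fun q : ℝ × EuclideanSpace ℝ (Fin d) => dilation q.1 q.2 :=
  continuous_fst.dilation continuous_snd

/-- The dilation as an equivalence. -/
def dilationEquiv {t : ℝ} (ht : 0 < t) :
    EuclideanSpace ℝ (Fin d) ≃L[ℝ] EuclideanSpace ℝ (Fin d) :=
  ContinuousLinearEquiv.equivOfInverse (dilation t) (dilation t⁻¹)
    (fun x => by rw [dilation_dilation, inv_mul_cancel₀ ht.ne', dilation_one])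
    (fun x => by rw [dilation_dilation, mul_inv_cancel₀ ht.ne', dilation_one])

theorem measurableEmbedding_dilation {t : ℝ} (ht : 0 < t) :
    MeasurableEmbedding (dilation t : EuclideanSpace ℝ (Fin d) → EuclideanSpace ℝ (Fin d)) :=
  (dilationEquiv ht).toHomeomorph.measurableEmbedding

theorem dilation_mem_halfSpace {t : ℝ} (ht : 0 < t) (x : EuclideanSpace ℝ (Fin d)) :
    dilation t x ∈ halfSpace d ↔ x ∈ halfSpace d := by
  change 0 < dilation t x 0 ↔ 0 < x 0
  rw [dilation_apply_zero, mul_pos_iff_of_pos_left ht]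

theorem map_dilation_volume {t : ℝ} (ht : 0 < t) :
    (volume : Measure (EuclideanSpace ℝ (Fin d))).map (dilation t) =
      ENNReal.ofReal t⁻¹ • volume := by
  have h : LinearMap.det ((dilation t : EuclideanSpace ℝ (Fin d) →L[ℝ] _) :
      EuclideanSpace ℝ (Fin d) →ₗ[ℝ] EuclideanSpace ℝ (Fin d)) = t := by
    -- The dilation is the identity plus a rank one map, with determinant 1 + (t - 1) = t.
    refine (LinearMap.transvection.det
      ((EuclideanSpace.proj (𝕜 := ℝ) (0 : Fin d) : EuclideanSpace ℝ (Fin d) →L[ℝ] ℝ) :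
        EuclideanSpace ℝ (Fin d) →ₗ[ℝ] ℝ)
      ((t - 1) • EuclideanSpace.single (0 : Fin d) (1 : ℝ))).trans ?_
    simp
  have := Measure.map_linearMap_addHaar_eq_smul_addHaar
    (volume : Measure (EuclideanSpace ℝ (Fin d))) (f := (dilation t : _ →L[ℝ] _).toLinearMap)
    (by rw [h]; exact ht.ne')
  rw [h, abs_of_pos (inv_pos.2 ht)] at this
  exact this

theorem lintegral_comp_dilation {t : ℝ} (ht : 0 < t)
    (F : EuclideanSpace ℝ (Fin d) → ℝ≥0∞) :
    ∫⁻ x, F (dilation t x) = ENNReal.ofReal t⁻¹ * ∫⁻ x, F x := by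
  rw [← (measurableEmbedding_dilation ht).lintegral_map, map_dilation_volume ht,
    lintegral_smul_measure, smul_eq_mul]

theorem setLIntegral_comp_dilation {t : ℝ} (ht : 0 < t) {S S' : Set (EuclideanSpace ℝ (Fin d))}
    (hS : MeasurableSet S) (hS' : MeasurableSet S') (h : ∀ x, x ∈ S ↔ dilation t x ∈ S')
    (F : EuclideanSpace ℝ (Fin d) → ℝ≥0∞) :
    ∫⁻ x in S, F (dilation t x) = ENNReal.ofReal t⁻¹ * ∫⁻ x in S', F x := by
  rw [← lintegral_indicator hS, ← lintegral_indicator hS', ← lintegral_comp_dilation ht]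
  refine lintegral_congr fun x => ?_
  by_cases hx : x ∈ S
  · rw [indicator_of_mem hx, indicator_of_mem ((h x).1 hx)]
  · rw [indicator_of_notMem hx, indicator_of_notMem fun h' => hx ((h x).2 h')]

theorem integral_comp_dilation {X : Type*} [NormedAddCommGroup X] [NormedSpace ℝ X] {t : ℝ}
    (ht : 0 < t) (F : EuclideanSpace ℝ (Fin d) → X) :
    ∫ x, F (dilation t x) = t⁻¹ • ∫ x, F x := by
  rw [← (measurableEmbedding_dilation ht).integral_map, map_dilation_volume ht,
    integral_smul_measure, ENNReal.toReal_ofReal (inv_pos.2 ht).le]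

/-- The union of the dilates `dilation t⁻¹ '' K` with `t ∈ [1/2, 1]`. -/
def dilates (K : Set (EuclideanSpace ℝ (Fin d))) : Set (EuclideanSpace ℝ (Fin d)) :=
  (fun q : ℝ × EuclideanSpace ℝ (Fin d) => dilation q.1 q.2) '' (Icc 1 2 ×ˢ K)

theorem isCompact_dilates {K : Set (EuclideanSpace ℝ (Fin d))} (hK : IsCompact K) :
    IsCompact (dilates K) :=
  (isCompact_Icc.prod hK).image continuous_dilation_uncurry

theorem dilates_subset {K : Set (EuclideanSpace ℝ (Fin d))} (hK : K ⊆ halfSpace d) :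
    dilates K ⊆ halfSpace d := by
  rintro _ ⟨⟨t, x⟩, ⟨ht, hx⟩, rfl⟩
  exact (dilation_mem_halfSpace (lt_of_lt_of_le one_pos ht.1) x).2 (hK hx)

theorem dilation_inv_mem_dilates {K : Set (EuclideanSpace ℝ (Fin d))} {t : ℝ}
    (ht : t ∈ Icc (1 / 2 : ℝ) 1) {x : EuclideanSpace ℝ (Fin d)} (hx : x ∈ K) :
    dilation t⁻¹ x ∈ dilates K := by
  have h0 : 0 < t := lt_of_lt_of_le (by norm_num) ht.1
  refine ⟨(t⁻¹, x), ⟨⟨(one_le_inv₀ h0).2 ht.2, ?_⟩, hx⟩, rfl⟩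
  rw [show (2 : ℝ) = (1 / 2)⁻¹ by norm_num]
  exact inv_anti₀ (by norm_num) ht.1

theorem mem_dilates_of_dilation_mem {K : Set (EuclideanSpace ℝ (Fin d))} {t : ℝ}
    (ht : t ∈ Icc (1 / 2 : ℝ) 1) {x : EuclideanSpace ℝ (Fin d)} (hx : dilation t x ∈ K) :
    x ∈ dilates K := by
  have h0 : 0 < t := lt_of_lt_of_le (by norm_num) ht.1
  have := dilation_inv_mem_dilates ht hx
  rwa [dilation_dilation, inv_mul_cancel₀ h0.ne', dilation_one] at this

attribute [irreducible] dilation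

end Dilation
end

/-! ### Recovering a function from its weak derivative along dilations -/

noncomputable section

section WeakDerivative

variable {d : ℕ} [NeZero d] {X : Type*} [NormedAddCommGroup X] [NormedSpace ℝ X]

theorem measurable_dilation_inv_uncurry :
    Measurable fun q : EuclideanSpace ℝ (Fin d) × ℝ => dilation q.2⁻¹ q.1 := by
  simp only [dilation_apply]
  fun_prop

/-- For each t in [1/2, 1] the dilate of `K` stays in the compact set `dilates K`, and the
substitution has Jacobian factor t ≤ 1, so Tonelli bounds the double integral by the integral of
`‖h‖` over that set. This justifies the later uses of Fubini. -/
theorem integrable_dilation_prod {h : EuclideanSpace ℝ (Fin d) → X} (hm : StronglyMeasurable h)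
    (hh : LocallyIntegrableOn h (halfSpace d : Set (EuclideanSpace ℝ (Fin d))) volume)
    {K : Set (EuclideanSpace ℝ (Fin d))} (hK : IsCompact K) (hKH : K ⊆ halfSpace d) :
    Integrable (fun q : EuclideanSpace ℝ (Fin d) × ℝ => h (dilation q.2⁻¹ q.1))
      ((volume.restrict K).prod (volume.restrict (Icc (1 / 2 : ℝ) 1))) := by
  have hmeas : StronglyMeasurable
      fun q : EuclideanSpace ℝ (Fin d) × ℝ => h (dilation q.2⁻¹ q.1) :=
    hm.comp_measurable measurable_dilation_inv_uncurry
  refine ⟨hmeas.aestronglyMeasurable, ?_⟩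
  have hK' : IntegrableOn h (dilates K) :=
    ((locallyIntegrableOn_iff (halfSpace d).isOpen.isLocallyClosed).1 hh) _ (dilates_subset hKH)
      (isCompact_dilates hK)
  rw [HasFiniteIntegral, lintegral_prod_symm _ hmeas.enorm.aemeasurable]
  calc ∫⁻ t in Icc (1 / 2 : ℝ) 1, ∫⁻ x in K, ‖h (dilation t⁻¹ x)‖ₑ
      ≤ ∫⁻ t in Icc (1 / 2 : ℝ) 1, ∫⁻ x in dilates K, ‖h x‖ₑ := by
        refine setLIntegral_mono' measurableSet_Icc fun t ht => ?_
        have h0 : 0 < t := lt_of_lt_of_le (by norm_num) ht.1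
        calc ∫⁻ x in K, ‖h (dilation t⁻¹ x)‖ₑ
            ≤ ∫⁻ x, (dilates K).indicator (fun y => ‖h y‖ₑ) (dilation t⁻¹ x) := by
              rw [← lintegral_indicator hK.measurableSet]
              refine lintegral_mono fun x => ?_
              by_cases hx : x ∈ K
              · rw [indicator_of_mem hx, indicator_of_mem (dilation_inv_mem_dilates ht hx)]
              · rw [indicator_of_notMem hx]; exact zero_le
          _ = ENNReal.ofReal t * ∫⁻ x in dilates K, ‖h x‖ₑ := by
              rw [lintegral_comp_dilation (inv_pos.2 h0), inv_inv,
                lintegral_indicator (isCompact_dilates hK).measurableSet]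
          _ ≤ 1 * ∫⁻ x in dilates K, ‖h x‖ₑ := by
              gcongr
              exact ENNReal.ofReal_le_one.2 ht.2
          _ = _ := one_mul _
    _ < ∞ := by
        rw [lintegral_const]
        exact ENNReal.mul_lt_top hK'.2 (by simp)

/-- The derivative of `x ↦ x 0 * φ (dilation t x)` in the first direction. -/
def dilationDeriv (φ : 𝓓(halfSpace d, ℝ)) (t : ℝ) (x : EuclideanSpace ℝ (Fin d)) : ℝ :=
  φ (dilation t x) +
    x 0 * (t * fderiv ℝ φ (dilation t x) (EuclideanSpace.single (0 : Fin d) (1 : ℝ)))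

theorem dilation_single (t : ℝ) : dilation t (EuclideanSpace.single (0 : Fin d) (1 : ℝ)) =
    t • EuclideanSpace.single (0 : Fin d) (1 : ℝ) := by
  rw [dilation_apply]
  simp [sub_smul]

theorem tsupport_dilation_subset (φ : 𝓓(halfSpace d, ℝ)) {t : ℝ} (ht : t ∈ Icc (1 / 2 : ℝ) 1) :
    tsupport (fun x => x 0 * φ (dilation t x)) ⊆ dilates (tsupport φ) := by
  refine (closure_minimal (t := dilation t ⁻¹' tsupport φ) (fun x hx => ?_)
    ((isClosed_tsupport _).preimage (dilation t).continuous)).trans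
      fun x hx => mem_dilates_of_dilation_mem ht hx
  exact subset_tsupport _ (right_ne_zero_of_mul hx)

/-- The test function `x ↦ x 0 * φ (dilation t x)`. -/
def dilationTest (φ : 𝓓(halfSpace d, ℝ)) {t : ℝ} (ht : t ∈ Icc (1 / 2 : ℝ) 1) :
    𝓓(halfSpace d, ℝ) :=
  ⟨fun x => x 0 * φ (dilation t x),
    (EuclideanSpace.proj (𝕜 := ℝ) (0 : Fin d)).contDiff.mul
      (φ.contDiff.comp (dilation t).contDiff),
    (isCompact_dilates φ.hasCompactSupport).of_isClosed_subset (isClosed_tsupport _)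
      (tsupport_dilation_subset φ ht),
    (tsupport_dilation_subset φ ht).trans (dilates_subset φ.tsupport_subset)⟩

theorem dilationTest_apply (φ : 𝓓(halfSpace d, ℝ)) {t : ℝ} (ht : t ∈ Icc (1 / 2 : ℝ) 1)
    (x : EuclideanSpace ℝ (Fin d)) : dilationTest φ ht x = x 0 * φ (dilation t x) := rfl

theorem fderiv_dilationTest (φ : 𝓓(halfSpace d, ℝ)) {t : ℝ} (ht : t ∈ Icc (1 / 2 : ℝ) 1)
    (x : EuclideanSpace ℝ (Fin d)) :
    fderiv ℝ (dilationTest φ ht) x (EuclideanSpace.single 0 1) = dilationDeriv φ t x := by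
  have h1 : HasFDerivAt φ (fderiv ℝ φ (dilation t x)) (dilation t x) :=
    (φ.contDiff.differentiable (by simp) _).hasFDerivAt
  have h2 : HasFDerivAt (fun x : EuclideanSpace ℝ (Fin d) => x 0)
      (EuclideanSpace.proj (𝕜 := ℝ) (0 : Fin d) : EuclideanSpace ℝ (Fin d) →L[ℝ] ℝ) x :=
    (EuclideanSpace.proj (𝕜 := ℝ) (0 : Fin d)).hasFDerivAt
  have h3 : HasFDerivAt (fun x => φ (dilation t x)) _ x := h1.comp x (dilation t).hasFDerivAt
  have h4 : HasFDerivAt (fun x => x 0 * φ (dilation t x)) _ x := h2.mul h3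
  have h5 : (dilationTest φ ht : EuclideanSpace ℝ (Fin d) → ℝ) =
    fun x => x 0 * φ (dilation t x) := rfl
  rw [h5, h4.fderiv, add_apply, smul_apply, smul_apply, ContinuousLinearMap.comp_apply, dilation_single, map_smul,
    dilationDeriv]
  have h6 : (EuclideanSpace.proj (𝕜 := ℝ) (0 : Fin d) : EuclideanSpace ℝ (Fin d) →L[ℝ] ℝ)
      (EuclideanSpace.single 0 1) = 1 := by simp
  rw [h6]
  simp only [smul_eq_mul]
  ring

theorem continuous_dilationDeriv_uncurry (φ : 𝓓(halfSpace d, ℝ)) :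
    Continuous fun q : EuclideanSpace ℝ (Fin d) × ℝ => dilationDeriv φ q.2 q.1 := by
  have h1 : Continuous fun q : EuclideanSpace ℝ (Fin d) × ℝ => dilation q.2 q.1 :=
    continuous_snd.dilation continuous_fst
  have h2 : Continuous fun x => fderiv ℝ φ x (EuclideanSpace.single (0 : Fin d) (1 : ℝ)) :=
    (φ.contDiff.continuous_fderiv (by simp)).clm_apply continuous_const
  have h3 := h2.comp h1
  have h4 := φ.continuous.comp h1
  have h5 : Continuous fun q : EuclideanSpace ℝ (Fin d) × ℝ => q.1 0 := by fun_prop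
  exact h4.add (h5.mul (continuous_snd.mul h3))

theorem dilationDeriv_eq_zero (φ : 𝓓(halfSpace d, ℝ)) {t : ℝ} (ht : t ∈ Icc (1 / 2 : ℝ) 1)
    {x : EuclideanSpace ℝ (Fin d)} (hx : x ∉ dilates (tsupport φ)) : dilationDeriv φ t x = 0 := by
  have h : dilation t x ∉ tsupport φ := fun h => hx (mem_dilates_of_dilation_mem ht h)
  have h' : fderiv ℝ φ (dilation t x) = 0 :=
    image_eq_zero_of_notMem_tsupport fun h' => h (tsupport_fderiv_subset ℝ h')
  simp [dilationDeriv, h', image_eq_zero_of_notMem_tsupport h]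

/-- The first-direction derivative of `x 0 * φ (dilation t x)` coincides with the t-derivative of `t
* φ (dilation t x)`, because t and `x 0` enter `dilation t x` only through their product. The
fundamental theorem of calculus then applies in t. -/
theorem integral_dilationDeriv (φ : 𝓓(halfSpace d, ℝ)) (x : EuclideanSpace ℝ (Fin d)) :
    ∫ t in Icc (1 / 2 : ℝ) 1, dilationDeriv φ t x = φ x - 2⁻¹ * φ (dilation 2⁻¹ x) := by
  have hc : Continuous fun t => dilationDeriv φ t x :=
    (continuous_dilationDeriv_uncurry φ).comp (Continuous.prodMk_right x)
  have hd (t : ℝ) : HasDerivAt (fun t => t * φ (dilation t x)) (dilationDeriv φ t x) t := by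
    have h1 : HasFDerivAt φ (fderiv ℝ φ (dilation t x)) (dilation t x) :=
      (φ.contDiff.differentiable (by simp) _).hasFDerivAt
    have h2 : HasDerivAt (fun t : ℝ => dilation t x)
        (x 0 • ((1 : ℝ) • EuclideanSpace.single (0 : Fin d) (1 : ℝ))) t := by
      simp only [dilation_apply]
      exact ((((hasDerivAt_id t).sub_const 1).smul_const
        (EuclideanSpace.single (0 : Fin d) (1 : ℝ))).const_smul (x 0)).const_add x
    have h3 : HasDerivAt (fun t : ℝ => φ (dilation t x)) _ t := h1.comp_hasDerivAt t h2
    have h4 : HasDerivAt (fun t : ℝ => t * φ (dilation t x)) _ t := (hasDerivAt_id t).mul h3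
    refine h4.congr_deriv ?_
    rw [one_smul, map_smul, dilationDeriv, id, smul_eq_mul]
    ring
  rw [integral_Icc_eq_integral_Ioc, ← intervalIntegral.integral_of_le (by norm_num),
    intervalIntegral.integral_eq_sub_of_hasDerivAt (fun t _ => hd t) (hc.intervalIntegrable _ _)]
  simp

theorem ae_snd_mem_Icc (μ : Measure (EuclideanSpace ℝ (Fin d))) [SFinite μ] :
    ∀ᵐ q ∂(μ.prod (volume.restrict (Icc (1 / 2 : ℝ) 1))), q.2 ∈ Icc (1 / 2 : ℝ) 1 :=
  Measure.quasiMeasurePreserving_snd.ae (ae_restrict_mem measurableSet_Icc)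

theorem integrable_dilationDeriv_smul (φ : 𝓓(halfSpace d, ℝ)) {g : EuclideanSpace ℝ (Fin d) → X}
    (hg : LocallyIntegrableOn g (halfSpace d : Set (EuclideanSpace ℝ (Fin d))) volume) :
    Integrable (fun q : EuclideanSpace ℝ (Fin d) × ℝ => dilationDeriv φ q.2 q.1 • g q.1)
      (volume.prod (volume.restrict (Icc (1 / 2 : ℝ) 1))) := by
  have hK := isCompact_dilates (d := d) φ.hasCompactSupport
  have hi : IntegrableOn g (dilates (tsupport φ)) :=
    ((locallyIntegrableOn_iff (halfSpace d).isOpen.isLocallyClosed).1 hg) _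
      (dilates_subset φ.tsupport_subset) hK
  have hi' := (integrable_indicator_iff hK.measurableSet).2 hi
  obtain ⟨M, hM⟩ := (hK.prod isCompact_Icc).exists_bound_of_continuousOn
    (s := dilates (tsupport φ) ×ˢ Icc (1 / 2 : ℝ) 1)
    (continuous_dilationDeriv_uncurry φ).continuousOn
  have hb : ∀ᵐ q ∂((volume : Measure (EuclideanSpace ℝ (Fin d))).prod
      (volume.restrict (Icc (1 / 2 : ℝ) 1))), ‖dilationDeriv φ q.2 q.1‖ ≤ max M 0 := by
    filter_upwards [ae_snd_mem_Icc volume] with q hq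
    by_cases hx : q.1 ∈ dilates (tsupport φ)
    · exact (hM q ⟨hx, hq⟩).trans (le_max_left _ _)
    · rw [dilationDeriv_eq_zero φ hq hx, norm_zero]; exact le_max_right _ _
  have := (hi'.comp_fst (volume.restrict (Icc (1 / 2 : ℝ) 1))).bdd_smul _
    (continuous_dilationDeriv_uncurry φ).aestronglyMeasurable hb
  refine this.congr ?_
  filter_upwards [ae_snd_mem_Icc volume] with q hq
  simp only [Pi.smul_apply']
  by_cases hx : q.1 ∈ dilates (tsupport φ)
  · rw [indicator_of_mem hx]
  · rw [dilationDeriv_eq_zero φ hq hx, zero_smul, zero_smul]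

theorem integrable_weight_dilation_prod {h : EuclideanSpace ℝ (Fin d) → X}
    (hm : StronglyMeasurable h)
    (hh : LocallyIntegrableOn h (halfSpace d : Set (EuclideanSpace ℝ (Fin d))) volume)
    {K : Set (EuclideanSpace ℝ (Fin d))} (hK : IsCompact K) (hKH : K ⊆ halfSpace d) :
    Integrable (fun q : EuclideanSpace ℝ (Fin d) × ℝ =>
        (q.2⁻¹ ^ 2 * q.1 0) • h (dilation q.2⁻¹ q.1))
      ((volume.restrict K).prod (volume.restrict (Icc (1 / 2 : ℝ) 1))) := by
  obtain ⟨M, hM⟩ := hK.exists_bound_of_continuousOn (f := fun x => x 0) (by fun_prop)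
  refine (integrable_dilation_prod hm hh hK hKH).bdd_smul (4 * M)
    (φ := fun q : EuclideanSpace ℝ (Fin d) × ℝ => q.2⁻¹ ^ 2 * q.1 0)
    (Measurable.aestronglyMeasurable (by fun_prop)) ?_
  have h1 : ∀ᵐ q ∂((volume.restrict K).prod (volume.restrict (Icc (1 / 2 : ℝ) 1))), q.1 ∈ K :=
    Measure.quasiMeasurePreserving_fst.ae (ae_restrict_mem hK.measurableSet)
  filter_upwards [h1, ae_snd_mem_Icc _] with q hq1 hq2
  have h0 : 0 < q.2 := lt_of_lt_of_le (by norm_num) hq2.1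
  have h2 : q.2⁻¹ ≤ 2 := by
    rw [show (2 : ℝ) = (1 / 2)⁻¹ by norm_num]
    exact inv_anti₀ (by norm_num) hq2.1
  rw [norm_mul, norm_pow, Real.norm_of_nonneg (inv_pos.2 h0).le]
  have h3 := hM _ hq1
  have h4 : q.2⁻¹ ^ 2 ≤ 4 := by
    calc q.2⁻¹ ^ 2 ≤ 2 ^ 2 := by gcongr
      _ = 4 := by norm_num
  gcongr

/-- Along dilations in the first coordinate, a function is recovered from its weak derivative. -/
theorem ae_eq_comp_dilation_two_sub [CompleteSpace X] {g h : EuclideanSpace ℝ (Fin d) → X}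
    (hhm : StronglyMeasurable h)
    (hg : LocallyIntegrableOn g (halfSpace d : Set (EuclideanSpace ℝ (Fin d))) volume)
    (hh : LocallyIntegrableOn h (halfSpace d : Set (EuclideanSpace ℝ (Fin d))) volume)
    (hgh : ∀ φ : 𝓓(halfSpace d, ℝ), ∫ x, φ x • h x =
      -∫ x, (fderiv ℝ φ x (EuclideanSpace.single 0 1)) • g x) :
    ∀ᵐ x, x ∈ (halfSpace d : Set (EuclideanSpace ℝ (Fin d))) → g x = g (dilation 2 x) -
      ∫ t in Icc (1 / 2 : ℝ) 1, (t⁻¹ ^ 2 * x 0) • h (dilation t⁻¹ x) := by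
  -- For smooth g, the curve t ↦ g(dilation t⁻¹ x) runs from g(dilation 2 x) at t = 1/2 to g(x) at t
  -- = 1 with derivative -t⁻² x₁ h(dilation t⁻¹ x). The proof below is the dual form of this
  -- computation, valid for weak derivatives.
  set Q : EuclideanSpace ℝ (Fin d) → X :=
    fun x => ∫ t in Icc (1 / 2 : ℝ) 1, (t⁻¹ ^ 2 * x 0) • h (dilation t⁻¹ x) with hQ
  have hgl := (locallyIntegrableOn_iff (halfSpace d).isOpen.isLocallyClosed).1 hg
  have hQl : LocallyIntegrableOn Q (halfSpace d : Set (EuclideanSpace ℝ (Fin d))) := by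
    rw [locallyIntegrableOn_iff (halfSpace d).isOpen.isLocallyClosed]
    intro K hKH hK
    exact (integrable_weight_dilation_prod hhm hh hK hKH).integral_prod_left
  have hg2l : LocallyIntegrableOn (fun x => g (dilation 2 x))
      (halfSpace d : Set (EuclideanSpace ℝ (Fin d))) := by
    rw [locallyIntegrableOn_iff (halfSpace d).isOpen.isLocallyClosed]
    intro K hKH hK
    have h1 : IntegrableOn g (dilates K) (volume.map (dilation 2)) := by
      rw [map_dilation_volume two_pos, IntegrableOn, Measure.restrict_smul]
      exact (hgl _ (dilates_subset hKH) (isCompact_dilates hK)).smul_measure (by simp)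
    refine ((measurableEmbedding_dilation two_pos).integrableOn_map_iff.1 h1).mono_set
      fun x hx => ⟨(2, x), ⟨⟨one_le_two, le_rfl⟩, hx⟩, rfl⟩
  have key := (halfSpace d).isOpen.ae_eq_zero_of_integral_contDiff_smul_eq_zero (μ := volume)
    ((hg.sub hg2l).add hQl) fun φ₀ hφ1 hφ2 hφ3 => ?_
  · filter_upwards [key] with x hx hxH
    have := hx hxH
    simp only [Pi.add_apply, Pi.sub_apply] at this
    rw [eq_sub_iff_add_eq, ← sub_eq_zero, ← this]
    abel
  obtain ⟨φ, hφ⟩ : ∃ φ : 𝓓(halfSpace d, ℝ), ∀ x, φ x = φ₀ x := ⟨⟨φ₀, hφ1, hφ2, hφ3⟩, fun _ => rfl⟩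
  simp only [← hφ]
  have hint (f : EuclideanSpace ℝ (Fin d) → X)
      (hf : LocallyIntegrableOn f (halfSpace d : Set (EuclideanSpace ℝ (Fin d))) volume) :
      Integrable (fun x => φ x • f x) volume :=
    φ.integrable_bilin (ContinuousLinearMap.lsmul ℝ ℝ) hf
  have e1 : ∫ x, φ x • g (dilation 2 x) = ∫ x, (2⁻¹ * φ (dilation 2⁻¹ x)) • g x := by
    have := integral_comp_dilation two_pos
      (fun x : EuclideanSpace ℝ (Fin d) => φ (dilation 2⁻¹ x) • g x)
    simp only [dilation_dilation, inv_mul_cancel₀ (two_ne_zero (α := ℝ)), dilation_one] at this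
    rw [this, ← integral_smul]
    simp only [smul_smul]
  have e2 : ∫ x, φ x • Q x = -∫ x, (φ x - 2⁻¹ * φ (dilation 2⁻¹ x)) • g x := by
    have hK := φ.hasCompactSupport
    have hF : Integrable (fun q : EuclideanSpace ℝ (Fin d) × ℝ =>
        φ q.1 • ((q.2⁻¹ ^ 2 * q.1 0) • h (dilation q.2⁻¹ q.1)))
        ((volume.restrict (tsupport φ)).prod (volume.restrict (Icc (1 / 2 : ℝ) 1))) := by
      obtain ⟨M, hM⟩ := hK.exists_bound_of_continuous φ.continuous
      exact (integrable_weight_dilation_prod hhm hh hK φ.tsupport_subset).bdd_smul M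
        (φ := fun q => φ q.1) (φ.continuous.comp continuous_fst).aestronglyMeasurable
        (ae_of_all _ fun q => hM q.1)
    calc ∫ x, φ x • Q x = ∫ x in tsupport φ, φ x • Q x := by
          refine (setIntegral_eq_integral_of_forall_compl_eq_zero fun x hx => ?_).symm
          rw [image_eq_zero_of_notMem_tsupport hx, zero_smul]
      _ = ∫ x in tsupport φ, ∫ t in Icc (1 / 2 : ℝ) 1,
            φ x • ((t⁻¹ ^ 2 * x 0) • h (dilation t⁻¹ x)) := by
          simp only [hQ, integral_smul]
      _ = ∫ t in Icc (1 / 2 : ℝ) 1, ∫ x in tsupport φ,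
            φ x • ((t⁻¹ ^ 2 * x 0) • h (dilation t⁻¹ x)) := integral_integral_swap hF
      -- For fixed t the dilation is moved from `h` to `φ`. The Jacobian t and the factor t from `x
      -- 0` cancel t⁻², so `h` is paired exactly with `dilationTest φ ht`, and the weak derivative
      -- can be integrated by parts.
      _ = ∫ t in Icc (1 / 2 : ℝ) 1, -∫ x, dilationDeriv φ t x • g x := by
          refine setIntegral_congr_fun measurableSet_Icc fun t ht => ?_
          have h0 : 0 < t := lt_of_lt_of_le (by norm_num) ht.1
          simp only
          rw [setIntegral_eq_integral_of_forall_compl_eq_zero fun x hx => by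
            rw [image_eq_zero_of_notMem_tsupport hx, zero_smul]]
          have h1 := integral_comp_dilation (inv_pos.2 h0)
            (fun x : EuclideanSpace ℝ (Fin d) =>
              φ (dilation t x) • ((t⁻¹ ^ 2 * (t * x 0)) • h x))
          simp only [dilation_dilation, dilation_apply_zero, mul_inv_cancel₀ h0.ne', dilation_one,
            mul_inv_cancel_left₀ h0.ne'] at h1
          have h2 := hgh (dilationTest φ ht)
          simp only [fderiv_dilationTest, dilationTest_apply] at h2
          rw [h1, ← h2, ← integral_smul]
          refine integral_congr_ae (ae_of_all _ fun x => ?_)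
          simp only [smul_smul]
          congr 1
          field_simp
      _ = -∫ x, ∫ t in Icc (1 / 2 : ℝ) 1, dilationDeriv φ t x • g x := by
          rw [integral_neg]
          congr 1
          exact (integral_integral_swap (integrable_dilationDeriv_smul φ hg)).symm
      _ = _ := by
          simp only [integral_smul_const, integral_dilationDeriv]
  have i1 := hint g hg
  have i2 := hint _ hg2l
  have i3 := hint Q hQl
  -- The dilated test function is not supported in a set treated by `hint`; integrability is
  -- transported from `i2` by the change of variables.
  have i2' : Integrable fun x => (2⁻¹ * φ (dilation 2⁻¹ x)) • g x := by
    have h1 : Integrable (fun x => φ (dilation 2⁻¹ x) • g x) (volume.map (dilation 2)) := by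
      rw [(measurableEmbedding_dilation two_pos).integrable_map_iff]
      simpa [Function.comp_def, dilation_dilation] using i2
    rw [map_dilation_volume two_pos, integrable_smul_measure (by simp) (by simp)] at h1
    have h2 := h1.smul (2⁻¹ : ℝ)
    simp only [mul_smul]
    exact h2
  simp only [Pi.add_apply, Pi.sub_apply, smul_add, smul_sub]
  have i12 : Integrable (fun x => φ x • g x - φ x • g (dilation 2 x)) volume := i1.sub i2
  rw [integral_add i12 i3, integral_sub i1 i2, e1, e2]
  simp only [sub_smul]
  rw [integral_sub i1 i2']
  abel

end WeakDerivative
end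

/-! ### Hardy's inequality -/

noncomputable section

section Hardy

/-- Hölder's inequality against the constant 1, whose norm is at most 1 when the total mass is. -/
theorem lintegral_rpow_le_lintegral_rpow {A : Type*} [MeasurableSpace A] {τ : Measure A}
    (hτ : τ univ ≤ 1) {P : ℝ} (hP : 1 ≤ P) {f : A → ℝ≥0∞} (hf : Measurable f) :
    (∫⁻ a, f a ∂τ) ^ P ≤ ∫⁻ a, f a ^ P ∂τ := by
  have h := eLpNorm'_le_eLpNorm'_mul_rpow_measure_univ (μ := τ) one_pos hP
    hf.aestronglyMeasurable
  simp only [eLpNorm', enorm_eq_self, ENNReal.rpow_one, div_one] at h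
  have h1 : τ univ ^ (1 - 1 / P) ≤ 1 := by
    refine ENNReal.rpow_le_one hτ ?_
    rw [sub_nonneg, div_le_one (by linarith)]
    exact hP
  calc (∫⁻ a, f a ∂τ) ^ P ≤ ((∫⁻ a, f a ^ P ∂τ) ^ (1 / P)) ^ P := by
        gcongr
        exact h.trans (mul_le_of_le_one_right' h1)
    _ = _ := by rw [← ENNReal.rpow_mul, one_div_mul_cancel (by linarith), ENNReal.rpow_one]

variable {d : ℕ} [NeZero d]

/-- The power weight `|x₁| ^ s`. -/
def weight (s : ℝ) (x : EuclideanSpace ℝ (Fin d)) : ℝ≥0∞ := ENNReal.ofReal (|x 0| ^ s)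

theorem measurable_weight (s : ℝ) :
    Measurable (weight s : EuclideanSpace ℝ (Fin d) → ℝ≥0∞) := by
  unfold weight
  fun_prop

theorem setLIntegral_powerMeasure (s : ℝ) {S : Set (EuclideanSpace ℝ (Fin d))}
    (hS : MeasurableSet S) (hSH : S ⊆ halfSpace d) {F : EuclideanSpace ℝ (Fin d) → ℝ≥0∞}
    (hF : Measurable F) :
    ∫⁻ x in S, F x ∂(powerMeasure d s) = ∫⁻ x in S, weight s x * F x := by
  rw [powerMeasure, restrict_withDensity hS, Measure.restrict_restrict hS,
    inter_eq_left.2 hSH]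
  exact lintegral_withDensity_eq_lintegral_mul _ (measurable_weight s) hF

theorem restrict_powerMeasure (s : ℝ) :
    (powerMeasure d s).restrict (halfSpace d : Set (EuclideanSpace ℝ (Fin d))) =
      powerMeasure d s := by
  have hm := (halfSpace d).isOpen.measurableSet
  rw [powerMeasure, restrict_withDensity hm, Measure.restrict_restrict hm, inter_self]

theorem lintegral_powerMeasure (s : ℝ) {F : EuclideanSpace ℝ (Fin d) → ℝ≥0∞}
    (hF : Measurable F) :
    ∫⁻ x, F x ∂(powerMeasure d s) =
      ∫⁻ x in (halfSpace d : Set (EuclideanSpace ℝ (Fin d))), weight s x * F x := by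
  rw [← setLIntegral_powerMeasure s (halfSpace d).isOpen.measurableSet subset_rfl hF,
    restrict_powerMeasure]

theorem weight_add {s t : ℝ} {x : EuclideanSpace ℝ (Fin d)} (hx : x ∈ halfSpace d) :
    weight (s + t) x = weight s x * weight t x := by
  have hx0 : 0 < |x 0| := abs_pos.2 (ne_of_gt hx)
  rw [weight, Real.rpow_add hx0, ENNReal.ofReal_mul (by positivity)]
  rfl

theorem weight_dilation (s : ℝ) {t : ℝ} (ht : 0 < t) (x : EuclideanSpace ℝ (Fin d)) :
    weight s (dilation t x) = ENNReal.ofReal (t ^ s) * weight s x := by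
  rw [weight, dilation_apply_zero, abs_mul, abs_of_pos ht, Real.mul_rpow ht.le (abs_nonneg _),
    ENNReal.ofReal_mul (by positivity)]
  rfl

theorem weight_eq_mul_dilation (s : ℝ) {t : ℝ} (ht : 0 < t) (x : EuclideanSpace ℝ (Fin d)) :
    weight s x = ENNReal.ofReal (t ^ (-s)) * weight s (dilation t x) := by
  rw [weight_dilation s ht, ← mul_assoc, ← ENNReal.ofReal_mul (by positivity),
    ← Real.rpow_add ht, neg_add_cancel, Real.rpow_zero, ENNReal.ofReal_one, one_mul]

theorem measurableSet_lt_coord (ε : ℝ) :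
    MeasurableSet {x : EuclideanSpace ℝ (Fin d) | ε < x 0} :=
  measurableSet_lt measurable_const (by fun_prop)

variable {X : Type*} [NormedAddCommGroup X]

/-- The factor is 2⁻¹ from the Jacobian times 2^(-ν) from the weight, and the dilation maps the
region x₁ > ε into itself. For ν > -1 the factor is below 1, which is the contraction behind Hardy's
inequality. -/
theorem lintegral_weight_comp_dilation_two (ν : ℝ) {P ε : ℝ} (hε : 0 < ε)
    (g : EuclideanSpace ℝ (Fin d) → X) :
    ∫⁻ x in {x : EuclideanSpace ℝ (Fin d) | ε < x 0}, weight ν x * ‖g (dilation 2 x)‖ₑ ^ P ≤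
      ENNReal.ofReal (2 ^ (-(1 + ν))) *
        ∫⁻ x in {x : EuclideanSpace ℝ (Fin d) | ε < x 0}, weight ν x * ‖g x‖ₑ ^ P := by
  calc ∫⁻ x in {x : EuclideanSpace ℝ (Fin d) | ε < x 0}, weight ν x * ‖g (dilation 2 x)‖ₑ ^ P
      = ∫⁻ x in {x : EuclideanSpace ℝ (Fin d) | ε < x 0}, (fun y => ENNReal.ofReal (2 ^ (-ν)) *
          (weight ν y * ‖g y‖ₑ ^ P)) (dilation 2 x) := by
        refine lintegral_congr fun x => ?_
        rw [weight_eq_mul_dilation ν two_pos x, mul_assoc]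
    _ = ENNReal.ofReal 2⁻¹ * ∫⁻ y in {x : EuclideanSpace ℝ (Fin d) | 2 * ε < x 0},
          ENNReal.ofReal (2 ^ (-ν)) * (weight ν y * ‖g y‖ₑ ^ P) :=
        setLIntegral_comp_dilation two_pos (measurableSet_lt_coord ε) (measurableSet_lt_coord _)
          (fun x => by simp) (fun y => ENNReal.ofReal (2 ^ (-ν)) * (weight ν y * ‖g y‖ₑ ^ P))
    _ = ENNReal.ofReal (2 ^ (-(1 + ν))) * ∫⁻ y in {x : EuclideanSpace ℝ (Fin d) | 2 * ε < x 0},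
          weight ν y * ‖g y‖ₑ ^ P := by
        rw [lintegral_const_mul' _ _ ENNReal.ofReal_ne_top, ← mul_assoc,
          ← ENNReal.ofReal_mul (by norm_num), neg_add, Real.rpow_add two_pos, Real.rpow_neg_one]
    _ ≤ _ := by
        gcongr
        linarith

/-- After Tonelli, each fixed t contributes the factor t^(1 + σ) ≤ 1 by substitution, the half-space
being invariant; the t-interval has length below 1. -/
theorem lintegral_weight_dilation_inv_le {P σ : ℝ} (hσ : -1 ≤ σ)
    {h : EuclideanSpace ℝ (Fin d) → X} (hm : StronglyMeasurable h) :
    ∫⁻ x in (halfSpace d : Set (EuclideanSpace ℝ (Fin d))), weight σ x *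
        ∫⁻ t in Icc (1 / 2 : ℝ) 1, ‖h (dilation t⁻¹ x)‖ₑ ^ P ≤
      ∫⁻ x in (halfSpace d : Set (EuclideanSpace ℝ (Fin d))), weight σ x * ‖h x‖ₑ ^ P := by
  have hmm : Measurable fun q : EuclideanSpace ℝ (Fin d) × ℝ =>
      ‖h (dilation q.2⁻¹ q.1)‖ₑ ^ P :=
    (hm.comp_measurable measurable_dilation_inv_uncurry).enorm.pow_const P
  set J := ∫⁻ x in (halfSpace d : Set (EuclideanSpace ℝ (Fin d))), weight σ x * ‖h x‖ₑ ^ P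
  calc ∫⁻ x in (halfSpace d : Set (EuclideanSpace ℝ (Fin d))), weight σ x *
        ∫⁻ t in Icc (1 / 2 : ℝ) 1, ‖h (dilation t⁻¹ x)‖ₑ ^ P
      = ∫⁻ x in (halfSpace d : Set (EuclideanSpace ℝ (Fin d))),
          ∫⁻ t in Icc (1 / 2 : ℝ) 1, weight σ x * ‖h (dilation t⁻¹ x)‖ₑ ^ P := by
        refine lintegral_congr fun x => ?_
        rw [lintegral_const_mul' (weight σ x) _ ENNReal.ofReal_ne_top]
    _ = ∫⁻ t in Icc (1 / 2 : ℝ) 1, ∫⁻ x in (halfSpace d : Set (EuclideanSpace ℝ (Fin d))),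
          weight σ x * ‖h (dilation t⁻¹ x)‖ₑ ^ P :=
        lintegral_lintegral_swap (((measurable_weight σ).comp measurable_fst).mul hmm).aemeasurable
    _ ≤ ∫⁻ t in Icc (1 / 2 : ℝ) 1, J := by
        refine setLIntegral_mono' measurableSet_Icc fun t ht => ?_
        have h0 : 0 < t := lt_of_lt_of_le (by norm_num) ht.1
        calc ∫⁻ x in (halfSpace d : Set (EuclideanSpace ℝ (Fin d))),
              weight σ x * ‖h (dilation t⁻¹ x)‖ₑ ^ P
            = ∫⁻ x in (halfSpace d : Set (EuclideanSpace ℝ (Fin d))),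
              (fun y => ENNReal.ofReal (t⁻¹ ^ (-σ)) * (weight σ y * ‖h y‖ₑ ^ P))
                (dilation t⁻¹ x) := by
              refine lintegral_congr fun x => ?_
              rw [weight_eq_mul_dilation σ (inv_pos.2 h0) x, mul_assoc]
          _ = ENNReal.ofReal t⁻¹⁻¹ * ∫⁻ x in (halfSpace d : Set (EuclideanSpace ℝ (Fin d))),
              ENNReal.ofReal (t⁻¹ ^ (-σ)) * (weight σ x * ‖h x‖ₑ ^ P) :=
              setLIntegral_comp_dilation (inv_pos.2 h0) (halfSpace d).isOpen.measurableSet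
                (halfSpace d).isOpen.measurableSet
                (fun x => (dilation_mem_halfSpace (inv_pos.2 h0) x).symm)
                (fun y => ENNReal.ofReal (t⁻¹ ^ (-σ)) * (weight σ y * ‖h y‖ₑ ^ P))
          _ = ENNReal.ofReal (t ^ (1 + σ)) * J := by
              rw [lintegral_const_mul' _ _ ENNReal.ofReal_ne_top, ← mul_assoc, inv_inv,
                ← ENNReal.ofReal_mul h0.le, Real.inv_rpow h0.le, Real.rpow_neg h0.le, inv_inv,
                Real.rpow_add h0, Real.rpow_one]
          _ ≤ 1 * J := by
              gcongr
              exact ENNReal.ofReal_le_one.2 (Real.rpow_le_one h0.le ht.2 (by linarith))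
          _ = J := one_mul J
    _ = J * ENNReal.ofReal (1 / 2) := by
        rw [lintegral_const, Measure.restrict_apply_univ, Real.volume_Icc]
        norm_num
    _ ≤ J * 1 := by
        gcongr
        exact ENNReal.ofReal_le_one.2 (by norm_num)
    _ = J := mul_one J

/-- The constant in Hardy's inequality. -/
def hardyConst (P σ : ℝ) : ℝ≥0∞ :=
  ENNReal.ofReal (4 / (1 - 2 ^ (-(1 + (σ - P)) / P))) ^ P

theorem hardyConst_ne_top {P : ℝ} (hP : 1 ≤ P) (σ : ℝ) : hardyConst P σ ≠ ∞ :=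
  ENNReal.rpow_ne_top_of_nonneg (by linarith) ENNReal.ofReal_ne_top

/-- **Hardy's inequality** for a function with weak derivative in the first direction, away from
the boundary. -/
theorem hardy_inequality_lt_coord [NormedSpace ℝ X] [CompleteSpace X] {P σ ε : ℝ} (hP : 1 ≤ P)
    (hσ : P - 1 < σ) (hε : 0 < ε) {g h : EuclideanSpace ℝ (Fin d) → X} (hgm : StronglyMeasurable g)
    (hhm : StronglyMeasurable h)
    (hg : LocallyIntegrableOn g (halfSpace d : Set (EuclideanSpace ℝ (Fin d))) volume)
    (hh : LocallyIntegrableOn h (halfSpace d : Set (EuclideanSpace ℝ (Fin d))) volume)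
    (hgh : ∀ φ : 𝓓(halfSpace d, ℝ), ∫ x, φ x • h x =
      -∫ x, (fderiv ℝ φ x (EuclideanSpace.single 0 1)) • g x)
    (hfin : ∫⁻ x, ‖g x‖ₑ ^ P ∂(powerMeasure d σ) ≠ ∞) :
    ∫⁻ x in {x : EuclideanSpace ℝ (Fin d) | ε < x 0}, ‖g x‖ₑ ^ P ∂(powerMeasure d (σ - P)) ≤
      hardyConst P σ * ∫⁻ x, ‖h x‖ₑ ^ P ∂(powerMeasure d σ) := by
  have hP0 : 0 < P := by linarith
  set S := {x : EuclideanSpace ℝ (Fin d) | ε < x 0}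
  have hSm : MeasurableSet S := measurableSet_lt_coord ε
  have hSH : S ⊆ halfSpace d := fun x hx => hε.trans hx
  set J := ∫⁻ x, ‖h x‖ₑ ^ P ∂(powerMeasure d σ) with hJ
  have hJ' := lintegral_powerMeasure (d := d) σ (hhm.enorm.pow_const P)
  set N := ∫⁻ x in S, ‖g x‖ₑ ^ P ∂(powerMeasure d (σ - P))
  have hN' : N = ∫⁻ x in S, weight (σ - P) x * ‖g x‖ₑ ^ P :=
    setLIntegral_powerMeasure _ hSm hSH (hgm.enorm.pow_const P)
  -- Finiteness of the left side is what permits absorption later, and it is the reason for staying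
  -- away from the boundary: for x₁ > ε the extra weight |x₁|^(-P) is at most ε^(-P).
  have hNfin : N ≠ ∞ := by
    have : N ≤ ENNReal.ofReal (ε ^ (-P)) * ∫⁻ x, ‖g x‖ₑ ^ P ∂(powerMeasure d σ) := by
      rw [lintegral_powerMeasure σ (hgm.enorm.pow_const P), hN',
        ← lintegral_const_mul' _ _ ENNReal.ofReal_ne_top]
      refine (setLIntegral_mono' hSm fun x hx => ?_).trans (lintegral_mono_set hSH)
      rw [sub_eq_add_neg, weight_add (hSH hx), mul_comm (weight σ x), mul_assoc]
      gcongr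
      refine ENNReal.ofReal_le_ofReal ?_
      have hx0 : ε < x 0 := hx
      rw [abs_of_pos (hε.trans hx0)]
      exact Real.rpow_le_rpow_of_nonpos hε hx0.le (by linarith)
    exact ne_top_of_le_ne_top (ENNReal.mul_ne_top ENNReal.ofReal_ne_top hfin) this
  set Q : EuclideanSpace ℝ (Fin d) → X :=
    fun x => ∫ t in Icc (1 / 2 : ℝ) 1, (t⁻¹ ^ 2 * x 0) • h (dilation t⁻¹ x)
  have hQm : StronglyMeasurable Q := by
    refine StronglyMeasurable.integral_prod_right' (f := fun q : EuclideanSpace ℝ (Fin d) × ℝ =>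
      (q.2⁻¹ ^ 2 * q.1 0) • h (dilation q.2⁻¹ q.1)) ?_
    refine StronglyMeasurable.smul (Measurable.stronglyMeasurable (by fun_prop)) ?_
    exact hhm.comp_measurable measurable_dilation_inv_uncurry
  have hg2m : StronglyMeasurable fun x => g (dilation 2 x) :=
    hgm.comp_measurable (dilation 2).continuous.measurable
  have hpart1 : ∫⁻ x in S, ‖g (dilation 2 x)‖ₑ ^ P ∂(powerMeasure d (σ - P)) ≤
      ENNReal.ofReal (2 ^ (-(1 + (σ - P)))) * N := by
    rw [setLIntegral_powerMeasure _ hSm hSH (hg2m.enorm.pow_const P), hN']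
    exact lintegral_weight_comp_dilation_two _ hε g
  -- The factor `x 0` in `Q`, raised to the power `P`, lifts the weight exponent from σ - P to σ;
  -- the 4 bounds t⁻² on [1/2, 1].
  have hpart2 : ∫⁻ x in S, ‖Q x‖ₑ ^ P ∂(powerMeasure d (σ - P)) ≤ ENNReal.ofReal 4 ^ P * J := by
    rw [setLIntegral_powerMeasure _ hSm hSH (hQm.enorm.pow_const P), hJ, hJ']
    refine le_trans ?_ (mul_le_mul_right (lintegral_weight_dilation_inv_le (P := P)
      (by linarith : -1 ≤ σ) hhm) _)
    rw [← lintegral_const_mul' _ _ (ENNReal.rpow_ne_top_of_nonneg hP0.le ENNReal.ofReal_ne_top)]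
    refine (setLIntegral_mono' hSm fun x hx => ?_).trans (lintegral_mono_set hSH)
    have hx0 : 0 < x 0 := hSH hx
    have hmx : Measurable fun t : ℝ => ‖h (dilation t⁻¹ x)‖ₑ :=
      (hhm.comp_measurable (measurable_dilation_inv_uncurry.comp measurable_prodMk_left)).enorm
    have h1 : ‖Q x‖ₑ ≤ ENNReal.ofReal 4 * ENNReal.ofReal |x 0| *
        ∫⁻ t in Icc (1 / 2 : ℝ) 1, ‖h (dilation t⁻¹ x)‖ₑ := by
      refine (enorm_integral_le_lintegral_enorm _).trans ?_
      rw [← lintegral_const_mul _ hmx]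
      refine setLIntegral_mono' measurableSet_Icc fun t ht => ?_
      have h0 : 0 < t := lt_of_lt_of_le (by norm_num) ht.1
      rw [enorm_smul, ← ENNReal.ofReal_mul (by norm_num)]
      gcongr
      rw [Real.enorm_eq_ofReal_abs, abs_mul]
      refine ENNReal.ofReal_le_ofReal ?_
      gcongr
      have h2 : t⁻¹ ≤ 2 := by
        rw [show (2 : ℝ) = (1 / 2)⁻¹ by norm_num]
        exact inv_anti₀ (by norm_num) ht.1
      rw [abs_of_pos (by positivity)]
      calc t⁻¹ ^ 2 ≤ 2 ^ 2 := by gcongr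
        _ = 4 := by norm_num
    calc weight (σ - P) x * ‖Q x‖ₑ ^ P
        ≤ weight (σ - P) x * (ENNReal.ofReal 4 * ENNReal.ofReal |x 0| *
          ∫⁻ t in Icc (1 / 2 : ℝ) 1, ‖h (dilation t⁻¹ x)‖ₑ) ^ P := by gcongr
      _ = ENNReal.ofReal 4 ^ P * ((weight (σ - P) x * ENNReal.ofReal |x 0| ^ P) *
          (∫⁻ t in Icc (1 / 2 : ℝ) 1, ‖h (dilation t⁻¹ x)‖ₑ) ^ P) := by
          rw [ENNReal.mul_rpow_of_nonneg _ _ hP0.le, ENNReal.mul_rpow_of_nonneg _ _ hP0.le]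
          ring
      _ = ENNReal.ofReal 4 ^ P * (weight σ x *
          (∫⁻ t in Icc (1 / 2 : ℝ) 1, ‖h (dilation t⁻¹ x)‖ₑ) ^ P) := by
          rw [ENNReal.ofReal_rpow_of_nonneg (abs_nonneg _) hP0.le]
          have := weight_add (s := σ - P) (t := P) (hSH hx)
          rw [sub_add_cancel] at this
          rw [this]
          rfl
      _ ≤ _ := by
          gcongr
          refine lintegral_rpow_le_lintegral_rpow ?_ hP hmx
          rw [Measure.restrict_apply_univ, Real.volume_Icc]
          exact ENNReal.ofReal_le_one.2 (by norm_num)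
  have hmink : N ^ (1 / P) ≤
      (∫⁻ x in S, ‖g (dilation 2 x)‖ₑ ^ P ∂(powerMeasure d (σ - P))) ^ (1 / P) +
      (∫⁻ x in S, ‖Q x‖ₑ ^ P ∂(powerMeasure d (σ - P))) ^ (1 / P) := by
    refine le_trans ?_ (ENNReal.lintegral_Lp_add_le hg2m.enorm.aemeasurable
      hQm.enorm.aemeasurable hP)
    refine ENNReal.rpow_le_rpow ?_ (by positivity)
    refine lintegral_mono_ae ?_
    have hae := ae_eq_comp_dilation_two_sub hhm hg hh hgh
    rw [← ae_restrict_iff' (halfSpace d).isOpen.measurableSet, Filter.Eventually,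
      ← ae_powerMeasure (σ - P)] at hae
    filter_upwards [ae_restrict_of_ae hae] with x hx
    gcongr
    rw [hx]
    exact enorm_sub_le
  -- The contraction factor of the dilation at the level of norms; it is below 1 because σ > P - 1.
  set q : ℝ := 2 ^ (-(1 + (σ - P)) / P)
  have hq0 : 0 ≤ q := by positivity
  have hq1 : q < 1 := Real.rpow_lt_one_of_one_lt_of_neg one_lt_two
    (div_neg_of_neg_of_pos (by linarith) hP0)
  have hmain : N ^ (1 / P) ≤ ENNReal.ofReal q * N ^ (1 / P) + ENNReal.ofReal 4 * J ^ (1 / P) := by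
    refine hmink.trans (add_le_add ?_ ?_)
    · refine (ENNReal.rpow_le_rpow hpart1 (by positivity)).trans_eq ?_
      rw [ENNReal.mul_rpow_of_nonneg _ _ (by positivity),
        ENNReal.ofReal_rpow_of_nonneg (by positivity) (by positivity), ← Real.rpow_mul two_pos.le,
        mul_one_div]
    · refine (ENNReal.rpow_le_rpow hpart2 (by positivity)).trans_eq ?_
      rw [ENNReal.mul_rpow_of_nonneg _ _ (by positivity), ← ENNReal.rpow_mul,
        mul_one_div_cancel hP0.ne', ENNReal.rpow_one]
  have hNfin' : N ^ (1 / P) ≠ ∞ := ENNReal.rpow_ne_top_of_nonneg (by positivity) hNfin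
  -- The term with factor q is absorbed into the left side, which produces the constant 4 / (1 - q).
  -- Infinite `J` is trivial and treated apart.
  have hfinal : N ^ (1 / P) ≤ ENNReal.ofReal (4 / (1 - q)) * J ^ (1 / P) := by
    rcases eq_or_ne (J ^ (1 / P)) ∞ with hJt | hJt
    · rw [hJt, ENNReal.mul_top (by
        rw [Ne, ENNReal.ofReal_eq_zero, not_le]
        exact div_pos (by norm_num) (by linarith))]
      exact le_top
    · lift N ^ (1 / P) to ℝ≥0 using hNfin' with a
      lift J ^ (1 / P) to ℝ≥0 using hJt with b
      rw [ENNReal.ofReal, ENNReal.ofReal] at hmain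
      rw [ENNReal.ofReal]
      norm_cast at hmain ⊢
      rw [← NNReal.coe_le_coe] at hmain ⊢
      push_cast at hmain ⊢
      rw [Real.coe_toNNReal _ hq0, Real.coe_toNNReal _ (by norm_num)] at hmain
      rw [Real.coe_toNNReal _ (div_nonneg (by norm_num) (by linarith)), div_mul_eq_mul_div,
        le_div_iff₀ (by linarith)]
      linarith
  calc N = (N ^ (1 / P)) ^ P := by
        rw [← ENNReal.rpow_mul, one_div_mul_cancel hP0.ne', ENNReal.rpow_one]
    _ ≤ (ENNReal.ofReal (4 / (1 - q)) * J ^ (1 / P)) ^ P := by gcongr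
    _ = _ := by
        rw [ENNReal.mul_rpow_of_nonneg _ _ hP0.le, ← ENNReal.rpow_mul, one_div_mul_cancel hP0.ne',
          ENNReal.rpow_one, hardyConst]

/-- The constant away from the boundary does not depend on ε, so the regions x₁ > 1/(n+1) can be
exhausted monotonically. -/
theorem hardy_inequality [NormedSpace ℝ X] [CompleteSpace X] {P σ : ℝ} (hP : 1 ≤ P)
    (hσ : P - 1 < σ) {g h : EuclideanSpace ℝ (Fin d) → X} (hgm : StronglyMeasurable g)
    (hhm : StronglyMeasurable h)
    (hg : LocallyIntegrableOn g (halfSpace d : Set (EuclideanSpace ℝ (Fin d))) volume)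
    (hh : LocallyIntegrableOn h (halfSpace d : Set (EuclideanSpace ℝ (Fin d))) volume)
    (hgh : ∀ φ : 𝓓(halfSpace d, ℝ), ∫ x, φ x • h x =
      -∫ x, (fderiv ℝ φ x (EuclideanSpace.single 0 1)) • g x)
    (hfin : ∫⁻ x, ‖g x‖ₑ ^ P ∂(powerMeasure d σ) ≠ ∞) :
    ∫⁻ x, ‖g x‖ₑ ^ P ∂(powerMeasure d (σ - P)) ≤
      hardyConst P σ * ∫⁻ x, ‖h x‖ₑ ^ P ∂(powerMeasure d σ) := by
  have hU : (halfSpace d : Set (EuclideanSpace ℝ (Fin d))) =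
      ⋃ n : ℕ, {x : EuclideanSpace ℝ (Fin d) | 1 / ((n : ℝ) + 1) < x 0} := by
    refine subset_antisymm (fun x hx => ?_) (iUnion_subset fun n x hx => ?_)
    · obtain ⟨n, hn⟩ := exists_nat_one_div_lt (show (0 : ℝ) < x 0 from hx)
      exact mem_iUnion.2 ⟨n, hn⟩
    · exact lt_trans (show (0 : ℝ) < 1 / ((n : ℝ) + 1) by positivity) hx
  rw [← restrict_powerMeasure (σ - P), hU, setLIntegral_iUnion_of_directed]
  · exact iSup_le fun n =>
      hardy_inequality_lt_coord hP hσ (by positivity) hgm hhm hg hh hgh hfin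
  · refine Monotone.directed_le (fun m n hmn x hx => ?_)
    have h1 : 1 / ((n : ℝ) + 1) ≤ 1 / ((m : ℝ) + 1) :=
      one_div_le_one_div_of_le (by positivity) (by simpa using hmn)
    exact lt_of_le_of_lt h1 hx

end Hardy
end

/-! ### Iterated Hardy inequalities for Sobolev functions -/

noncomputable section

section SobolevHardy

variable {d : ℕ} [NeZero d] {X : Type*} [NormedAddCommGroup X] [NormedSpace ℂ X]
  {p : ℝ≥0∞} [Fact (1 ≤ p)]

theorem one_le_toReal (hp : p ≠ ∞) : 1 ≤ p.toReal := by
  simpa using ENNReal.toReal_mono hp (Fact.out : 1 ≤ p)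

theorem lintegral_enorm_rpow_eq (hp : p ≠ ∞) {A : Type*} [MeasurableSpace A] {μ : Measure A}
    (f : Lp X p μ) : ∫⁻ x, ‖f x‖ₑ ^ p.toReal ∂μ = ‖f‖ₑ ^ p.toReal := by
  have hP := one_le_toReal hp
  have hp0 : p ≠ 0 := (zero_lt_one.trans_le (Fact.out : 1 ≤ p)).ne'
  rw [Lp.enorm_def, eLpNorm_eq_lintegral_rpow_enorm_toReal hp0 hp, ← ENNReal.rpow_mul,
    one_div_mul_cancel (by linarith), ENNReal.rpow_one]

variable {k : ℕ} {γ : ℝ}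

/-- The multi-index `α` with first entry replaced by `min j (α 0)`. -/
def MultiIndex.setFst (α : MultiIndex d k) (j : ℕ) : MultiIndex d k :=
  ⟨Function.update α.1 0 (min j (α.1 0)), (Finset.sum_le_sum fun i _ => by
    by_cases hi : i = 0
    · subst hi; simp
    · simp [hi]).trans α.2⟩

theorem sum_update_zero (α : Fin d → ℕ) (j : ℕ) :
    ∑ i, Function.update α 0 j i + α 0 = ∑ i, α i + j := by
  rw [Finset.sum_update_of_mem (Finset.mem_univ _),
    ← Finset.sum_sdiff (Finset.subset_univ {(0 : Fin d)}) (f := α),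
    Finset.sum_singleton]
  ring

/-- The multi-index `α + e₁`, where `e₁` is the first unit vector. -/
def MultiIndex.succFst (α : MultiIndex d k) (h : ∑ i, α.1 i + 1 ≤ k) : MultiIndex d k :=
  ⟨Function.update α.1 0 (α.1 0 + 1), by have := sum_update_zero α.1 (α.1 0 + 1); omega⟩

theorem MultiIndex.sum_succFst (α : MultiIndex d k) (h : ∑ i, α.1 i + 1 ≤ k) :
    ∑ i, (α.succFst h).1 i = ∑ i, α.1 i + 1 := by
  have := sum_update_zero α.1 (α.1 0 + 1)
  change ∑ i, Function.update α.1 0 (α.1 0 + 1) i = _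
  omega

/-- Puts the Sobolev relation between ∂^α and ∂₁∂^α into the integrated form in which Hardy's
inequality asks for it. -/
theorem integral_smul_succFst (F : weightedSobolev d X k p γ) (α : MultiIndex d k)
    (h : ∑ i, α.1 i + 1 ≤ k) (φ : 𝓓(halfSpace d, ℝ)) :
    ∫ x, φ x • F.1 (α.succFst h) x =
      -∫ x, (fderiv ℝ φ x (EuclideanSpace.single 0 1)) • F.1 α x := by
  have h1 := F.2 (α.succFst h)
  have h2 := lineDerivOp_distribDeriv α.1 (α.1 0) (lpToDistribution d X p γ (F.1 0))
  rw [Function.update_eq_self, ← F.2 α] at h2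
  have h3 : lpToDistribution d X p γ (F.1 (α.succFst h)) =
      ∂_{EuclideanSpace.single (0 : Fin d) (1 : ℝ)} (lpToDistribution d X p γ (F.1 α)) :=
    h1.trans h2.symm
  have h4 := congrArg (fun T : 𝓓'(halfSpace d, X) => T φ) h3
  simp only [Distribution.lineDerivOp_apply_apply, map_neg, lpToDistribution_apply,
    lineDerivOp_testFunction_apply] at h4
  exact h4

theorem enorm_apply_rpow_le (hp : p ≠ ∞) (F : weightedSobolev d X k p γ) (α : MultiIndex d k) :
    ∫⁻ x, ‖F.1 α x‖ₑ ^ p.toReal ∂(powerMeasure d γ) ≤ ‖F‖ₑ ^ p.toReal := by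
  have hP := one_le_toReal hp
  rw [lintegral_enorm_rpow_eq hp]
  gcongr
  exact PiLp.enorm_apply_le F.1 α

theorem rpow_enorm_ne_top (hp : p ≠ ∞) (F : weightedSobolev d X k p γ) :
    ‖F‖ₑ ^ p.toReal ≠ ∞ :=
  ENNReal.rpow_ne_top_of_nonneg (by have := one_le_toReal hp; linarith) enorm_ne_top

/-- The constant in the iterated Hardy inequality. -/
def hardyProd (P γ : ℝ) (j : ℕ) : ℝ≥0∞ := ∏ i ∈ Finset.range j, hardyConst P (γ - i * P)

theorem hardyProd_ne_top {P : ℝ} (hP : 1 ≤ P) (γ : ℝ) (j : ℕ) : hardyProd P γ j ≠ ∞ :=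
  ENNReal.prod_ne_top fun _ _ => hardyConst_ne_top hP _

/-- Each application of Hardy's inequality lowers the weight exponent by p at the price of one more
derivative in x₁, and the induction hypothesis for the same α supplies the finiteness it requires.
-/
theorem hardy_iterate [CompleteSpace X] (hp : p ≠ ∞) (hk : k * p.toReal - 1 < γ)
    (F : weightedSobolev d X k p γ) (j : ℕ) :
    ∀ α : MultiIndex d k, ∑ i, α.1 i + j ≤ k →
      ∫⁻ x, ‖F.1 α x‖ₑ ^ p.toReal ∂(powerMeasure d (γ - j * p.toReal)) ≤
        hardyProd p.toReal γ j * ‖F‖ₑ ^ p.toReal := by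
  have hP := one_le_toReal hp
  induction j with
  | zero =>
    intro α hα
    simpa [hardyProd] using enorm_apply_rpow_le hp F α
  | succ j ih =>
    intro α hα
    have hjk : (j : ℝ) + 1 ≤ k := by
      have : j + 1 ≤ k := by omega
      exact_mod_cast this
    -- The next step is admissible when γ > (j + 1)p - 1; this follows from γ > kp - 1 because j + 1
    -- ≤ k.
    have hσ : p.toReal - 1 < γ - j * p.toReal := by nlinarith
    have h1 := hardy_inequality hP hσ (Lp.stronglyMeasurable (F.1 α))
      (Lp.stronglyMeasurable (F.1 (α.succFst (by omega)))) (locallyIntegrableOn_weightedLp _)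
      (locallyIntegrableOn_weightedLp _) (integral_smul_succFst F α (by omega))
      (ne_top_of_le_ne_top (ENNReal.mul_ne_top (hardyProd_ne_top hP _ _) (rpow_enorm_ne_top hp F))
        (ih α (by omega)))
    have h2 := ih (α.succFst (by omega)) (by rw [MultiIndex.sum_succFst]; omega)
    have h3 : γ - ((j + 1 : ℕ) : ℝ) * p.toReal = γ - j * p.toReal - p.toReal := by
      push_cast; ring
    rw [h3]
    refine h1.trans ((mul_le_mul_right h2 _).trans_eq ?_)
    rw [hardyProd, hardyProd, Finset.prod_range_succ, ← mul_assoc, mul_comm (hardyConst _ _)]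

/-- The pairs `(α, j)` with `|α| + j ≤ k`. -/
def hardyIndex (d k : ℕ) : Finset (MultiIndex d k × ℕ) :=
  {q ∈ Finset.univ ×ˢ Finset.range (k + 1) | ∑ i, q.1.1 i + q.2 ≤ k}

/-- The function `∑ |x₁| ^ (-j) ‖∂^α f‖` where `(α, j)` runs over `|α| + j ≤ k`. -/
def hardySum (F : weightedSobolev d X k p γ) (x : EuclideanSpace ℝ (Fin d)) : ℝ≥0∞ :=
  ∑ q ∈ hardyIndex d k, weight (-(q.2 : ℝ)) x * ‖F.1 q.1 x‖ₑ

theorem measurable_hardySum (F : weightedSobolev d X k p γ) : Measurable (hardySum F) :=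
  Finset.measurable_sum _ fun q _ =>
    (measurable_weight _).mul (Lp.stronglyMeasurable (F.1 q.1)).enorm

/-- The constant in `lintegral_hardySum_rpow_le`. -/
def hardySumConst (d k : ℕ) (P γ : ℝ) : ℝ≥0∞ :=
  ((hardyIndex d k).card : ℝ≥0∞) ^ (P - 1) * ∑ q ∈ hardyIndex d k, hardyProd P γ q.2

theorem hardySumConst_ne_top {P : ℝ} (hP : 1 ≤ P) (γ : ℝ) : hardySumConst d k P γ ≠ ∞ :=
  ENNReal.mul_ne_top (ENNReal.rpow_ne_top_of_nonneg (by linarith) (by simp))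
    (ENNReal.sum_ne_top.2 fun _ _ => hardyProd_ne_top hP _ _)

theorem weight_rpow (s : ℝ) {P : ℝ} (hP : 0 ≤ P) (x : EuclideanSpace ℝ (Fin d)) :
    weight s x ^ P = weight (s * P) x := by
  rw [weight, ENNReal.ofReal_rpow_of_nonneg (by positivity) hP, ← Real.rpow_mul (abs_nonneg _)]
  rfl

/-- The power mean inequality separates the finitely many terms; each factor |x₁|^(-jp) goes into
the weight, and `hardy_iterate` applies. `hardySum` majorises every term of the Leibniz rule for a
dyadic piece. -/
theorem lintegral_hardySum_rpow_le [CompleteSpace X] (hp : p ≠ ∞) (hk : k * p.toReal - 1 < γ)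
    (F : weightedSobolev d X k p γ) :
    ∫⁻ x, hardySum F x ^ p.toReal ∂(powerMeasure d γ) ≤
      hardySumConst d k p.toReal γ * ‖F‖ₑ ^ p.toReal := by
  have hP := one_le_toReal hp
  have hP0 : 0 ≤ p.toReal := by linarith
  have hm (q : MultiIndex d k × ℕ) : Measurable fun x =>
      (weight (-(q.2 : ℝ)) x * ‖F.1 q.1 x‖ₑ) ^ p.toReal :=
    ((measurable_weight _).mul (Lp.stronglyMeasurable (F.1 q.1)).enorm).pow_const _
  calc ∫⁻ x, hardySum F x ^ p.toReal ∂(powerMeasure d γ)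
      ≤ ∫⁻ x, ((hardyIndex d k).card : ℝ≥0∞) ^ (p.toReal - 1) * ∑ q ∈ hardyIndex d k,
          (weight (-(q.2 : ℝ)) x * ‖F.1 q.1 x‖ₑ) ^ p.toReal ∂(powerMeasure d γ) :=
        lintegral_mono fun x => ENNReal.rpow_sum_le_const_mul_sum_rpow _ _ hP
    _ = ((hardyIndex d k).card : ℝ≥0∞) ^ (p.toReal - 1) * ∑ q ∈ hardyIndex d k,
          ∫⁻ x, (weight (-(q.2 : ℝ)) x * ‖F.1 q.1 x‖ₑ) ^ p.toReal ∂(powerMeasure d γ) := by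
        rw [lintegral_const_mul _ (Finset.measurable_fun_sum _ fun q _ => hm q),
          lintegral_finsetSum _ fun q _ => hm q]
    _ ≤ ((hardyIndex d k).card : ℝ≥0∞) ^ (p.toReal - 1) * ∑ q ∈ hardyIndex d k,
          hardyProd p.toReal γ q.2 * ‖F‖ₑ ^ p.toReal := by
        gcongr with q hq
        refine le_trans (le_of_eq ?_) (hardy_iterate hp hk F q.2 q.1 (Finset.mem_filter.1 hq).2)
        rw [lintegral_powerMeasure _ (hm q),
          lintegral_powerMeasure _ ((Lp.stronglyMeasurable (F.1 q.1)).enorm.pow_const _)]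
        refine setLIntegral_congr_fun (halfSpace d).isOpen.measurableSet fun x hx => ?_
        simp only
        rw [ENNReal.mul_rpow_of_nonneg _ _ hP0, weight_rpow _ hP0, ← mul_assoc, ← weight_add hx]
        ring_nf
    _ = _ := by rw [← Finset.sum_mul, ← mul_assoc, hardySumConst]

end SobolevHardy
end

/-! ### The dyadic partition of unity -/

noncomputable section

section DyadicPartition

/-- A smooth function which is `1` on `(-∞, 1]` and `0` on `[2, ∞)`. -/
def smoothCutoff (r : ℝ) : ℝ := 1 - Real.smoothTransition (r - 1)

theorem contDiff_smoothCutoff : ContDiff ℝ (⊤ : ℕ∞) smoothCutoff :=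
  contDiff_const.sub (Real.smoothTransition.contDiff.comp (contDiff_id.sub contDiff_const))

theorem smoothCutoff_of_le {r : ℝ} (h : r ≤ 1) : smoothCutoff r = 1 := by
  rw [smoothCutoff, Real.smoothTransition.zero_of_nonpos (by linarith), sub_zero]

theorem smoothCutoff_of_ge {r : ℝ} (h : 2 ≤ r) : smoothCutoff r = 0 := by
  rw [smoothCutoff, Real.smoothTransition.one_of_one_le (by linarith), sub_self]

/-- A smooth bump function supported in `[1/2, 2]`. -/
def dyadicBump (r : ℝ) : ℝ := smoothCutoff r - smoothCutoff (2 * r)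

theorem contDiff_dyadicBump : ContDiff ℝ (⊤ : ℕ∞) dyadicBump :=
  contDiff_smoothCutoff.sub (contDiff_smoothCutoff.comp (contDiff_const.mul contDiff_id))

theorem tsupport_iteratedDeriv_subset (f : ℝ → ℝ) (j : ℕ) :
    tsupport (iteratedDeriv j f) ⊆ tsupport f := by
  induction j with
  | zero => simp
  | succ j ih =>
    rw [iteratedDeriv_succ]
    exact (closure_minimal support_deriv_subset (isClosed_tsupport _)).trans ih

theorem iteratedDeriv_dyadicBump_eq_zero (j : ℕ) {r : ℝ} (hr : r ∉ Icc (1 / 2 : ℝ) 2) :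
    iteratedDeriv j dyadicBump r = 0 := by
  refine image_eq_zero_of_notMem_tsupport fun h => hr ?_
  refine closure_minimal (fun s hs => ?_) isClosed_Icc (tsupport_iteratedDeriv_subset _ j h)
  by_contra hs'
  refine hs ?_
  rw [dyadicBump]
  rcases lt_or_ge s (1 / 2) with h1 | h1
  · rw [smoothCutoff_of_le (by linarith), smoothCutoff_of_le (by linarith), sub_self]
  · have h2 : 2 < s := by
      by_contra h2
      exact hs' ⟨h1, not_lt.1 h2⟩
    rw [smoothCutoff_of_ge h2.le, smoothCutoff_of_ge (by linarith), sub_self]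

theorem exists_bound_iteratedDeriv_dyadicBump (k : ℕ) :
    ∃ K : ℝ, 0 ≤ K ∧ ∀ j ≤ k, ∀ r, |iteratedDeriv j dyadicBump r| ≤ K := by
  have h (j : ℕ) : ∃ K : ℝ, ∀ r, |iteratedDeriv j dyadicBump r| ≤ K := by
    have hc : HasCompactSupport (iteratedDeriv j dyadicBump) :=
      HasCompactSupport.intro isCompact_Icc fun r hr => iteratedDeriv_dyadicBump_eq_zero j hr
    exact hc.exists_bound_of_continuous (contDiff_iteratedDeriv contDiff_dyadicBump j).continuous
  choose K hK using h
  refine ⟨∑ j ∈ Finset.range (k + 1), |K j|, by positivity, fun j hj r => (hK j r).trans ?_⟩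
  exact (le_abs_self _).trans (Finset.single_le_sum (f := fun j => |K j|)
    (fun _ _ => abs_nonneg _) (Finset.mem_range.2 (by omega)))

/-- A bound for the derivatives of `dyadicBump` up to order `k`. -/
def bumpBound (k : ℕ) : ℝ := (exists_bound_iteratedDeriv_dyadicBump k).choose

theorem bumpBound_nonneg (k : ℕ) : 0 ≤ bumpBound k :=
  (exists_bound_iteratedDeriv_dyadicBump k).choose_spec.1

theorem abs_iteratedDeriv_dyadicBump_le {j k : ℕ} (hj : j ≤ k) (r : ℝ) :
    |iteratedDeriv j dyadicBump r| ≤ bumpBound k :=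
  (exists_bound_iteratedDeriv_dyadicBump k).choose_spec.2 j hj r

/-- The dyadic partition of unity on `(0, ∞)`. -/
def dyadicPart (n : ℤ) (r : ℝ) : ℝ := dyadicBump (2 ^ (-n) * r)

theorem contDiff_dyadicPart (n : ℤ) : ContDiff ℝ (⊤ : ℕ∞) (dyadicPart n) :=
  contDiff_dyadicBump.comp (contDiff_const.mul contDiff_id)

theorem iteratedDeriv_dyadicPart (n : ℤ) (j : ℕ) (r : ℝ) : iteratedDeriv j (dyadicPart n) r =
    (2 ^ (-n)) ^ j * iteratedDeriv j dyadicBump (2 ^ (-n) * r) :=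
  congrFun (iteratedDeriv_comp_const_mul (contDiff_dyadicBump.of_le (by
    exact_mod_cast le_top)) _) r

theorem iteratedDeriv_dyadicPart_eq_zero {n : ℤ} (j : ℕ) {r : ℝ}
    (hr : r ∉ Icc ((2 : ℝ) ^ (n - 1)) (2 ^ (n + 1))) : iteratedDeriv j (dyadicPart n) r = 0 := by
  rw [iteratedDeriv_dyadicPart, iteratedDeriv_dyadicBump_eq_zero, mul_zero]
  refine fun h => hr ?_
  have h2 : (0 : ℝ) < 2 ^ n := by positivity
  rw [zpow_neg, mem_Icc, ← div_eq_inv_mul, div_le_iff₀ h2, le_div_iff₀ h2] at h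
  rw [zpow_sub_one₀ two_ne_zero, zpow_add_one₀ two_ne_zero]
  constructor <;> linarith [h.1, h.2]

/-- Every derivative brings out a factor 2^(-n), which on the support is at most 2/r. These negative
powers of the distance to the boundary are what Hardy's inequality has to control. -/
theorem abs_iteratedDeriv_dyadicPart_le {j k : ℕ} (hj : j ≤ k) (n : ℤ) {r : ℝ} (hr0 : 0 < r)
    (hr : r ∈ Icc ((2 : ℝ) ^ (n - 1)) (2 ^ (n + 1))) :
    |iteratedDeriv j (dyadicPart n) r| ≤ 2 ^ k * bumpBound k * r ^ (-(j : ℝ)) := by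
  have h2 : (2 : ℝ) ^ (-n) * r ≤ 2 := by
    calc (2 : ℝ) ^ (-n) * r ≤ 2 ^ (-n) * 2 ^ (n + 1) := by gcongr; exact hr.2
      _ = 2 := by rw [← zpow_add₀ two_ne_zero]; simp
  have h3 : ((2 : ℝ) ^ (-n)) ^ j ≤ 2 ^ k * r ^ (-(j : ℝ)) := by
    rw [Real.rpow_neg hr0.le, Real.rpow_natCast, ← div_eq_mul_inv, le_div_iff₀ (by positivity),
      ← mul_pow]
    calc ((2 : ℝ) ^ (-n) * r) ^ j ≤ 2 ^ j := by gcongr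
      _ ≤ 2 ^ k := pow_le_pow_right₀ one_le_two hj
  rw [iteratedDeriv_dyadicPart, abs_mul, abs_of_pos (by positivity)]
  calc ((2 : ℝ) ^ (-n)) ^ j * |iteratedDeriv j dyadicBump (2 ^ (-n) * r)|
      ≤ (2 ^ k * r ^ (-(j : ℝ))) * bumpBound k := by
        gcongr
        exact abs_iteratedDeriv_dyadicBump_le hj _
    _ = _ := by ring

/-- The bump is a difference of two consecutive rescaled cutoffs, so the sum telescopes. -/
theorem sum_dyadicPart (a : ℤ) (m : ℕ) (r : ℝ) :
    ∑ i ∈ Finset.range m, dyadicPart (a + i) r =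
      smoothCutoff (2 ^ (-(a + m - 1)) * r) - smoothCutoff (2 ^ (-(a - 1)) * r) := by
  have h := Finset.sum_range_sub (fun i : ℕ => smoothCutoff (2 ^ (-(a + i - 1)) * r)) m
  simp only [Nat.cast_zero, add_zero] at h
  rw [← h]
  refine Finset.sum_congr rfl fun i _ => ?_
  rw [dyadicPart, dyadicBump]
  congr 2
  · push_cast; ring_nf
  · rw [← mul_assoc, ← zpow_one_add₀ two_ne_zero]; ring_nf

/-- On a compact interval, finitely many terms of the dyadic partition of unity sum up to `1`. -/
theorem exists_finset_sum_dyadicPart_eq_one {a b : ℝ} (ha : 0 < a) :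
    ∃ s : Finset ℤ, ∀ r ∈ Icc a b, ∑ n ∈ s, dyadicPart n r = 1 ∧
      ∀ n ∉ s, dyadicPart n r = 0 := by
  obtain ⟨N₁, hN₁⟩ := pow_unbounded_of_one_lt (2 / a) one_lt_two
  obtain ⟨N₂, hN₂⟩ := pow_unbounded_of_one_lt b one_lt_two
  have hinj : Function.Injective fun i : ℕ => (-(N₁ : ℤ)) + i := fun i j h => by simpa using h
  -- The indices run from -N₁ to N₂: the first bound kills the lower cutoff on [a, b], the second
  -- makes the upper cutoff equal to 1.
  refine ⟨(Finset.range (N₁ + N₂ + 1)).image fun i : ℕ => (-(N₁ : ℤ)) + i, fun r hr => ?_⟩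
  have hr0 : 0 < r := ha.trans_le hr.1
  have h1 : 2 ≤ (2 : ℝ) ^ N₁ * r := by
    rw [div_lt_iff₀ ha] at hN₁
    exact hN₁.le.trans (by gcongr; exact hr.1)
  have h2 : r ≤ 2 ^ N₂ := hr.2.trans hN₂.le
  constructor
  · rw [Finset.sum_image fun i _ j _ h => hinj h, sum_dyadicPart, smoothCutoff_of_le,
      smoothCutoff_of_ge, sub_zero]
    · have : (-(-(N₁ : ℤ) - 1)) = (N₁ + 1 : ℕ) := by push_cast; ring
      rw [this, zpow_natCast, pow_succ]
      nlinarith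
    · have : (-(-(N₁ : ℤ) + (N₁ + N₂ + 1 : ℕ) - 1)) = -(N₂ : ℕ) := by push_cast; ring
      rw [this, zpow_neg, zpow_natCast, ← div_eq_inv_mul]
      exact div_le_one_of_le₀ h2 (by positivity)
  · intro n hn
    have := iteratedDeriv_dyadicPart_eq_zero (n := n) 0 (r := r) fun hmem => hn ?_
    · simpa using this
    · rw [Finset.mem_image]
      have hb1 : -(N₁ : ℤ) < n + 1 := by
        rw [← zpow_lt_zpow_iff_right₀ (one_lt_two (α := ℝ))]
        refine lt_of_lt_of_le ?_ hmem.2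
        rw [zpow_neg, zpow_natCast, inv_lt_iff_one_lt_mul₀ (by positivity)]
        linarith
      have hb2' : n - 1 < (N₂ : ℤ) := by
        rw [← zpow_lt_zpow_iff_right₀ (one_lt_two (α := ℝ)), zpow_natCast]
        exact hmem.1.trans_lt (hr.2.trans_lt hN₂)
      refine ⟨(n + N₁).toNat, Finset.mem_range.2 (by omega), by omega⟩

/-- Every point lies in at most three of the intervals `[2 ^ (n - 1), 2 ^ (n + 1)]`. -/
theorem card_filter_dyadic_le (s : Finset ℤ) {r : ℝ} (hr : 0 < r) :
    (s.filter fun n : ℤ => r ∈ Icc ((2 : ℝ) ^ (n - 1)) (2 ^ (n + 1))).card ≤ 3 := by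
  have h1 := Int.zpow_log_le_self (b := 2) (r := r) one_lt_two hr
  have h2 := Int.lt_zpow_succ_log_self (b := 2) one_lt_two r
  push_cast at h1 h2
  -- The index is within one of the binary logarithm; three indices do occur when r is a power of 2,
  -- as the intervals are closed.
  refine (Finset.card_le_card (t := Finset.Icc (Int.log 2 r - 1) (Int.log 2 r + 1))
    fun n hn => ?_).trans (by simp; omega)
  rw [Finset.mem_filter] at hn
  have h3 : Int.log 2 r ≤ n + 1 := by
    rw [← zpow_le_zpow_iff_right₀ (one_lt_two (α := ℝ))]
    exact h1.trans hn.2.2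
  have h4 : n - 1 < Int.log 2 r + 1 := by
    rw [← zpow_lt_zpow_iff_right₀ (one_lt_two (α := ℝ))]
    exact hn.2.1.trans_lt h2
  rw [Finset.mem_Icc]
  omega

end DyadicPartition
end

/-! ### Powers on dyadic intervals -/

noncomputable section

section DyadicRpow

theorem rpow_le_two_rpow_abs {u : ℝ} (hu : u ∈ Icc (1 / 2 : ℝ) 2) (δ : ℝ) : u ^ δ ≤ 2 ^ |δ| := by
  have hu0 : 0 < u := lt_of_lt_of_le (by norm_num) hu.1
  rcases le_total 0 δ with h | h
  · rw [abs_of_nonneg h]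
    exact Real.rpow_le_rpow hu0.le hu.2 h
  · rw [abs_of_nonpos h]
    calc u ^ δ ≤ (1 / 2) ^ δ := Real.rpow_le_rpow_of_nonpos (by norm_num) hu.1 h
      _ = 2 ^ (-δ) := by rw [one_div, Real.inv_rpow two_pos.le, Real.rpow_neg two_pos.le]

theorem div_mem_Icc_of_dyadic {n : ℤ} {r : ℝ} (hr : r ∈ Icc ((2 : ℝ) ^ (n - 1)) (2 ^ (n + 1))) :
    r / 2 ^ n ∈ Icc (1 / 2 : ℝ) 2 := by
  have h2 : (0 : ℝ) < 2 ^ n := by positivity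
  rw [zpow_sub_one₀ two_ne_zero, zpow_add_one₀ two_ne_zero] at hr
  rw [mem_Icc, div_le_iff₀ h2, le_div_iff₀ h2]
  constructor <;> linarith [hr.1, hr.2]

theorem inv_mem_Icc {u : ℝ} (hu : u ∈ Icc (1 / 2 : ℝ) 2) : u⁻¹ ∈ Icc (1 / 2 : ℝ) 2 := by
  have hu0 : 0 < u := lt_of_lt_of_le (by norm_num) hu.1
  refine ⟨?_, ?_⟩
  · rw [one_div]; exact inv_anti₀ hu0 hu.2
  · rw [inv_le_comm₀ hu0 two_pos]; simpa using hu.1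

theorem rpow_le_of_dyadic {n : ℤ} {r : ℝ} (hr : r ∈ Icc ((2 : ℝ) ^ (n - 1)) (2 ^ (n + 1)))
    (δ : ℝ) : r ^ δ ≤ 2 ^ |δ| * ((2 : ℝ) ^ n) ^ δ := by
  have h2 : (0 : ℝ) < 2 ^ n := by positivity
  have h := rpow_le_two_rpow_abs (div_mem_Icc_of_dyadic hr) δ
  have hr0 : 0 < r := lt_of_lt_of_le (by positivity) hr.1
  rwa [Real.div_rpow hr0.le h2.le, div_le_iff₀ (by positivity)] at h

theorem rpow_ge_of_dyadic {n : ℤ} {r : ℝ} (hr : r ∈ Icc ((2 : ℝ) ^ (n - 1)) (2 ^ (n + 1)))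
    (δ : ℝ) : ((2 : ℝ) ^ n) ^ δ ≤ 2 ^ |δ| * r ^ δ := by
  have h2 : (0 : ℝ) < 2 ^ n := by positivity
  have h := rpow_le_two_rpow_abs (inv_mem_Icc (div_mem_Icc_of_dyadic hr)) δ
  have hr0 : 0 < r := lt_of_lt_of_le (by positivity) hr.1
  rwa [inv_div, Real.div_rpow h2.le hr0.le, div_le_iff₀ (by positivity)] at h

end DyadicRpow

theorem PiLp.enorm_rpow_eq_sum {p : ℝ≥0∞} (hp : 0 < p.toReal) {ι : Type*} [Fintype ι]
    {E : ι → Type*} [Fact (1 ≤ p)] [∀ i, SeminormedAddCommGroup (E i)] (x : PiLp p E) :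
    ‖x‖ₑ ^ p.toReal = ∑ i, ‖x i‖ₑ ^ p.toReal := by
  simp only [← ofReal_norm, ENNReal.ofReal_rpow_of_nonneg (norm_nonneg _) hp.le]
  rw [← ENNReal.ofReal_sum_of_nonneg fun i _ => by positivity, PiLp.norm_eq_sum hp,
    ← Real.rpow_mul (Finset.sum_nonneg fun i _ => by positivity), one_div_mul_cancel hp.ne',
    Real.rpow_one]

/-! ### Localising Sobolev functions to dyadic slabs -/

section Cutoff

variable {d : ℕ} [NeZero d] {X : Type*} [NormedAddCommGroup X] [NormedSpace ℂ X]
  {p : ℝ≥0∞} [Fact (1 ≤ p)] {k : ℕ} {γ : ℝ}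

/-- The dyadic slab `2 ^ (n - 1) ≤ x₁ ≤ 2 ^ (n + 1)`. -/
def slab (d : ℕ) [NeZero d] (n : ℤ) : Set (EuclideanSpace ℝ (Fin d)) :=
  {x | x 0 ∈ Icc ((2 : ℝ) ^ (n - 1)) (2 ^ (n + 1))}

theorem measurableSet_slab (n : ℤ) : MeasurableSet (slab d n) :=
  measurableSet_Icc.preimage (by fun_prop : Measurable fun x : EuclideanSpace ℝ (Fin d) => x 0)

theorem slab_subset (n : ℤ) : slab d n ⊆ halfSpace d := fun _ hx =>
  lt_of_lt_of_le (show (0 : ℝ) < 2 ^ (n - 1) by positivity) hx.1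

/-- On the slab x₁ is within a factor 2 of 2ⁿ, so all power weights are comparable. A function
localised there belongs to every weighted space, with an explicit dependence on n. -/
theorem restrict_slab_powerMeasure_le (n : ℤ) (γ γ' : ℝ) :
    (powerMeasure d γ').restrict (slab d n) ≤
      ENNReal.ofReal (2 ^ |γ' - γ| * ((2 : ℝ) ^ n) ^ (γ' - γ)) • powerMeasure d γ := by
  refine Measure.le_iff.2 fun s hs => ?_
  have hm := hs.inter (measurableSet_slab (d := d) n)
  have hsub : s ∩ slab d n ⊆ halfSpace d := inter_subset_right.trans (slab_subset n)
  rw [Measure.restrict_apply hs, Measure.smul_apply, smul_eq_mul]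
  refine le_trans ?_ (mul_le_mul_right (measure_mono (inter_subset_left (t := slab d n))) _)
  rw [← setLIntegral_one, ← setLIntegral_one, setLIntegral_powerMeasure _ hm hsub measurable_const,
    setLIntegral_powerMeasure _ hm hsub measurable_const,
    ← lintegral_const_mul' _ _ ENNReal.ofReal_ne_top]
  refine setLIntegral_mono' hm fun x hx => ?_
  have hx0 : 0 < x 0 := slab_subset n hx.2
  have h1 := weight_add (s := γ' - γ) (t := γ) (slab_subset n hx.2)
  rw [sub_add_cancel] at h1
  rw [mul_one, mul_one, h1]
  gcongr
  rw [weight, abs_of_pos hx0]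
  exact ENNReal.ofReal_le_ofReal (rpow_le_of_dyadic hx.2 _)

theorem memLp_powerMeasure_of_slab {n : ℤ} {g : EuclideanSpace ℝ (Fin d) → X}
    (hg : MemLp g p (powerMeasure d γ)) (h : ∀ x ∉ slab d n, g x = 0) (γ' : ℝ) :
    MemLp g p (powerMeasure d γ') := by
  have h1 := hg.of_measure_le_smul ENNReal.ofReal_ne_top (restrict_slab_powerMeasure_le n γ γ')
  rw [← memLp_indicator_iff_restrict (measurableSet_slab n)] at h1
  rwa [indicator_eq_self.2 fun x hx => by_contra fun hx' => hx (h x hx')] at h1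

theorem memLp_dyadicPart_smul (n : ℤ) (i : ℕ) (f : WeightedLp d X p γ) (γ' : ℝ) :
    MemLp (fun x => iteratedDeriv i (dyadicPart n) (x 0) • f x) p (powerMeasure d γ') := by
  refine memLp_powerMeasure_of_slab (n := n) (γ := γ) ?_ (fun x hx => ?_) γ'
  · refine (Lp.memLp f).of_le_mul (c := (2 ^ (-n)) ^ i * bumpBound i) ?_ (ae_of_all _ fun x => ?_)
    · have hc : Continuous fun x : EuclideanSpace ℝ (Fin d) =>
          iteratedDeriv i (dyadicPart n) (x 0) :=
        (contDiff_iteratedDeriv (contDiff_dyadicPart n) i).continuous.comp (by fun_prop)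
      exact hc.aestronglyMeasurable.smul (Lp.aestronglyMeasurable f)
    · rw [norm_smul]
      gcongr
      rw [iteratedDeriv_dyadicPart, norm_mul, Real.norm_of_nonneg (by positivity)]
      gcongr
      exact abs_iteratedDeriv_dyadicBump_le le_rfl _
  · rw [iteratedDeriv_dyadicPart_eq_zero i hx, zero_smul]

/-- The product of a derivative of `dyadicPart n` with `f`, as an element of a Lebesgue space with
an arbitrary power weight. -/
def partTerm (n : ℤ) (i : ℕ) (f : WeightedLp d X p γ) (γ' : ℝ) : WeightedLp d X p γ' :=
  (memLp_dyadicPart_smul n i f γ').toLp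

theorem coeFn_partTerm (n : ℤ) (i : ℕ) (f : WeightedLp d X p γ) (γ' : ℝ) :
    partTerm n i f γ' =ᵐ[powerMeasure d γ'] fun x => iteratedDeriv i (dyadicPart n) (x 0) • f x :=
  MemLp.coeFn_toLp _

theorem lpToDistribution_partTerm (n : ℤ) (i : ℕ) (f : WeightedLp d X p γ) (γ' : ℝ) :
    lpToDistribution d X p γ' (partTerm n i f γ') =
      mulDist (contDiff_iteratedDeriv (contDiff_dyadicPart n) i) (lpToDistribution d X p γ f) := by
  ext φ
  rw [mulDist_apply, lpToDistribution_apply, lpToDistribution_apply]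
  refine integral_congr_ae ?_
  filter_upwards [ae_volume_of_ae (coeFn_partTerm n i f γ') φ] with x hx
  rw [mulTest_apply]
  rcases hx with hx | hx
  · simp [hx]
  · rw [hx, smul_smul]

/-- The derivative of order `α` of the product of `dyadicPart n` with `F`. -/
def partDeriv (n : ℤ) (F : weightedSobolev d X k p γ) (γ' : ℝ) (α : MultiIndex d k) :
    WeightedLp d X p γ' :=
  ∑ ij ∈ Finset.HasAntidiagonal.antidiagonal (α.1 0),
    (α.1 0).choose ij.1 • partTerm n ij.1 (F.1 (α.setFst ij.2)) γ'

theorem lpToDistribution_partDeriv (n : ℤ) (F : weightedSobolev d X k p γ) (γ' : ℝ)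
    (α : MultiIndex d k) : lpToDistribution d X p γ' (partDeriv n F γ' α) =
      distribDeriv α.1 (mulDist (contDiff_dyadicPart n) (lpToDistribution d X p γ (F.1 0))) := by
  rw [distribDeriv_mulDist, partDeriv, map_sum]
  refine Finset.sum_congr rfl fun ij hij => ?_
  rw [map_nsmul, lpToDistribution_partTerm, F.2 (α.setFst ij.2)]
  have h : ij.2 ≤ α.1 0 := by
    have := Finset.HasAntidiagonal.mem_antidiagonal.1 hij
    omega
  change _ • mulDist _ (distribDeriv (Function.update α.1 0 (min ij.2 (α.1 0))) _) = _
  -- The truncation in `MultiIndex.setFst` is inactive for the orders occurring in the Leibniz rule.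
  rw [min_eq_left h]

theorem distribDeriv_zero (T : 𝓓'(halfSpace d, X)) :
    distribDeriv (0 : MultiIndex d k).1 T = T := by
  change (List.finRange d).foldr (fun _ S => S) T = T
  induction List.finRange d with
  | nil => rfl
  | cons i l ih => exact ih

/-- The product of `dyadicPart n` with `F` in a Sobolev space with an arbitrary power weight. -/
def partSobolev (n : ℤ) (F : weightedSobolev d X k p γ) (γ' : ℝ) : weightedSobolev d X k p γ' :=
  ⟨WithLp.toLp p (partDeriv n F γ'), fun α => by
    change lpToDistribution d X p γ' (partDeriv n F γ' α) =
      distribDeriv α.1 (lpToDistribution d X p γ' (partDeriv n F γ' 0))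
    rw [lpToDistribution_partDeriv, lpToDistribution_partDeriv, distribDeriv_zero]⟩

theorem sobolevToDistribution_partSobolev (n : ℤ) (F : weightedSobolev d X k p γ) (γ' : ℝ) :
    sobolevToDistribution d X k p γ' (partSobolev n F γ') =
      mulDist (contDiff_dyadicPart n) (sobolevToDistribution d X k p γ F) := by
  change lpToDistribution d X p γ' (partDeriv n F γ' 0) =
    mulDist _ (lpToDistribution d X p γ (F.1 0))
  rw [lpToDistribution_partDeriv, distribDeriv_zero]

/-- On the compact support of `φ` the first coordinate ranges over some [a, b] with a > 0, so the
sum is finite and the partition adds up to 1 there. -/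
theorem sum_mulDist_dyadicPart (T : 𝓓'(halfSpace d, X)) (φ : 𝓓(halfSpace d, ℝ)) :
    HasSum (fun n : ℤ => mulDist (contDiff_dyadicPart n) T φ) (T φ) := by
  obtain ⟨a, b, ha, hab⟩ : ∃ a b : ℝ, 0 < a ∧ ∀ x ∈ tsupport φ, x 0 ∈ Icc a b := by
    have hc : IsCompact ((fun x : EuclideanSpace ℝ (Fin d) => x 0) '' tsupport φ) :=
      φ.hasCompactSupport.isCompact.image (by fun_prop)
    rcases (tsupport φ).eq_empty_or_nonempty with he | hne
    · exact ⟨1, 1, one_pos, by simp [he]⟩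
    · obtain ⟨x, hx, hxe⟩ := hc.sInf_mem (hne.image _)
      refine ⟨_, _, ?_, fun y hy => ⟨csInf_le hc.bddBelow (mem_image_of_mem _ hy),
        le_csSup hc.bddAbove (mem_image_of_mem _ hy)⟩⟩
      rw [← hxe]
      exact φ.tsupport_subset hx
  obtain ⟨s, hs⟩ := exists_finset_sum_dyadicPart_eq_one (b := b) ha
  have h0 : ∀ n ∉ s, mulDist (contDiff_dyadicPart n) T φ = 0 := by
    intro n hn
    rw [mulDist_apply]
    have : mulTest (contDiff_dyadicPart n) φ = 0 := by
      ext x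
      rw [mulTest_apply]
      change _ = (0 : ℝ)
      by_cases hx : x ∈ tsupport φ
      · rw [(hs _ (hab x hx)).2 n hn, mul_zero]
      · rw [image_eq_zero_of_notMem_tsupport hx, zero_mul]
    rw [this, map_zero]
  have h1 : T φ = ∑ n ∈ s, mulDist (contDiff_dyadicPart n) T φ := by
    simp only [mulDist_apply]
    rw [← map_sum]
    congr 1
    ext x
    have h2 : (∑ n ∈ s, mulTest (contDiff_dyadicPart n) φ) x =
        ∑ n ∈ s, mulTest (contDiff_dyadicPart n) φ x :=
      map_sum (⟨⟨fun f : 𝓓(halfSpace d, ℝ) => f x, rfl⟩, fun _ _ => rfl⟩ :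
        𝓓(halfSpace d, ℝ) →+ ℝ) _ _
    rw [h2]
    simp only [mulTest_apply]
    rw [← Finset.mul_sum]
    by_cases hx : x ∈ tsupport φ
    · rw [(hs _ (hab x hx)).1, mul_one]
    · rw [image_eq_zero_of_notMem_tsupport hx, zero_mul]
  rw [h1]
  exact hasSum_sum_of_ne_finset_zero h0

/-- In the Leibniz rule i derivatives on the bump cost |x₁|^(-i) and leave a derivative of order |α|
- i on F, a pair counted in `hardySum`. The constant 4^k is 2^k from the binomial coefficients times
2^k from the bump. -/
theorem enorm_partDeriv_le (n : ℤ) (F : weightedSobolev d X k p γ) (γ' : ℝ) (α : MultiIndex d k) :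
    ∀ᵐ x ∂(powerMeasure d γ'), ‖partDeriv n F γ' α x‖ₑ ≤
      (slab d n).indicator (fun x => ENNReal.ofReal (4 ^ k * bumpBound k) * hardySum F x) x := by
  have hB := bumpBound_nonneg k
  have h1 := Lp.coeFn_fun_finsetSum (Finset.HasAntidiagonal.antidiagonal (α.1 0))
    fun ij => (α.1 0).choose ij.1 • partTerm n ij.1 (F.1 (α.setFst ij.2)) γ'
  have h2 : ∀ᵐ x ∂(powerMeasure d γ'), ∀ ij ∈ Finset.HasAntidiagonal.antidiagonal (α.1 0),
      ((α.1 0).choose ij.1 • partTerm n ij.1 (F.1 (α.setFst ij.2)) γ' : WeightedLp d X p γ') x =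
        (α.1 0).choose ij.1 • iteratedDeriv ij.1 (dyadicPart n) (x 0) • F.1 (α.setFst ij.2) x := by
    refine (Finset.eventually_all _).2 fun ij _ => ?_
    rw [← Nat.cast_smul_eq_nsmul ℂ]
    filter_upwards [coeFn_partTerm n ij.1 (F.1 (α.setFst ij.2)) γ',
      Lp.coeFn_smul (((α.1 0).choose ij.1 : ℕ) : ℂ)
        (partTerm n ij.1 (F.1 (α.setFst ij.2)) γ')] with x hx hx2
    rw [hx2, Pi.smul_apply, hx, Nat.cast_smul_eq_nsmul]
  filter_upwards [h1, h2] with x hx hx2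
  rw [partDeriv, hx, Finset.sum_congr rfl hx2]
  by_cases hxn : x ∈ slab d n
  · rw [indicator_of_mem hxn]
    have hx0 : 0 < x 0 := slab_subset n hxn
    have hα : α.1 0 ≤ k :=
      (Finset.single_le_sum (fun _ _ => Nat.zero_le _) (Finset.mem_univ (0 : Fin d))).trans α.2
    calc ‖∑ ij ∈ Finset.HasAntidiagonal.antidiagonal (α.1 0), (α.1 0).choose ij.1 •
          iteratedDeriv ij.1 (dyadicPart n) (x 0) • F.1 (α.setFst ij.2) x‖ₑ
        ≤ ∑ ij ∈ Finset.HasAntidiagonal.antidiagonal (α.1 0), ((α.1 0).choose ij.1 : ℝ≥0∞) *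
          (ENNReal.ofReal (2 ^ k * bumpBound k) * hardySum F x) := by
          refine (enorm_sum_le _ _).trans (Finset.sum_le_sum fun ij hij => ?_)
          have hij' := Finset.HasAntidiagonal.mem_antidiagonal.1 hij
          rw [← Nat.cast_smul_eq_nsmul ℝ, enorm_smul, enorm_smul, Real.enorm_natCast]
          refine mul_le_mul_right ?_ _
          calc ‖iteratedDeriv ij.1 (dyadicPart n) (x 0)‖ₑ * ‖F.1 (α.setFst ij.2) x‖ₑ
              ≤ (ENNReal.ofReal (2 ^ k * bumpBound k) * weight (-(ij.1 : ℝ)) x) *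
                ‖F.1 (α.setFst ij.2) x‖ₑ := by
                gcongr
                rw [weight, ← ENNReal.ofReal_mul (by positivity), Real.enorm_eq_ofReal_abs,
                  abs_of_pos hx0]
                exact ENNReal.ofReal_le_ofReal
                  (abs_iteratedDeriv_dyadicPart_le (by omega) n hx0 hxn)
            _ = ENNReal.ofReal (2 ^ k * bumpBound k) * (weight (-(ij.1 : ℝ)) x *
                ‖F.1 (α.setFst ij.2) x‖ₑ) := mul_assoc _ _ _
            _ ≤ _ := by
                refine mul_le_mul_right ?_ _
                refine Finset.single_le_sum (f := fun q : MultiIndex d k × ℕ =>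
                  weight (-(q.2 : ℝ)) x * ‖F.1 q.1 x‖ₑ) (fun _ _ => zero_le)
                  (a := (α.setFst ij.2, ij.1)) ?_
                rw [hardyIndex, Finset.mem_filter, Finset.mem_product, Finset.mem_range]
                refine ⟨⟨Finset.mem_univ _, by simp only; omega⟩, ?_⟩
                have h3 := sum_update_zero α.1 (min ij.2 (α.1 0))
                have h4 := α.2
                change ∑ i, Function.update α.1 0 (min ij.2 (α.1 0)) i + ij.1 ≤ k
                omega
      _ = ENNReal.ofReal (2 ^ (α.1 0)) *
          (ENNReal.ofReal (2 ^ k * bumpBound k) * hardySum F x) := by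
          rw [← Finset.sum_mul]
          congr 1
          rw [Finset.Nat.sum_antidiagonal_eq_sum_range_succ_mk]
          simp only
          rw [← Nat.cast_sum, Nat.sum_range_choose, ENNReal.ofReal_pow two_pos.le]
          norm_num
      _ ≤ ENNReal.ofReal (2 ^ k) * (ENNReal.ofReal (2 ^ k * bumpBound k) * hardySum F x) := by
          gcongr
          exact one_le_two
      _ = _ := by
          rw [← mul_assoc, ← ENNReal.ofReal_mul (by positivity), ← mul_assoc, ← mul_pow]
          norm_num
  · rw [indicator_of_notMem hxn, Finset.sum_eq_zero fun ij _ => by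
      rw [iteratedDeriv_dyadicPart_eq_zero ij.1 hxn, zero_smul, smul_zero]]
    simp

end Cutoff
end

/-! ### From the Sobolev space into the interpolation space -/

noncomputable section

section Decomposition

variable {d : ℕ} [NeZero d] {X : Type*} [NormedAddCommGroup X] [NormedSpace ℂ X]
  {p : ℝ≥0∞} [Fact (1 ≤ p)] {k : ℕ} {γ : ℝ}

theorem sum_indicator_slab (s : Finset ℤ) (a : ℝ≥0∞) (x : EuclideanSpace ℝ (Fin d)) :
    ∑ n ∈ s, (slab d n).indicator (fun _ => a) x =
      (s.filter fun n : ℤ => x 0 ∈ Icc ((2 : ℝ) ^ (n - 1)) (2 ^ (n + 1))).card * a := by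
  rw [← nsmul_eq_mul, ← Finset.sum_const, Finset.sum_filter]
  refine Finset.sum_congr rfl fun n _ => ?_
  split_ifs with h
  · exact indicator_of_mem (s := slab d n) h _
  · exact indicator_of_notMem (s := slab d n) h _

theorem sum_indicator_slab_le (s : Finset ℤ) (a : ℝ≥0∞) (x : EuclideanSpace ℝ (Fin d)) :
    ∑ n ∈ s, (slab d n).indicator (fun _ => a) x ≤ 3 * a := by
  rw [sum_indicator_slab]
  by_cases hx : 0 < x 0
  · gcongr
    exact_mod_cast card_filter_dyadic_le s hx
  · rw [Finset.filter_false_of_mem fun n _ (hn : x 0 ∈ Icc _ _) =>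
      hx (lt_of_lt_of_le (zpow_pos two_pos _) hn.1)]
    simp

/-- Bounded overlap makes the pieces almost disjoint: at most three terms are present at each point,
and any one of them dominates the sum up to the factor 3. -/
theorem sum_indicator_slab_rpow_le (s : Finset ℤ) (a : ℝ≥0∞) {P : ℝ} (hP : 0 < P)
    (x : EuclideanSpace ℝ (Fin d)) :
    (∑ n ∈ s, (slab d n).indicator (fun _ => a) x) ^ P ≤
      3 ^ P * ∑ n ∈ s, (slab d n).indicator (fun _ => a ^ P) x := by
  by_cases h : ∃ n ∈ s, x ∈ slab d n
  · obtain ⟨n, hn, hx⟩ := h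
    calc _ ≤ (3 * a) ^ P := ENNReal.rpow_le_rpow (sum_indicator_slab_le s a x) hP.le
      _ = 3 ^ P * (slab d n).indicator (fun _ => a ^ P) x := by
        rw [ENNReal.mul_rpow_of_nonneg _ _ hP.le, indicator_of_mem hx]
      _ ≤ _ := mul_le_mul_right (Finset.single_le_sum
        (f := fun n => (slab d n).indicator (fun _ => a ^ P) x) (fun _ _ => zero_le) hn) _
  · push Not at h
    rw [Finset.sum_eq_zero fun n hn => indicator_of_notMem (h n hn) _, ENNReal.zero_rpow_of_pos hP]
    exact zero_le

theorem setLIntegral_weight_mul_rpow {δ P : ℝ} (hP : 0 ≤ P) {γ' : ℝ} (hδ : γ' + δ * P = γ) (n : ℤ)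
    {h : EuclideanSpace ℝ (Fin d) → ℝ≥0∞} (hm : Measurable h) :
    ∫⁻ x in slab d n, (weight δ x * h x) ^ P ∂(powerMeasure d γ') =
      ∫⁻ x in slab d n, h x ^ P ∂(powerMeasure d γ) := by
  rw [setLIntegral_powerMeasure _ (measurableSet_slab n) (slab_subset n)
      (F := fun x => (weight δ x * h x) ^ P) (((measurable_weight _).mul hm).pow_const _),
    setLIntegral_powerMeasure _ (measurableSet_slab n) (slab_subset n) (hm.pow_const _)]
  refine setLIntegral_congr_fun (measurableSet_slab n) fun x hx => ?_
  rw [ENNReal.mul_rpow_of_nonneg _ _ hP, weight_rpow _ hP, ← mul_assoc,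
    ← weight_add (slab_subset n hx), hδ]

/-- The constant in `lintegral_sum_smul_partDeriv_le`. -/
def partConst (k : ℕ) (P D : ℝ) : ℝ≥0∞ :=
  (3 * ENNReal.ofReal (2 ^ D * (4 ^ k * bumpBound k))) ^ P

theorem partConst_ne_top {P : ℝ} (hP : 0 ≤ P) (D : ℝ) : partConst k P D ≠ ∞ :=
  ENNReal.rpow_ne_top_of_nonneg hP (ENNReal.mul_ne_top (by simp) ENNReal.ofReal_ne_top)

/-- On slab n the coefficient is bounded by a multiple of |x₁|^δ, and γ' + δP = γ says that this
factor converts the weight γ' into γ. The right side therefore no longer involves γ' and serves both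
boundary lines. -/
theorem lintegral_sum_smul_partDeriv_le {P : ℝ} (hP : 0 < P) (F : weightedSobolev d X k p γ)
    {γ' δ D : ℝ} (hδ : γ' + δ * P = γ) (hD : |δ| ≤ D) (s : Finset ℤ) (c : ℤ → ℂ)
    (hc : ∀ n, ‖c n‖ ≤ ((2 : ℝ) ^ n) ^ δ) (α : MultiIndex d k) :
    ∫⁻ x, ‖(∑ n ∈ s, c n • partDeriv n F γ' α : WeightedLp d X p γ') x‖ₑ ^ P
        ∂(powerMeasure d γ') ≤
      partConst k P D * ∑ n ∈ s, ∫⁻ x in slab d n, hardySum F x ^ P ∂(powerMeasure d γ) := by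
  set K : ℝ≥0∞ := ENNReal.ofReal (2 ^ D * (4 ^ k * bumpBound k)) with hK
  have hB := bumpBound_nonneg k
  have hpt : ∀ᵐ x ∂(powerMeasure d γ'),
      ‖(∑ n ∈ s, c n • partDeriv n F γ' α : WeightedLp d X p γ') x‖ₑ ≤
        ∑ n ∈ s, (slab d n).indicator (fun _ => K * (weight δ x * hardySum F x)) x := by
    have h2 : ∀ᵐ x ∂(powerMeasure d γ'), ∀ n ∈ s,
        ‖(c n • partDeriv n F γ' α : WeightedLp d X p γ') x‖ₑ ≤
          (slab d n).indicator (fun _ => K * (weight δ x * hardySum F x)) x := by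
      refine (Finset.eventually_all _).2 fun n _ => ?_
      filter_upwards [Lp.coeFn_smul (c n) (partDeriv n F γ' α), enorm_partDeriv_le n F γ' α]
        with x hx hx2
      rw [hx, Pi.smul_apply, enorm_smul]
      by_cases hxn : x ∈ slab d n
      · rw [indicator_of_mem hxn] at hx2 ⊢
        have hx0 : 0 < x 0 := slab_subset n hxn
        have h1 : ‖c n‖ₑ ≤ ENNReal.ofReal (2 ^ D) * weight δ x := by
          rw [weight, ← ENNReal.ofReal_mul (by positivity), ← ofReal_norm, abs_of_pos hx0]
          refine ENNReal.ofReal_le_ofReal ((hc n).trans ((rpow_ge_of_dyadic hxn δ).trans ?_))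
          gcongr
          exact one_le_two
        calc _ ≤ (ENNReal.ofReal (2 ^ D) * weight δ x) *
              (ENNReal.ofReal (4 ^ k * bumpBound k) * hardySum F x) := mul_le_mul' h1 hx2
          _ = _ := by rw [hK, ENNReal.ofReal_mul (p := (2 : ℝ) ^ D) (by positivity)]; ring
      · rw [indicator_of_notMem hxn] at hx2 ⊢
        rw [nonpos_iff_eq_zero.1 hx2, mul_zero]
    filter_upwards [Lp.coeFn_fun_finsetSum s fun n => c n • partDeriv n F γ' α, h2] with x hx hx2
    rw [hx]
    exact (enorm_sum_le _ _).trans (Finset.sum_le_sum hx2)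
  have hm : Measurable fun x => (weight δ x * hardySum F x) ^ P :=
    ((measurable_weight _).mul (measurable_hardySum F)).pow_const _
  calc _ ≤ ∫⁻ x, 3 ^ P * ∑ n ∈ s, (slab d n).indicator
        (fun x => K ^ P * (weight δ x * hardySum F x) ^ P) x ∂(powerMeasure d γ') := by
        refine lintegral_mono_ae ?_
        filter_upwards [hpt] with x hx
        refine (ENNReal.rpow_le_rpow hx hP.le).trans ((sum_indicator_slab_rpow_le s _ hP x).trans ?_)
        rw [ENNReal.mul_rpow_of_nonneg _ _ hP.le]
        rfl
    _ = 3 ^ P * ∑ n ∈ s, K ^ P *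
        ∫⁻ x in slab d n, hardySum F x ^ P ∂(powerMeasure d γ) := by
      rw [lintegral_const_mul _ (Finset.measurable_fun_sum _ fun n _ =>
          (hm.const_mul _).indicator (measurableSet_slab n)),
        lintegral_finsetSum _ fun n _ => (hm.const_mul _).indicator (measurableSet_slab n)]
      congr 1
      refine Finset.sum_congr rfl fun n _ => ?_
      rw [lintegral_indicator (measurableSet_slab n), lintegral_const_mul _ hm,
        setLIntegral_weight_mul_rpow hP.le hδ n (measurable_hardySum F)]
    _ = _ := by
      rw [← Finset.mul_sum, ← mul_assoc, partConst, ENNReal.mul_rpow_of_nonneg _ _ hP.le]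

theorem enorm_sum_smul_partSobolev_rpow_le (hp : p ≠ ∞) (F : weightedSobolev d X k p γ)
    {γ' δ D : ℝ} (hδ : γ' + δ * p.toReal = γ) (hD : |δ| ≤ D) (s : Finset ℤ) (c : ℤ → ℂ)
    (hc : ∀ n, ‖c n‖ ≤ ((2 : ℝ) ^ n) ^ δ) :
    ‖∑ n ∈ s, c n • partSobolev n F γ'‖ₑ ^ p.toReal ≤
      ∑ n ∈ s, Fintype.card (MultiIndex d k) * partConst k p.toReal D *
        ∫⁻ x in slab d n, hardySum F x ^ p.toReal ∂(powerMeasure d γ) := by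
  have hP : 0 < p.toReal := one_pos.trans_le (one_le_toReal hp)
  have h1 : ‖∑ n ∈ s, c n • partSobolev n F γ'‖ₑ =
      ‖((∑ n ∈ s, c n • partSobolev n F γ' : weightedSobolev d X k p γ') :
        PiLp p fun _ : MultiIndex d k => WeightedLp d X p γ')‖ₑ := rfl
  rw [h1, PiLp.enorm_rpow_eq_sum hP, ← Finset.mul_sum, mul_assoc, ← nsmul_eq_mul,
    ← Finset.card_univ, ← Finset.sum_const]
  refine Finset.sum_le_sum fun α _ => ?_
  rw [← lintegral_enorm_rpow_eq hp]
  have h2 : ((∑ n ∈ s, c n • partSobolev n F γ' : weightedSobolev d X k p γ') :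
      PiLp p fun _ : MultiIndex d k => WeightedLp d X p γ') α =
      ∑ n ∈ s, c n • partDeriv n F γ' α :=
    map_sum (((PiLp.projₗ p (𝕜 := ℂ) (fun _ : MultiIndex d k => WeightedLp d X p γ') α)).comp
      (weightedSobolev d X k p γ').subtype) _ _ |>.trans (Finset.sum_congr rfl fun n _ => by
        rw [map_smul]; rfl)
  rw [h2]
  exact lintegral_sum_smul_partDeriv_le hP F hδ hD s c hc α

theorem sum_setLIntegral_slab_le {h : EuclideanSpace ℝ (Fin d) → ℝ≥0∞} (hm : Measurable h)
    (s : Finset ℤ) (μ : Measure (EuclideanSpace ℝ (Fin d))) :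
    ∑ n ∈ s, ∫⁻ x in slab d n, h x ∂μ ≤ 3 * ∫⁻ x, h x ∂μ := by
  rw [← lintegral_const_mul _ hm]
  simp_rw [← lintegral_indicator (measurableSet_slab _)]
  rw [← lintegral_finsetSum _ fun n _ => hm.indicator (measurableSet_slab n)]
  exact lintegral_mono fun x => sum_indicator_slab_le s (h x) x

/-- The constant in `exists_stripFunction_sobolevCouple`. -/
def upperConst (d k : ℕ) (P D γ : ℝ) : ℝ≥0∞ :=
  Fintype.card (MultiIndex d k) * partConst k P D * (3 * hardySumConst d k P γ)

theorem upperConst_ne_top {P : ℝ} (hP : 1 ≤ P) (D γ : ℝ) : upperConst d k P D γ ≠ ∞ :=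
  ENNReal.mul_ne_top (ENNReal.mul_ne_top (by simp) (partConst_ne_top (by linarith) D))
    (ENNReal.mul_ne_top (by simp) (hardySumConst_ne_top hP γ))

theorem exists_stripFunction_sobolevCouple [CompleteSpace X] (hp : p ≠ ∞) {γ₀ γ₁ θ : ℝ}
    (hθ₀ : 0 < θ) (hθ₁ : θ < 1) (hγ : γ = (1 - θ) * γ₀ + θ * γ₁) (hk : k * p.toReal - 1 < γ)
    (F : weightedSobolev d X k p γ) :
    ∃ f : (sobolevCouple d X k p γ₀ γ₁).StripFunction,
      (sobolevCouple d X k p γ₀ γ₁).sumIncl (f.toFun θ) = sobolevToDistribution d X k p γ F ∧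
      f.size ≤ (upperConst d k p.toReal (|(γ₁ - γ₀) / p.toReal|) γ).toReal ^ p.toReal⁻¹ * ‖F‖ := by
  have hP1 := one_le_toReal hp
  have hP : 0 < p.toReal := one_pos.trans_le hP1
  set P := p.toReal
  -- With exponent -nη log 2 the coefficients have modulus 2^(nθη) on Re z = 0 and 2^(-n(1-θ)η) on
  -- Re z = 1, and θηP = γ - γ₀, -(1-θ)ηP = γ - γ₁.
  set η : ℝ := (γ₁ - γ₀) / P
  have hηP : η * P = γ₁ - γ₀ := div_mul_cancel₀ _ hP.ne'
  -- The mass of `hardySum` on slab n; the masses are summable by bounded overlap and Hardy's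
  -- inequality.
  set M : ℤ → ℝ≥0∞ := fun n => Fintype.card (MultiIndex d k) * partConst k P |η| *
    ∫⁻ x in slab d n, hardySum F x ^ P ∂(powerMeasure d γ)
  have hMs (s : Finset ℤ) : ∑ n ∈ s, M n ≤ upperConst d k P |η| γ * ‖F‖ₑ ^ P := by
    rw [← Finset.mul_sum]
    calc _ ≤ Fintype.card (MultiIndex d k) * partConst k P |η| *
          (3 * (hardySumConst d k P γ * ‖F‖ₑ ^ P)) := by
          refine mul_le_mul_right ?_ _
          refine (sum_setLIntegral_slab_le ((measurable_hardySum F).pow_const _) _ _).trans ?_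
          exact mul_le_mul_right (lintegral_hardySum_rpow_le hp hk F) _
      _ = _ := by rw [upperConst]; ring
  have htop : upperConst d k P |η| γ * ‖F‖ₑ ^ P ≠ ∞ :=
    ENNReal.mul_ne_top (upperConst_ne_top hP1 _ _) (rpow_enorm_ne_top hp F)
  have hMtop (n : ℤ) : M n ≠ ∞ := by
    have := hMs {n}
    rw [Finset.sum_singleton] at this
    exact ne_top_of_le_ne_top htop this
  have hreal (s : Finset ℤ) : ∑ n ∈ s, (M n).toReal ≤
      (upperConst d k P |η| γ * ‖F‖ₑ ^ P).toReal := by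
    rw [← ENNReal.toReal_sum fun n _ => hMtop n]
    exact ENNReal.toReal_mono htop (hMs s)
  have hsum : Summable fun n => (M n).toReal :=
    summable_of_sum_le (fun _ => ENNReal.toReal_nonneg) hreal
  have key {γ' δ : ℝ} (hδ : γ' + δ * P = γ) (hD : |δ| ≤ |η|) (s : Finset ℤ) (c : ℤ → ℂ)
      (hc : ∀ n, ‖c n‖ ≤ ((2 : ℝ) ^ n) ^ δ) :
      ‖∑ n ∈ s, c n • partSobolev n F γ'‖ ≤ (∑ n ∈ s, (M n).toReal) ^ P⁻¹ := by
    have h := enorm_sum_smul_partSobolev_rpow_le hp F hδ hD s c hc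
    have h2 := ENNReal.toReal_mono (ENNReal.sum_ne_top.2 fun n _ => hMtop n) h
    rw [ENNReal.toReal_sum fun n _ => hMtop n, ← ENNReal.toReal_rpow, toReal_enorm] at h2
    exact (Real.le_rpow_inv_iff_of_pos (norm_nonneg _)
      (Finset.sum_nonneg fun _ _ => ENNReal.toReal_nonneg) hP).2 h2
  have hexp (n : ℤ) (u : ℝ) : Real.exp (u * (n * Real.log 2)) = ((2 : ℝ) ^ n) ^ u := by
    rw [Real.rpow_def_of_pos (by positivity), Real.log_zpow, mul_comm]
  obtain ⟨f, hf, hfs⟩ := (sobolevCouple d X k p γ₀ γ₁).exists_stripFunction_hasSum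
    (x := fun n : ℤ => partSobolev n F γ₀) (y := fun n : ℤ => partSobolev n F γ₁)
    (fun n => (sobolevToDistribution_partSobolev n F γ₀).trans
      (sobolevToDistribution_partSobolev n F γ₁).symm)
    (fun n => -η * (n * Real.log 2)) hθ₀ hθ₁ (m := fun n => (M n).toReal)
    (fun _ => ENNReal.toReal_nonneg) hsum (q := P⁻¹) (by positivity)
    (fun s c hc => key (δ := θ * η) (by rw [mul_assoc, hηP, hγ]; ring)
      (by rw [abs_mul, abs_of_pos hθ₀]; exact mul_le_of_le_one_left (abs_nonneg _) hθ₁.le) s c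
      fun n => by rw [← hexp]; convert hc n using 2; ring)
    (fun s c hc => key (δ := -(1 - θ) * η) (by rw [mul_assoc, hηP, hγ]; ring)
      (by
        rw [abs_mul, abs_neg, abs_of_pos (by linarith)]
        exact mul_le_of_le_one_left (abs_nonneg _) (by linarith)) s c
      fun n => by rw [← hexp]; convert hc n using 2; ring)
  refine ⟨f, ?_, hf.trans ?_⟩
  -- The series converges to the value at θ in the space of distributions, and tested against `φ` it
  -- sums to F, so the two limits agree.
  · ext φ
    have hc : Continuous fun T : 𝓓'(halfSpace d, X) => T φ := continuous_eval_const φ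
    have h1 := hfs.map (⟨⟨fun T : 𝓓'(halfSpace d, X) => T φ, rfl⟩, fun _ _ => rfl⟩ :
      𝓓'(halfSpace d, X) →+ X) hc
    refine h1.unique ?_
    refine (sum_mulDist_dyadicPart (sobolevToDistribution d X k p γ F) φ).congr_fun fun n => ?_
    change sobolevToDistribution d X k p γ₀ (partSobolev n F γ₀) φ = _
    rw [sobolevToDistribution_partSobolev]
  · have h1 : ∑' n, (M n).toReal ≤ (upperConst d k P |η| γ * ‖F‖ₑ ^ P).toReal :=
      hsum.tsum_le_of_sum_le hreal
    rw [ENNReal.toReal_mul, ← ENNReal.toReal_rpow, toReal_enorm] at h1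
    calc _ ≤ ((upperConst d k P |η| γ).toReal * ‖F‖ ^ P) ^ P⁻¹ :=
          Real.rpow_le_rpow (tsum_nonneg fun _ => ENNReal.toReal_nonneg) h1 (by positivity)
      _ = _ := by
        rw [Real.mul_rpow ENNReal.toReal_nonneg (by positivity),
          ← Real.rpow_mul (norm_nonneg _), mul_inv_cancel₀ hP.ne', Real.rpow_one]

end Decomposition
end

/-! ### Restriction of derivatives to slabs on the sum space -/

noncomputable section

section Restriction

variable {d : ℕ} [NeZero d] {X : Type*} [NormedAddCommGroup X] [NormedSpace ℂ X]
  {p : ℝ≥0∞} [Fact (1 ≤ p)] {k : ℕ}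

theorem memLp_restrict_slab (n : ℤ) (γ : ℝ) {γ' : ℝ} (f : WeightedLp d X p γ') :
    MemLp f p ((powerMeasure d γ).restrict (slab d n)) :=
  (Lp.memLp f).of_measure_le_smul ENNReal.ofReal_ne_top (restrict_slab_powerMeasure_le n γ' γ)

theorem setLIntegral_slab_le (n : ℤ) (γ γ' : ℝ) (h : EuclideanSpace ℝ (Fin d) → ℝ≥0∞) :
    ∫⁻ x in slab d n, h x ∂(powerMeasure d γ) ≤
      ENNReal.ofReal (2 ^ |γ - γ'| * ((2 : ℝ) ^ n) ^ (γ - γ')) *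
        ∫⁻ x in slab d n, h x ∂(powerMeasure d γ') := by
  have h1 := Measure.restrict_mono_measure (restrict_slab_powerMeasure_le (d := d) n γ' γ) (slab d n)
  rw [Measure.restrict_restrict (measurableSet_slab n), inter_self, Measure.restrict_smul] at h1
  refine (lintegral_mono' h1 le_rfl).trans_eq ?_
  rw [lintegral_smul_measure, smul_eq_mul]

/-- The restriction of a function to a dyadic slab, with a change of the weight. -/
def restrictSlab (n : ℤ) (γ γ' : ℝ) :
    WeightedLp d X p γ' →ₗ[ℂ] Lp X p ((powerMeasure d γ).restrict (slab d n)) where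
  toFun f := (memLp_restrict_slab n γ f).toLp
  map_add' f g := by
    rw [← MemLp.toLp_add]
    refine MemLp.toLp_congr _ _ ?_
    exact (Measure.absolutelyContinuous_of_le_smul (restrict_slab_powerMeasure_le n γ' γ)).ae_le
      (Lp.coeFn_add f g)
  map_smul' c f := by
    rw [RingHom.id_apply, ← MemLp.toLp_const_smul]
    refine MemLp.toLp_congr _ _ ?_
    exact (Measure.absolutelyContinuous_of_le_smul (restrict_slab_powerMeasure_le n γ' γ)).ae_le
      (Lp.coeFn_smul c f)

theorem coeFn_restrictSlab (n : ℤ) (γ : ℝ) {γ' : ℝ} (f : WeightedLp d X p γ') :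
    restrictSlab n γ γ' f =ᵐ[(powerMeasure d γ).restrict (slab d n)] f :=
  (memLp_restrict_slab n γ f).coeFn_toLp

theorem enorm_restrictSlab_rpow (hp : p ≠ ∞) (n : ℤ) (γ : ℝ) {γ' : ℝ} (f : WeightedLp d X p γ') :
    ‖restrictSlab n γ γ' f‖ₑ ^ p.toReal =
      ∫⁻ x in slab d n, ‖f x‖ₑ ^ p.toReal ∂(powerMeasure d γ) := by
  rw [← lintegral_enorm_rpow_eq hp]
  refine lintegral_congr_ae ?_
  filter_upwards [coeFn_restrictSlab n γ f] with x hx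
  rw [hx]

theorem enorm_restrictSlab_rpow_le (hp : p ≠ ∞) (n : ℤ) (γ : ℝ) {γ' : ℝ}
    (f : WeightedLp d X p γ') : ‖restrictSlab n γ γ' f‖ₑ ^ p.toReal ≤
      ENNReal.ofReal (2 ^ |γ - γ'| * ((2 : ℝ) ^ n) ^ (γ - γ')) *
        ∫⁻ x in slab d n, ‖f x‖ₑ ^ p.toReal ∂(powerMeasure d γ') := by
  rw [enorm_restrictSlab_rpow hp]
  exact setLIntegral_slab_le n γ γ' _

theorem continuous_restrictSlab (n : ℤ) (γ γ' : ℝ) :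
    Continuous (restrictSlab (d := d) (X := X) (p := p) n γ γ') := by
  set c := ENNReal.ofReal (2 ^ |γ - γ'| * ((2 : ℝ) ^ n) ^ (γ - γ')) ^ (1 / p).toReal
  have hct : c ≠ ∞ := ENNReal.rpow_ne_top_of_nonneg ENNReal.toReal_nonneg ENNReal.ofReal_ne_top
  refine AddMonoidHomClass.continuous_of_bound _ c.toReal fun f => ?_
  rw [← toReal_enorm, ← toReal_enorm f, ← ENNReal.toReal_mul]
  refine ENNReal.toReal_mono (ENNReal.mul_ne_top hct enorm_ne_top) ?_
  rw [Lp.enorm_def, Lp.enorm_def, eLpNorm_congr_ae (coeFn_restrictSlab n γ f)]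
  exact (eLpNorm_mono_measure _ (restrict_slab_powerMeasure_le n γ' γ)).trans
    (eLpNorm_smul_measure_le _ _ _ _)

/-- The derivative of order `α`, as a continuous linear map. -/
def sobolevDeriv (γ : ℝ) (α : MultiIndex d k) : weightedSobolev d X k p γ →L[ℂ] WeightedLp d X p γ :=
  PiLp.proj p (fun _ : MultiIndex d k => WeightedLp d X p γ) α ∘L
    (weightedSobolev d X k p γ).subtypeL

theorem lpToDistribution_sobolevDeriv {γ : ℝ} (α : MultiIndex d k) (F : weightedSobolev d X k p γ) :
    lpToDistribution d X p γ (sobolevDeriv γ α F) =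
      distribDeriv α.1 (sobolevToDistribution d X k p γ F) :=
  F.2 α

theorem enorm_sobolevDeriv_rpow_le (hp : p ≠ ∞) {γ : ℝ} (α : MultiIndex d k)
    (F : weightedSobolev d X k p γ) :
    ∫⁻ x, ‖sobolevDeriv γ α F x‖ₑ ^ p.toReal ∂(powerMeasure d γ) ≤ ‖F‖ₑ ^ p.toReal := by
  exact enorm_apply_rpow_le hp F α

section Sum

variable [CompleteSpace X] {γ₀ γ₁ : ℝ}

theorem lpToDistribution_add_eq_distribDeriv (α : MultiIndex d k)
    (a : weightedSobolev d X k p γ₀) (b : weightedSobolev d X k p γ₁) :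
    lpToDistribution d X p γ₀ (sobolevDeriv γ₀ α a) +
        lpToDistribution d X p γ₁ (sobolevDeriv γ₁ α b) =
      distribDeriv α.1 (sobolevToDistribution d X k p γ₀ a + sobolevToDistribution d X k p γ₁ b) := by
  obtain ⟨L, hL⟩ := distribDeriv_linear (X := X) α.1
  rw [lpToDistribution_sobolevDeriv, lpToDistribution_sobolevDeriv, ← hL, ← hL, ← hL, map_add]

theorem lpToDistribution_add_apply (f : WeightedLp d X p γ₀) (g : WeightedLp d X p γ₁)
    (φ : 𝓓(halfSpace d, ℝ)) :
    (lpToDistribution d X p γ₀ f + lpToDistribution d X p γ₁ g) φ = ∫ x, φ x • (f x + g x) := by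
  simp only [smul_add]
  rw [integral_add (integrable_testFunction_smul f φ) (integrable_testFunction_smul g φ),
    ← lpToDistribution_apply, ← lpToDistribution_apply]
  rfl

/-- The two functions lie in different weighted spaces, so injectivity on one space does not apply;
their pointwise sum is still locally integrable on the half-space. Null sets do not depend on the
weight. -/
theorem add_eq_zero_of_lpToDistribution_add_eq_zero {f : WeightedLp d X p γ₀}
    {g : WeightedLp d X p γ₁}
    (h : lpToDistribution d X p γ₀ f + lpToDistribution d X p γ₁ g = 0) (γ : ℝ) :
    ∀ᵐ x ∂(powerMeasure d γ), f x + g x = 0 := by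
  have h1 := (halfSpace d).isOpen.ae_eq_zero_of_integral_contDiff_smul_eq_zero
    (f := fun x => f x + g x)
    ((locallyIntegrableOn_weightedLp f).add (locallyIntegrableOn_weightedLp g))
    fun φ hφ hφc hφs => by
      have := lpToDistribution_add_apply f g ⟨φ, hφ, hφc, hφs⟩
      rw [h] at this
      exact this.symm
  rwa [← ae_restrict_iff' (halfSpace d).isOpen.measurableSet, Filter.Eventually,
    ← ae_powerMeasure γ] at h1

/-- The restriction of the derivative of order `α` to a dyadic slab, on the sum of two weighted
Sobolev spaces. -/
def sumRestrict (k : ℕ) (γ₀ γ₁ : ℝ) (n : ℤ) (γ : ℝ) (α : MultiIndex d k) :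
    (sobolevCouple d X k p γ₀ γ₁).SumSpace →L[ℂ]
      Lp X p ((powerMeasure d γ).restrict (slab d n)) :=
  (sobolevCouple d X k p γ₀ γ₁).zeroPairs.liftQL
    (((⟨restrictSlab n γ γ₀, continuous_restrictSlab n γ γ₀⟩ :
        WeightedLp d X p γ₀ →L[ℂ] _) ∘L sobolevDeriv γ₀ α).coprod
      ((⟨restrictSlab n γ γ₁, continuous_restrictSlab n γ γ₁⟩ :
        WeightedLp d X p γ₁ →L[ℂ] _) ∘L sobolevDeriv γ₁ α)) (by
    rintro ⟨a, b⟩ hab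
    -- Well-definedness on the quotient: if a + b vanishes as a distribution, so does the sum of the
    -- derivatives, and hence their pointwise sum almost everywhere.
    have hab : sobolevToDistribution d X k p γ₀ a + sobolevToDistribution d X k p γ₁ b = 0 := hab
    have h1 := lpToDistribution_add_eq_distribDeriv α a b
    obtain ⟨L, hL⟩ := distribDeriv_linear (X := X) α.1
    rw [hab, ← hL, map_zero] at h1
    change restrictSlab n γ γ₀ (sobolevDeriv γ₀ α a) + restrictSlab n γ γ₁ (sobolevDeriv γ₁ α b) = 0
    rw [Lp.eq_zero_iff_ae_eq_zero]
    filter_upwards [Lp.coeFn_add (restrictSlab n γ γ₀ (sobolevDeriv γ₀ α a))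
        (restrictSlab n γ γ₁ (sobolevDeriv γ₁ α b)),
      coeFn_restrictSlab n γ (sobolevDeriv γ₀ α a), coeFn_restrictSlab n γ (sobolevDeriv γ₁ α b),
      ae_restrict_of_ae (add_eq_zero_of_lpToDistribution_add_eq_zero h1 γ)] with x h2 h3 h4 h5
    rw [h2, Pi.add_apply, h3, h4, h5, Pi.zero_apply])

theorem sumRestrict_mk (n : ℤ) (γ : ℝ) (α : MultiIndex d k)
    (a : weightedSobolev d X k p γ₀) (b : weightedSobolev d X k p γ₁) :
    sumRestrict k γ₀ γ₁ n γ α ((sobolevCouple d X k p γ₀ γ₁).zeroPairs.mkQ (a, b)) =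
      restrictSlab n γ γ₀ (sobolevDeriv γ₀ α a) + restrictSlab n γ γ₁ (sobolevDeriv γ₁ α b) :=
  rfl

theorem enorm_sumRestrict_mk_rpow (hp : p ≠ ∞) (n : ℤ) (γ : ℝ) (α : MultiIndex d k)
    (a : weightedSobolev d X k p γ₀) (b : weightedSobolev d X k p γ₁) :
    ‖sumRestrict k γ₀ γ₁ n γ α ((sobolevCouple d X k p γ₀ γ₁).zeroPairs.mkQ (a, b))‖ₑ ^ p.toReal =
      ∫⁻ x in slab d n, ‖sobolevDeriv γ₀ α a x + sobolevDeriv γ₁ α b x‖ₑ ^ p.toReal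
        ∂(powerMeasure d γ) := by
  rw [sumRestrict_mk, ← lintegral_enorm_rpow_eq hp]
  refine lintegral_congr_ae ?_
  filter_upwards [Lp.coeFn_add (restrictSlab n γ γ₀ (sobolevDeriv γ₀ α a))
      (restrictSlab n γ γ₁ (sobolevDeriv γ₁ α b)),
    coeFn_restrictSlab n γ (sobolevDeriv γ₀ α a), coeFn_restrictSlab n γ (sobolevDeriv γ₁ α b)]
    with x h2 h3 h4
  rw [h2, Pi.add_apply, h3, h4]

theorem sumRestrict_toSum₀ (n : ℤ) (γ : ℝ) (α : MultiIndex d k)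
    (a : weightedSobolev d X k p γ₀) :
    sumRestrict k γ₀ γ₁ n γ α ((sobolevCouple d X k p γ₀ γ₁).toSum₀ a) =
      restrictSlab n γ γ₀ (sobolevDeriv γ₀ α a) := by
  change sumRestrict k γ₀ γ₁ n γ α ((sobolevCouple d X k p γ₀ γ₁).zeroPairs.mkQ (a, 0)) = _
  rw [sumRestrict_mk, map_zero, map_zero, add_zero]

theorem sumRestrict_toSum₁ (n : ℤ) (γ : ℝ) (α : MultiIndex d k)
    (b : weightedSobolev d X k p γ₁) :
    sumRestrict k γ₀ γ₁ n γ α ((sobolevCouple d X k p γ₀ γ₁).toSum₁ b) =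
      restrictSlab n γ γ₁ (sobolevDeriv γ₁ α b) := by
  change sumRestrict k γ₀ γ₁ n γ α ((sobolevCouple d X k p γ₀ γ₁).zeroPairs.mkQ (0, b)) = _
  rw [sumRestrict_mk, map_zero, map_zero, zero_add]

end Sum

/-- The constant in `sum_enorm_smul_restrictSlab_le`. -/
def lowerConst (D : ℝ) : ℝ≥0∞ := 3 * ENNReal.ofReal (2 ^ D)

theorem lowerConst_ne_top (D : ℝ) : lowerConst D ≠ ∞ :=
  ENNReal.mul_ne_top (by simp) ENNReal.ofReal_ne_top

/-- The scalar compensates the change of weight on slab n up to the factor 2^|γ - γ'|, so the sum is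
an integral in the original weight γ', counted with overlap at most three. -/
theorem sum_enorm_smul_restrictSlab_le (hp : p ≠ ∞) {γ γ' D : ℝ} (hD : |γ - γ'| ≤ D)
    (s : Finset ℤ) {c : ℤ → ℂ} (hc : ∀ n, ‖c n‖ ^ p.toReal ≤ ((2 : ℝ) ^ n) ^ (γ' - γ))
    (α : MultiIndex d k) (F : weightedSobolev d X k p γ') :
    ∑ n ∈ s, ‖c n • restrictSlab n γ γ' (sobolevDeriv γ' α F)‖ₑ ^ p.toReal ≤
      lowerConst D * ‖F‖ₑ ^ p.toReal := by
  have hP : 0 < p.toReal := one_pos.trans_le (one_le_toReal hp)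
  have hm : Measurable fun x => ‖sobolevDeriv γ' α F x‖ₑ ^ p.toReal :=
    (Lp.stronglyMeasurable (sobolevDeriv γ' α F)).enorm.pow_const _
  calc _ ≤ ∑ n ∈ s, ENNReal.ofReal (2 ^ D) *
        ∫⁻ x in slab d n, ‖sobolevDeriv γ' α F x‖ₑ ^ p.toReal ∂(powerMeasure d γ') := by
        refine Finset.sum_le_sum fun n _ => ?_
        have h2 : (0 : ℝ) < 2 ^ n := by positivity
        rw [enorm_smul, ENNReal.mul_rpow_of_nonneg _ _ hP.le]
        calc _ ≤ ENNReal.ofReal (((2 : ℝ) ^ n) ^ (γ' - γ)) *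
              (ENNReal.ofReal (2 ^ |γ - γ'| * ((2 : ℝ) ^ n) ^ (γ - γ')) *
              ∫⁻ x in slab d n, ‖sobolevDeriv γ' α F x‖ₑ ^ p.toReal ∂(powerMeasure d γ')) := by
              refine mul_le_mul' ?_ (enorm_restrictSlab_rpow_le hp n γ _)
              rw [← ofReal_norm, ENNReal.ofReal_rpow_of_nonneg (norm_nonneg _) hP.le]
              exact ENNReal.ofReal_le_ofReal (hc n)
          _ = ENNReal.ofReal (2 ^ |γ - γ'|) *
              ∫⁻ x in slab d n, ‖sobolevDeriv γ' α F x‖ₑ ^ p.toReal ∂(powerMeasure d γ') := by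
              rw [← mul_assoc, ← ENNReal.ofReal_mul (by positivity), mul_left_comm,
                ← Real.rpow_add h2]
              simp
          _ ≤ _ := by
              gcongr
              exact one_le_two
    _ ≤ ENNReal.ofReal (2 ^ D) * (3 * ‖F‖ₑ ^ p.toReal) := by
        rw [← Finset.mul_sum]
        refine mul_le_mul_right ((sum_setLIntegral_slab_le hm s _).trans ?_) _
        exact mul_le_mul_right (enorm_sobolevDeriv_rpow_le hp α F) _
    _ = _ := by rw [lowerConst]; ring

end Restriction
end

/-! ### Three lines in ℓ^p sums and the converse inclusion -/

noncomputable section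

namespace CompatibleCouple

variable {E₀ E₁ V : Type*}
  [NormedAddCommGroup E₀] [NormedSpace ℂ E₀] [NormedAddCommGroup E₁] [NormedSpace ℂ E₁]
  [AddCommGroup V] [Module ℂ V] [TopologicalSpace V] [T2Space V] [ContinuousAdd V]
  {A : CompatibleCouple E₀ E₁ V}

open Complex.HadamardThreeLines

/-- The three lines theorem for `ℓ^p` sums of images of a strip function under operators
`R n` with weights `exp (e n)`. -/
theorem StripFunction.sum_enorm_rpow_le (f : A.StripFunction) {p : ℝ≥0∞} [Fact (1 ≤ p)]
    (hP : 0 < p.toReal) {ι : Type*} (s : Finset ι) {G : ι → Type*} [∀ n, NormedAddCommGroup (G n)]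
    [∀ n, NormedSpace ℂ (G n)] (R : ∀ n, A.SumSpace →L[ℂ] G n) (e : ι → ℝ) {θ : ℝ} (hθ₀ : 0 < θ)
    (hθ₁ : θ < 1) {N : ℝ≥0∞} (hN : N ≠ ∞)
    (h0 : ∀ (t : ℝ) (c : ι → ℂ), (∀ n, ‖c n‖ = Real.exp (-θ * e n)) →
      ∑ n ∈ s, ‖c n • R n (A.toSum₀ (f.bd₀ t))‖ₑ ^ p.toReal ≤ N)
    (h1 : ∀ (t : ℝ) (c : ι → ℂ), (∀ n, ‖c n‖ = Real.exp ((1 - θ) * e n)) →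
      ∑ n ∈ s, ‖c n • R n (A.toSum₁ (f.bd₁ t))‖ₑ ^ p.toReal ≤ N) :
    ∑ n ∈ s, ‖R n (f.toFun θ)‖ₑ ^ p.toReal ≤ N := by
  let c (n : ι) (z : ℂ) : ℂ := Complex.exp (e n * (z - θ))
  have hcnorm (n : ι) (z : ℂ) : ‖c n z‖ = Real.exp (e n * (z.re - θ)) := by
    simp [c, Complex.norm_exp]
  have hcd (n : ι) : Differentiable ℂ (c n) := by fun_prop
  let h (z : ℂ) (n : s) : G n := c n z • R n (f.toFun z)
  -- The finite family becomes a single function with values in an ℓ^p sum, to which the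
  -- vector-valued three lines theorem applies.
  let Φ := (PiLp.continuousLinearEquiv p ℂ fun n : s => G n).symm
  have hg (z : ℂ) : ‖Φ (h z)‖ₑ ^ p.toReal = ∑ n ∈ s, ‖c n z • R n (f.toFun z)‖ₑ ^ p.toReal := by
    rw [PiLp.enorm_rpow_eq_sum hP]
    exact Finset.sum_coe_sort s fun n => ‖c n z • R n (f.toFun z)‖ₑ ^ p.toReal
  have hNtop : N ^ p.toReal⁻¹ ≠ ∞ := ENNReal.rpow_ne_top_of_nonneg (by positivity) hN
  have hiff (z : ℂ) : ‖Φ (h z)‖ ≤ (N ^ p.toReal⁻¹).toReal ↔ ‖Φ (h z)‖ₑ ^ p.toReal ≤ N := by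
    rw [← ENNReal.ofReal_le_iff_le_toReal hNtop, ofReal_norm, ENNReal.le_rpow_inv_iff hP]
  have hθ : ‖Φ (h θ)‖ ≤ (N ^ p.toReal⁻¹).toReal := by
    refine norm_le_of_norm_le_on_strip_boundary (f := fun z => Φ (h z)) ?_ ?_ (fun t => ?_)
      (fun t => ?_) (z := θ) ⟨by simpa using hθ₀.le, by simpa using hθ₁.le⟩
    · refine Φ.toContinuousLinearMap.differentiable.comp_diffContOnCl (g := h) ?_
      have hn (n : s) : DiffContOnCl ℂ (fun z => h z n) (verticalStrip 0 1) :=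
        (hcd n).diffContOnCl.smul ((R n).differentiable.comp_diffContOnCl f.diffContOnCl)
      exact ⟨differentiableOn_pi.2 fun n => (hn n).1, continuousOn_pi.2 fun n => (hn n).2⟩
    · obtain ⟨B, hB⟩ := f.bounded
      have hB0 : 0 ≤ B := (norm_nonneg _).trans (hB 0 (by simp [verticalClosedStrip]))
      -- A crude bound suffices: it depends on the finite set but only feeds the boundedness
      -- hypothesis and does not enter the conclusion.
      refine ⟨‖Φ.toContinuousLinearMap‖ * ∑ n : s, Real.exp |e n| * (‖R n‖ * B), fun z hz => ?_⟩
      refine Φ.toContinuousLinearMap.le_opNorm_of_le ?_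
      refine (pi_norm_le_iff_of_nonneg (Finset.sum_nonneg fun n _ => by positivity)).2 fun n => ?_
      refine le_trans ?_ (Finset.single_le_sum
        (f := fun n : s => Real.exp |e n| * (‖R n‖ * B)) (fun n _ => by positivity)
        (Finset.mem_univ n))
      rw [norm_smul, hcnorm]
      gcongr
      · have : |z.re - θ| ≤ 1 := by
          have := hz.1; have := hz.2
          rw [abs_le]; constructor <;> linarith
        refine (le_abs_self _).trans ?_
        rw [abs_mul]
        exact mul_le_of_le_one_right (abs_nonneg _) this
      · exact ContinuousLinearMap.le_opNorm_of_le _ (hB z hz)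
    · rw [hiff, hg, f.eq_bd₀]
      exact h0 t (fun n => c n (t * Complex.I)) fun n => by rw [hcnorm]; simp [mul_comm]
    · rw [hiff, hg, f.eq_bd₁]
      exact h1 t (fun n => c n (1 + t * Complex.I)) fun n => by rw [hcnorm]; simp [mul_comm]
  rw [hiff, hg] at hθ
  simpa [c] using hθ

end CompatibleCouple

section LowerEstimate

variable {d : ℕ} [NeZero d] {X : Type*} [NormedAddCommGroup X] [NormedSpace ℂ X]
  [CompleteSpace X] {p : ℝ≥0∞} [Fact (1 ≤ p)] {k : ℕ} {γ₀ γ₁ γ θ : ℝ}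

/-- The exponents are n log 2 (γ₁ - γ₀)/p, opposite in sign to those of the construction: on Re z =
j the p-th power of the scalar has modulus 2^(n(γⱼ - γ)), which undoes the passage from weight γⱼ to
γ on slab n. -/
theorem sum_enorm_sumRestrict_le (hp : p ≠ ∞) (hθ₀ : 0 < θ) (hθ₁ : θ < 1)
    (hγ : γ = (1 - θ) * γ₀ + θ * γ₁) (f : (sobolevCouple d X k p γ₀ γ₁).StripFunction)
    (s : Finset ℤ) (α : MultiIndex d k) :
    ∑ n ∈ s, ‖sumRestrict k γ₀ γ₁ n γ α (f.toFun θ)‖ₑ ^ p.toReal ≤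
      lowerConst |γ₁ - γ₀| * ENNReal.ofReal f.size ^ p.toReal := by
  have hP : 0 < p.toReal := one_pos.trans_le (one_le_toReal hp)
  have hexp (n : ℤ) (u : ℝ) :
      Real.exp (u * (n * Real.log 2 * ((γ₁ - γ₀) / p.toReal))) ^ p.toReal =
        ((2 : ℝ) ^ n) ^ (u * (γ₁ - γ₀)) := by
    rw [← Real.exp_mul, Real.rpow_def_of_pos (by positivity), Real.log_zpow]
    congr 1
    field_simp
  have hbd₀ (t : ℝ) : ‖f.bd₀ t‖ₑ ^ p.toReal ≤ ENNReal.ofReal f.size ^ p.toReal := by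
    rw [← ofReal_norm]
    gcongr
    exact (f.bd₀.norm_coe_le_norm t).trans (le_max_left _ _)
  have hbd₁ (t : ℝ) : ‖f.bd₁ t‖ₑ ^ p.toReal ≤ ENNReal.ofReal f.size ^ p.toReal := by
    rw [← ofReal_norm]
    gcongr
    exact (f.bd₁.norm_coe_le_norm t).trans (le_max_right _ _)
  refine f.sum_enorm_rpow_le hP s (fun n => sumRestrict k γ₀ γ₁ n γ α)
    (fun n => n * Real.log 2 * ((γ₁ - γ₀) / p.toReal)) hθ₀ hθ₁ (ENNReal.mul_ne_top
      (lowerConst_ne_top _) (ENNReal.rpow_ne_top_of_nonneg hP.le ENNReal.ofReal_ne_top))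
    (fun t c hc => ?_) (fun t c hc => ?_)
  · simp only [sumRestrict_toSum₀]
    refine (sum_enorm_smul_restrictSlab_le hp (D := |γ₁ - γ₀|) ?_ s (fun n => ?_) α
      (f.bd₀ t)).trans (mul_le_mul_right (hbd₀ t) _)
    · rw [show γ - γ₀ = θ * (γ₁ - γ₀) by rw [hγ]; ring, abs_mul, abs_of_pos hθ₀]
      exact mul_le_of_le_one_left (abs_nonneg _) hθ₁.le
    · rw [hc, hexp, show γ₀ - γ = -θ * (γ₁ - γ₀) by rw [hγ]; ring]
  · simp only [sumRestrict_toSum₁]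
    refine (sum_enorm_smul_restrictSlab_le hp (D := |γ₁ - γ₀|) ?_ s (fun n => ?_) α
      (f.bd₁ t)).trans (mul_le_mul_right (hbd₁ t) _)
    · rw [show γ - γ₁ = -(1 - θ) * (γ₁ - γ₀) by rw [hγ]; ring, abs_mul, abs_neg,
        abs_of_pos (by linarith)]
      exact mul_le_of_le_one_left (abs_nonneg _) (by linarith)
    · rw [hc, hexp, show γ₁ - γ = (1 - θ) * (γ₁ - γ₀) by rw [hγ]; ring]

theorem iUnion_slab : ⋃ n, slab d n = halfSpace d := by
  refine Subset.antisymm (iUnion_subset slab_subset) fun x hx => ?_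
  have hx : 0 < x 0 := hx
  have h1 := Int.zpow_log_le_self (b := 2) one_lt_two hx
  have h2 := Int.lt_zpow_succ_log_self (b := 2) one_lt_two (x 0)
  push_cast at h1 h2
  exact mem_iUnion.2 ⟨Int.log 2 (x 0),
    (zpow_le_zpow_right₀ one_le_two (by omega)).trans h1, h2.le⟩

theorem lintegral_le_of_sum_setLIntegral_slab_le {h : EuclideanSpace ℝ (Fin d) → ℝ≥0∞}
    {C : ℝ≥0∞} (hC : ∀ s : Finset ℤ, ∑ n ∈ s, ∫⁻ x in slab d n, h x ∂(powerMeasure d γ) ≤ C) :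
    ∫⁻ x, h x ∂(powerMeasure d γ) ≤ C := by
  rw [← restrict_powerMeasure, ← iUnion_slab]
  refine (lintegral_iUnion_le _ _).trans ?_
  rw [ENNReal.tsum_eq_iSup_sum]
  exact iSup_le hC

/-- Any splitting f(θ) = a + b gives candidates ∂^αa + ∂^αb for the derivatives. The slab bounds are
uniform over finite sets of slabs and hence add up to membership in L^p(w_γ). -/
theorem exists_weightedSobolev_of_stripFunction (hp : p ≠ ∞) (hθ₀ : 0 < θ) (hθ₁ : θ < 1)
    (hγ : γ = (1 - θ) * γ₀ + θ * γ₁) (f : (sobolevCouple d X k p γ₀ γ₁).StripFunction) :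
    ∃ F : weightedSobolev d X k p γ,
      sobolevToDistribution d X k p γ F = (sobolevCouple d X k p γ₀ γ₁).sumIncl (f.toFun θ) ∧
      ‖F‖ ≤ (Fintype.card (MultiIndex d k) * lowerConst |γ₁ - γ₀|).toReal ^ p.toReal⁻¹ *
        f.size := by
  have hP : 0 < p.toReal := one_pos.trans_le (one_le_toReal hp)
  have hp0 : p ≠ 0 := (zero_lt_one.trans_le (Fact.out : 1 ≤ p)).ne'
  obtain ⟨⟨a, b⟩, hab⟩ := (sobolevCouple d X k p γ₀ γ₁).zeroPairs.mkQ_surjective (f.toFun θ)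
  set v : MultiIndex d k → EuclideanSpace ℝ (Fin d) → X :=
    fun α x => sobolevDeriv γ₀ α a x + sobolevDeriv γ₁ α b x
  have hT : (sobolevCouple d X k p γ₀ γ₁).sumIncl (f.toFun θ) =
      sobolevToDistribution d X k p γ₀ a + sobolevToDistribution d X k p γ₁ b := by
    rw [← hab]; rfl
  set N : ℝ≥0∞ := lowerConst |γ₁ - γ₀| * ENNReal.ofReal f.size ^ p.toReal with hN
  have hNtop : N ≠ ∞ := ENNReal.mul_ne_top (lowerConst_ne_top _)
    (ENNReal.rpow_ne_top_of_nonneg hP.le ENNReal.ofReal_ne_top)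
  have hint (α : MultiIndex d k) : ∫⁻ x, ‖v α x‖ₑ ^ p.toReal ∂(powerMeasure d γ) ≤ N := by
    refine lintegral_le_of_sum_setLIntegral_slab_le fun s => ?_
    refine le_trans (le_of_eq ?_) (sum_enorm_sumRestrict_le hp hθ₀ hθ₁ hγ f s α)
    refine Finset.sum_congr rfl fun n _ => ?_
    rw [← hab, enorm_sumRestrict_mk_rpow hp]
  have hLp (α : MultiIndex d k) : MemLp (v α) p (powerMeasure d γ) :=
    ⟨((Lp.stronglyMeasurable _).add (Lp.stronglyMeasurable _)).aestronglyMeasurable,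
      (eLpNorm_lt_top_iff_lintegral_rpow_enorm_lt_top hp0 hp).2
        ((hint α).trans_lt hNtop.lt_top)⟩
  have hw (α : MultiIndex d k) : lpToDistribution d X p γ (hLp α).toLp =
      distribDeriv α.1 ((sobolevCouple d X k p γ₀ γ₁).sumIncl (f.toFun θ)) := by
    rw [hT, ← lpToDistribution_add_eq_distribDeriv]
    ext φ
    rw [lpToDistribution_apply, lpToDistribution_add_apply]
    refine integral_congr_ae ?_
    filter_upwards [ae_volume_of_ae (hLp α).coeFn_toLp φ] with x hx
    rcases hx with hx | hx
    · simp [hx]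
    · rw [hx]
  refine ⟨⟨WithLp.toLp p fun α => (hLp α).toLp, fun α => ?_⟩, ?_, ?_⟩
  · change lpToDistribution d X p γ (hLp α).toLp =
      distribDeriv α.1 (lpToDistribution d X p γ (hLp 0).toLp)
    rw [hw, hw, distribDeriv_zero]
  · change lpToDistribution d X p γ (hLp 0).toLp = _
    rw [hw, distribDeriv_zero]
  · set F : PiLp p fun _ : MultiIndex d k => WeightedLp d X p γ :=
      WithLp.toLp p fun α => (hLp α).toLp
    change ‖F‖ ≤ _
    have hsize : 0 ≤ f.size := (norm_nonneg _).trans (le_max_left _ _)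
    have h1 : ‖F‖ₑ ^ p.toReal ≤ Fintype.card (MultiIndex d k) * N := by
      rw [PiLp.enorm_rpow_eq_sum hP, ← nsmul_eq_mul, ← Finset.card_univ, ← Finset.sum_const]
      refine Finset.sum_le_sum fun α _ => ?_
      change ‖(hLp α).toLp‖ₑ ^ p.toReal ≤ N
      rw [← lintegral_enorm_rpow_eq hp]
      refine le_trans (le_of_eq (lintegral_congr_ae ?_)) (hint α)
      filter_upwards [(hLp α).coeFn_toLp] with x hx
      rw [hx]
    have h2 := ENNReal.toReal_mono (ENNReal.mul_ne_top (by simp) hNtop) h1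
    rw [hN, ← mul_assoc, ENNReal.toReal_mul, ← ENNReal.toReal_rpow, ← ENNReal.toReal_rpow,
      toReal_enorm, ENNReal.toReal_ofReal hsize] at h2
    refine ((Real.le_rpow_inv_iff_of_pos (norm_nonneg _) (by positivity) hP).2 h2).trans_eq ?_
    rw [Real.mul_rpow ENNReal.toReal_nonneg (by positivity), ← Real.rpow_mul hsize,
      mul_inv_cancel₀ hP.ne', Real.rpow_one]

end LowerEstimate
end
-- The interpolation identity
theorem mainTheorem7 (d k : ℕ) [NeZero d] (p : ℝ≥0∞) [Fact (1 ≤ p)] (hp₁ : 1 < p) (hp₂ : p < ∞)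
    (γ₀ γ₁ γ θ : ℝ) (hθ₀ : 0 < θ) (hθ₁ : θ < 1) (hγ₀ : -1 < γ₀) (h₀ : γ₀ < γ) (h₁ : γ < γ₁)
    (hγ : γ = (1 - θ) * γ₀ + θ * γ₁) (hk : k * p.toReal - 1 < γ) :
    ∃ C : ℝ, 0 < C ∧
      ∀ (X : Type*) [NormedAddCommGroup X] [NormedSpace ℂ X] [CompleteSpace X],
        ((sobolevCouple d X k p γ₀ γ₁).interpolationSpace θ : Set 𝓓'(halfSpace d, X)) =
            Set.range (sobolevToDistribution d X k p γ) ∧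
          ∀ f : weightedSobolev d X k p γ,
            ‖f‖ ≤ C * (sobolevCouple d X k p γ₀ γ₁).interpolationNorm θ
                (sobolevToDistribution d X k p γ f) ∧
              (sobolevCouple d X k p γ₀ γ₁).interpolationNorm θ
                (sobolevToDistribution d X k p γ f) ≤ C * ‖f‖ := by
  have hp : p ≠ ∞ := hp₂.ne
  set C₁ : ℝ := (Fintype.card (MultiIndex d k) * lowerConst |γ₁ - γ₀|).toReal ^ p.toReal⁻¹
  set C₂ : ℝ := (upperConst d k p.toReal (|(γ₁ - γ₀) / p.toReal|) γ).toReal ^ p.toReal⁻¹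
  have hC₁0 : 0 ≤ C₁ := by positivity
  have hC₂0 : 0 ≤ C₂ := by positivity
  -- Chosen before X is introduced; the summand 1 only ensures positivity.
  refine ⟨C₁ + C₂ + 1, by positivity, ?_⟩
  intro X _ _ _
  have hsize (f : (sobolevCouple d X k p γ₀ γ₁).StripFunction) : 0 ≤ f.size :=
    (norm_nonneg _).trans (le_max_left _ _)
  refine ⟨Subset.antisymm ?_ ?_, fun F => ?_⟩
  · rintro _ ⟨f, rfl⟩
    obtain ⟨F, hF, -⟩ := exists_weightedSobolev_of_stripFunction hp hθ₀ hθ₁ hγ f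
    exact ⟨F, hF⟩
  · rintro _ ⟨F, rfl⟩
    obtain ⟨f, hf, -⟩ := exists_stripFunction_sobolevCouple hp hθ₀ hθ₁ hγ hk F
    exact ⟨f, hf⟩
  · obtain ⟨f, hf, hfs⟩ := exists_stripFunction_sobolevCouple hp hθ₀ hθ₁ hγ hk F
    constructor
    · rw [← div_le_iff₀' (by positivity)]
      refine le_csInf ⟨_, f, hf, rfl⟩ ?_
      rintro _ ⟨g, hg, rfl⟩
      obtain ⟨G, hG, hGs⟩ := exists_weightedSobolev_of_stripFunction hp hθ₀ hθ₁ hγ g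
      -- The function recovered from an arbitrary competitor `g` represents the same distribution as
      -- F, so its norm bound is a bound for F.
      rw [sobolevToDistribution_injective k γ (hG.trans hg)] at hGs
      rw [div_le_iff₀' (by positivity)]
      refine hGs.trans (mul_le_mul_of_nonneg_right ?_ (hsize g))
      linarith
    · have hle := csInf_le (s := {r : ℝ | ∃ g : (sobolevCouple d X k p γ₀ γ₁).StripFunction,
        (sobolevCouple d X k p γ₀ γ₁).sumIncl (g.toFun θ) = sobolevToDistribution d X k p γ F ∧
          g.size = r}) ⟨0, by rintro _ ⟨g, -, rfl⟩; exact hsize g⟩ ⟨f, hf, rfl⟩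
      refine hle.trans (hfs.trans (mul_le_mul_of_nonneg_right ?_ (norm_nonneg _)))
      linarith
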